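/- **Setting.** Let $(X_t)_{t\in\mathbb Z}$ be a strictly stationary, square-integrable real process with $E X_t=0$ such that * (moment bound) for some constants $C<\infty$ and $1<\phi<2$, $E\big[\big(\sum_{t=i}^{j}X_t\big)^2\big]\le C\,(j-i+1)^{\phi}$ for all integers $1\le i\le j$; * (invariance principle) for some $\sigma>0$, $n^{-1/2}\sum_{t=1}^{\lfloor nr\rfloor}X_t\Rightarrow\sigma B(r)$ weakly in $D[0,1]$ with the Skorokhod topology, where $B$ is a standard Brownian motion. Let $m\ge 0$ be fixed. For each $n$ let $k_0=0$, $k_{m+1}=n$ and let $k_i=k_{i,n}$ $(1\le i\le m)$ be integers with $k_i/n\to\tau_i$, where $\tau_0=0$, $\tau_{m+1}=1$. Let $\epsilon\in(0,1/2)$ satisfy $\epsilon<\min_{1\le i\le m+1}(\tau_i-\tau_{i-1})$. The observations are $$Y_t=X_t+\mu_i,\qquad k_{i-1}<t\le k_i,\quad 1\le i\le m+1,$$ where the means $\mu_i=\mu_{i,n}$ satisfy $\mu_{i+1}-\mu_i=c_i\delta$ with fixed constants $c_i\ne0$ and a real sequence $\delta=\delta_n$ such that $n^{2-\phi}\delta^2\to\infty$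 (hence also $n\delta^2\to\infty$). **SNCP.** Let $\widehat\theta_{a,b}=\frac1{b-a+1}\sum_{t=a}^bY_t$. For $1\le t_1<k<t_2\le n$ put $$D_n(t_1,k,t_2)=\tfrac{(k-t_1+1)(t_2-k)}{(t_2-t_1+1)^{3/2}}\big(\widehat\theta_{t_1,k}-\widehat\theta_{k+1,t_2}\big),\qquad T_n(t_1,k,t_2)=\frac{D_n(t_1,k,t_2)^2}{L_n(t_1,k,t_2)+R_n(t_1,k,t_2)},$$ $$L_n=\sum_{i=t_1}^{k}\tfrac{(i-t_1+1)^2(k-i)^2}{(t_2-t_1+1)^2(k-t_1+1)^2}\big(\widehat\theta_{t_1,i}-\widehat\theta_{i+1,k}\big)^2,\qquad R_n=\sum_{i=k+1}^{t_2}\tfrac{(t_2-i+1)^2(i-1-k)^2}{(t_2-t_1+1)^2(t_2-k)^2}\big(\widehat\theta_{i,t_2}-\widehat\theta_{k+1,i-1}\big)^2.$$ With $h=\lfloor n\epsilon\rfloor$ let $T_{s,e}(k)$ be the maximum of $T_n(t_1,k,t_2)$ over the pairs $t_1=k-j_1h+1$, $1\le j_1\le\lfloor k/h\rfloor$, $t_2=k+j_2h$,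 $1\le j_2\le\lfloor (n-k)/h\rfloor$, with $s\le t_1<t_2\le e$ (and $0$ if there is no such pair). Let $K_n=(n\delta^2)^{\kappa}$ for a fixed $\kappa\in(1/2,1)$. The procedure SNCP$(s,e)$ stops if $e-s+1<2h$ or $\max_{s\le k\le e}T_{s,e}(k)\le K_n$; otherwise it adds $\widehat k^*\in\arg\max_{s\le k\le e}T_{s,e}(k)$ to the set of estimates (ties are broken arbitrarily) and calls SNCP$(s,\widehat k^*)$ and SNCP$(\widehat k^*+1,e)$. The output of SNCP$(1,n)$ is written $\widehat k_1<\dots<\widehat k_{\widehat m}$. **Local refinement.** Let $\iota_n>0$ with $\iota_n/n\to0$ and $\iota_n^{-2}\delta^{-2}n\to0$, and let $\widetilde\iota_n$ be a sequence of non-negative integers with $\iota_n=O(\widetilde\iota_n)$ and $\widetilde\iota_n=o(n)$. Put $\widehat k_0=1-\widetilde\iota_n$, $\widehat k_{\widehat m+1}=n+\widetilde\iota_n$ and, for $1\le i\le\widehat m$, $s_i^*=\widehat k_{i-1}+\widetilde\iota_n$, $e_i^*=\widehat k_{i+1}-\widetilde\iota_n$. Let $$\widetilde k_i^*\in\arg\max_{s_i^*+\widetilde\iota_n\le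 k\le e_i^*-\widetilde\iota_n}T(k;s_i^*,e_i^*)^2,\qquad T(k;s,e)=\frac{\sqrt{(k-s+1)(e-k)}}{e-s+1}\big[\widehat\theta_{k+1,e}-\widehat\theta_{s,k}\big],$$ and let $\widetilde k_i^*$ be an arbitrary integer if $i>\widehat m$ or if the range of $k$ is empty. **Theorem.** For every $i=1,\dots,m$, $$|\widetilde k_i^*-k_i|=O_p\big(|\delta|^{2/(\phi-2)}\big)\qquad(n\to\infty).$$ In particular, if $\delta$ does not depend on $n$, then $|\widetilde k_i^*/n-k_i/n|=O_p(n^{-1})$. Here $Z_n=O_p(a_n)$ means: for every $\eta>0$ there is $M>0$ such that $P(|Z_n|>Ma_n)\le\eta$ for all large $n$. -/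

import Mathlib

open MeasureTheory ProbabilityTheory Filter Topology Asymptotics

/-! ### The space `D[0,1]` with the Skorokhod topology -/

/-- The space `D[0,1]` of real functions on `[0,1]` that are right-continuous with left limits. -/
structure SkorokhodSpace where
  toFun : unitInterval → ℝ
  right_continuous : ∀ t, ContinuousWithinAt toFun (Set.Ici t) t
  left_limit : ∀ t, ∃ l : ℝ, Tendsto toFun (𝓝[<] t) (𝓝 l)

namespace SkorokhodSpace

instance : CoeFun SkorokhodSpace (fun _ => unitInterval → ℝ) := ⟨toFun⟩

/-- `x` and `y` are `η`-close in the Skorokhod sense: some increasing bijection `l` of `[0,1]`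
satisfies `|l t - t| < η` and `|x t - y (l t)| < η` for all `t`. -/
def Close (η : ℝ) (x y : SkorokhodSpace) : Prop :=
  ∃ l : unitInterval ≃o unitInterval,
    ∀ t, |(l t : ℝ) - (t : ℝ)| < η ∧ |x t - y (l t)| < η

/-- The Skorokhod (J1) topology, i.e. the topology of the metric
`d x y = inf {η | Close η x y}`: a set is open if with each of its points it contains a ball. -/
instance : TopologicalSpace SkorokhodSpace where
  IsOpen U := ∀ x ∈ U, ∃ η > 0, ∀ y, Close η x y → y ∈ U
  isOpen_univ := fun _ _ => ⟨1, one_pos, fun _ _ => trivial⟩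
  isOpen_inter := by
    intro U V hU hV x hx
    obtain ⟨a, ha, hUa⟩ := hU x hx.1
    obtain ⟨b, hb, hVb⟩ := hV x hx.2
    refine ⟨min a b, lt_min ha hb, fun y hy => ?_⟩
    obtain ⟨l, hl⟩ := hy
    exact ⟨hUa y ⟨l, fun t => ⟨(hl t).1.trans_le (min_le_left _ _),
        (hl t).2.trans_le (min_le_left _ _)⟩⟩,
      hVb y ⟨l, fun t => ⟨(hl t).1.trans_le (min_le_right _ _),
        (hl t).2.trans_le (min_le_right _ _)⟩⟩⟩
  isOpen_sUnion := by
    intro S hS x hx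
    obtain ⟨U, hU, hxU⟩ := hx
    obtain ⟨a, ha, h⟩ := hS U hU x hxU
    exact ⟨a, ha, fun y hy => ⟨U, hU, h y hy⟩⟩

instance : MeasurableSpace SkorokhodSpace := borel SkorokhodSpace

instance : BorelSpace SkorokhodSpace := ⟨rfl⟩

end SkorokhodSpace

/-- The normalised partial-sum path `r ↦ n^{-1/2} ∑_{t = 1}^{⌊n r⌋} x t`, an element of `D[0,1]`. -/
noncomputable def partialSumPath (x : ℤ → ℝ) (n : ℕ) : SkorokhodSpace where
  toFun r := (Real.sqrt n)⁻¹ * ∑ t ∈ Finset.Icc (1 : ℤ) ⌊(n : ℝ) * (r : ℝ)⌋, x t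
  right_continuous := by
    intro r
    have h1 : Tendsto (fun s : unitInterval => (n : ℝ) * (s : ℝ)) (𝓝[≥] r)
        (𝓝[≥] ((n : ℝ) * (r : ℝ))) := by
      refine tendsto_nhdsWithin_iff.2 ⟨?_, ?_⟩
      · exact ((by fun_prop : Continuous fun s : unitInterval => (n : ℝ) * (s : ℝ)).tendsto
          r).mono_left nhdsWithin_le_nhds
      · filter_upwards [self_mem_nhdsWithin] with s hs
        have hs' : r ≤ s := hs
        exact mul_le_mul_of_nonneg_left (Subtype.coe_le_coe.2 hs') (Nat.cast_nonneg n)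
    have h2 := (tendsto_floor_right_pure_floor ((n : ℝ) * (r : ℝ))).comp h1
    have h3 := tendsto_pure.1 h2
    refine tendsto_const_nhds.congr' ?_
    filter_upwards [h3] with s hs
    simp only [Function.comp_apply] at hs
    rw [hs]
  left_limit := by
    intro r
    rcases Nat.eq_zero_or_pos n with hn | hn
    · subst hn
      exact ⟨0, by simpa using tendsto_const_nhds⟩
    have hn' : (0 : ℝ) < n := Nat.cast_pos.2 hn
    have h1 : Tendsto (fun s : unitInterval => (n : ℝ) * (s : ℝ)) (𝓝[<] r)
        (𝓝[<] ((n : ℝ) * (r : ℝ))) := by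
      refine tendsto_nhdsWithin_iff.2 ⟨?_, ?_⟩
      · exact ((by fun_prop : Continuous fun s : unitInterval => (n : ℝ) * (s : ℝ)).tendsto
          r).mono_left nhdsWithin_le_nhds
      · filter_upwards [self_mem_nhdsWithin] with s hs
        exact mul_lt_mul_of_pos_left (Subtype.coe_lt_coe.2 hs) hn'
    have h2 := (tendsto_floor_left_pure_ceil_sub_one ((n : ℝ) * (r : ℝ))).comp h1
    have h3 := tendsto_pure.1 h2
    refine ⟨(Real.sqrt n)⁻¹ * ∑ t ∈ Finset.Icc (1 : ℤ) (⌈(n : ℝ) * (r : ℝ)⌉ - 1), x t,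
      tendsto_const_nhds.congr' ?_⟩
    filter_upwards [h3] with s hs
    simp only [Function.comp_apply] at hs
    rw [hs]

/-! ### Probabilistic notions -/

/-- Strict stationarity: the finite-dimensional laws are invariant under time shifts. -/
def IsStrictlyStationary {Ω : Type*} [MeasurableSpace Ω] (X : ℤ → Ω → ℝ) (P : Measure Ω) : Prop :=
  ∀ (d : ℕ) (t : Fin d → ℤ) (u : ℤ),
    IdentDistrib (fun ω j => X (t j + u) ω) (fun ω j => X (t j) ω) P P

/-- `Z n = O_p(a n)` as `n → ∞`. -/
def IsBigOp {Ω : Type*} [MeasurableSpace Ω] (P : Measure Ω) (Z : ℕ → Ω → ℝ) (a : ℕ → ℝ) : Prop :=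
  ∀ η : ℝ, 0 < η → ∃ M : ℝ, 0 < M ∧
    ∀ᶠ n in atTop, P {ω | M * a n < |Z n ω|} ≤ ENNReal.ofReal η

/-! ### The self-normalised statistics for the mean functional

A sample is a function `y : ℤ → ℝ`, of which only the values `y 1, …, y n` are used. -/

/-- The estimator of the mean from the subsample `y a, …, y b`. -/
noncomputable def thetaHat (y : ℤ → ℝ) (a b : ℤ) : ℝ :=
  (∑ t ∈ Finset.Icc a b, y t) / ((b : ℝ) - a + 1)

/-- The contrast `D_n(t₁, k, t₂)`. -/
noncomputable def contrastD (y : ℤ → ℝ) (t₁ k t₂ : ℤ) : ℝ :=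
  ((k : ℝ) - t₁ + 1) * ((t₂ : ℝ) - k) / ((t₂ : ℝ) - t₁ + 1) ^ (3 / 2 : ℝ) *
    (thetaHat y t₁ k - thetaHat y (k + 1) t₂)

/-- The left part `L_n(t₁, k, t₂)` of the self-normaliser. -/
noncomputable def normaliserL (y : ℤ → ℝ) (t₁ k t₂ : ℤ) : ℝ :=
  ∑ i ∈ Finset.Icc t₁ k,
    ((i : ℝ) - t₁ + 1) ^ 2 * ((k : ℝ) - i) ^ 2 /
        (((t₂ : ℝ) - t₁ + 1) ^ 2 * ((k : ℝ) - t₁ + 1) ^ 2) *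
      (thetaHat y t₁ i - thetaHat y (i + 1) k) ^ 2

/-- The right part `R_n(t₁, k, t₂)` of the self-normaliser. -/
noncomputable def normaliserR (y : ℤ → ℝ) (t₁ k t₂ : ℤ) : ℝ :=
  ∑ i ∈ Finset.Icc (k + 1) t₂,
    ((t₂ : ℝ) - i + 1) ^ 2 * ((i : ℝ) - 1 - k) ^ 2 /
        (((t₂ : ℝ) - t₁ + 1) ^ 2 * ((t₂ : ℝ) - k) ^ 2) *
      (thetaHat y i t₂ - thetaHat y (k + 1) (i - 1)) ^ 2

/-- The self-normalised statistic `T_n(t₁, k, t₂) = D_n² / (L_n + R_n)`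
(with value `0` where the self-normaliser vanishes). -/
noncomputable def statT (y : ℤ → ℝ) (t₁ k t₂ : ℤ) : ℝ :=
  contrastD y t₁ k t₂ ^ 2 / (normaliserL y t₁ k t₂ + normaliserR y t₁ k t₂)

/-- The nested window set `H_{1:n}(k)` for the window size `h`. -/
noncomputable def nestedWindows (n h k : ℤ) : Finset (ℤ × ℤ) :=
  (Finset.Icc (1 : ℤ) (k / h) ×ˢ Finset.Icc (1 : ℤ) ((n - k) / h)).image
    fun j => (k - j.1 * h + 1, k + j.2 * h)

/-- The nested window set `H_{s:e}(k)` of `k` on the subsample with times `s, …, e`. -/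
noncomputable def subWindows (n h s e k : ℤ) : Finset (ℤ × ℤ) :=
  (nestedWindows n h k).filter fun w => s ≤ w.1 ∧ w.1 < w.2 ∧ w.2 ≤ e

/-- The maximal statistic `T_{s,e}(k)`; the maximum over an empty window set is `0`. -/
noncomputable def maxStat (y : ℤ → ℝ) (n h s e k : ℤ) : ℝ :=
  if hne : (subWindows n h s e k).Nonempty then
    (subWindows n h s e k).sup' hne fun w => statT y w.1 k w.2
  else 0

/-! ### The nested local-window segmentation algorithm -/

/-- `SNCPOutput y n h K s e S`: on the subsample with times `s, …, e`, the procedure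
`SNCP(s, e, K, h)` can return the set `S` of estimated change-points. It is a relation because
ties among the maximisers may be broken in any way. -/
inductive SNCPOutput (y : ℤ → ℝ) (n h : ℤ) (K : ℝ) : ℤ → ℤ → Finset ℤ → Prop
  | short (s e : ℤ) (hlen : e - s + 1 < 2 * h) : SNCPOutput y n h K s e ∅
  | halt (s e : ℤ) (hlen : 2 * h ≤ e - s + 1)
      (hmax : ∀ k ∈ Finset.Icc s e, maxStat y n h s e k ≤ K) : SNCPOutput y n h K s e ∅
  | split (s e k : ℤ) (A B : Finset ℤ) (hlen : 2 * h ≤ e - s + 1) (hk : k ∈ Finset.Icc s e)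
      (hmax : ∀ k' ∈ Finset.Icc s e, maxStat y n h s e k' ≤ maxStat y n h s e k)
      (hK : K < maxStat y n h s e k)
      (hA : SNCPOutput y n h K s k A) (hB : SNCPOutput y n h K (k + 1) e B) :
      SNCPOutput y n h K s e (insert k (A ∪ B))

/-! ### The local refinement -/

/-- `k̂_i` for `i = 0, …, m̂ + 1`, where `m̂ = S.card`: the `i`-th smallest element of the set `S` of
estimated change-points if `1 ≤ i ≤ m̂`, and by convention `k̂_0 = 1 - w`, `k̂_{m̂+1} = n + w`. -/
noncomputable def khatExt (n w : ℤ) (S : Finset ℤ) (i : ℕ) : ℤ :=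
  if i = 0 then 1 - w
  else if i = S.card + 1 then n + w
  else (S.sort (· ≤ ·)).getD (i - 1) 0

/-- The left end `s_i^* = k̂_{i-1} + w` of the `i`-th local interval. -/
noncomputable def localLeft (n w : ℤ) (S : Finset ℤ) (i : ℕ) : ℤ := khatExt n w S (i - 1) + w

/-- The right end `e_i^* = k̂_{i+1} - w` of the `i`-th local interval. -/
noncomputable def localRight (n w : ℤ) (S : Finset ℤ) (i : ℕ) : ℤ := khatExt n w S (i + 1) - w

/-- The CUSUM statistic `T(k; s, e)`. -/
noncomputable def cusum (y : ℤ → ℝ) (s e k : ℤ) : ℝ :=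
  Real.sqrt (((k : ℝ) - s + 1) * ((e : ℝ) - k)) / ((e : ℝ) - s + 1) *
    (thetaHat y (k + 1) e - thetaHat y s k)

/-- `k` maximises `T²(·; s, e)` over `s + w ≤ k ≤ e - w`. -/
def IsCusumArgmax (y : ℤ → ℝ) (s e w k : ℤ) : Prop :=
  k ∈ Finset.Icc (s + w) (e - w) ∧
    ∀ k' ∈ Finset.Icc (s + w) (e - w), cusum y s e k' ^ 2 ≤ cusum y s e k ^ 2

/-! ### The data -/

/-- The piecewise constant mean: `μ i` at the times `κ (i - 1) < t ≤ κ i`, `i = 1, …, m + 1`. -/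
def segmentMean (m : ℕ) (κ : ℕ → ℤ) (μ : ℕ → ℝ) (t : ℤ) : ℝ :=
  ∑ i ∈ Finset.Icc 1 (m + 1), if κ (i - 1) < t ∧ t ≤ κ i then μ i else 0

/-! ### Weak convergence in the Skorokhod space -/

namespace SkorokhodSpace

/-! The invariance principle enters only through two properties of the noise, collected in
`RegularNoise`: its partial sums are `O(√n)`, and on every interval of length proportional to `n`
their summed squared distance to any affine function is at least of order `n ^ 2`. Both hold up to
small probability, because a Brownian path is almost surely bounded on `[0,1]` and has nonzero
second differences at any finite set of triples, and these properties are stable under small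
Skorokhod perturbations (`exists_measure_not_regularNoise_le`). On regular noise the analysis of
SNCP is deterministic.

The self-normaliser is an energy of bridges (partial sums centred to vanish at both ends). It is
bounded below, since the left half of every window contains a stretch without change-point, on which
the bridge is noise minus an affine function. If the split point has distance at least `q` from all
change-points, a signal that inflates the contrast inflates the normaliser too, so the statistic is
at most of order `1 + (n / q) ^ 2` (`statT_le`). For `q` of order `n` this is bounded, hence below
the threshold; for `q = w` it is `o(n δ ^ 2)`, because `n / (w ^ 2 δ ^ 2) → 0`. At a change-point
the statistic is at least of order `n δ ^ 2` (`le_statT`), which exceeds the threshold because the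
exponent of the latter is below one. Hence every split lands within `w` of a change-point not yet
found, and the recursion stops exactly when none is left (`SNCPOutput.exists_near`).

Each refinement interval then sees a single jump, at distance of order `n` from both ends. Comparing
the squared CUSUM at its maximiser and at the jump shows that an error `d` forces `|c i * δ| * d ≤ 6
* |S|`, with `S` the noise sum over the `d` times in between (`jump_mul_le_of_isCusumArgmax`). The
moment bound gives a Hájek–Rényi inequality (`exists_measure_sum_ge_le`): sums exceeding `L d` for
some `d > d₀` have probability at most of order `d₀ ^ (φ - 2) / L ^ 2`. With `L = |c i * δ| / 6` and
`d₀ = M |δ| ^ (2 / (φ - 2))` the powers of `δ` cancel, and a multiple of `M ^ (φ - 2)` remains,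
which is small for large `M`. -/

lemma Close.mono {a b : ℝ} {x y : SkorokhodSpace} (hab : a ≤ b) (h : Close a x y) :
    Close b x y := by
  obtain ⟨l, hl⟩ := h
  exact ⟨l, fun t => ⟨(hl t).1.trans_le hab, (hl t).2.trans_le hab⟩⟩

lemma Close.symm {a : ℝ} {x y : SkorokhodSpace} (h : Close a x y) : Close a y x := by
  obtain ⟨l, hl⟩ := h
  refine ⟨l.symm, fun t => ?_⟩
  have h1 := hl (l.symm t)
  rw [l.apply_symm_apply] at h1
  exact ⟨by rw [abs_sub_comm]; exact h1.1, by rw [abs_sub_comm]; exact h1.2⟩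

lemma Close.trans {a b : ℝ} {x y z : SkorokhodSpace} (h : Close a x y) (h' : Close b y z) :
    Close (a + b) x z := by
  obtain ⟨l, hl⟩ := h
  obtain ⟨l', hl'⟩ := h'
  refine ⟨l.trans l', fun t => ?_⟩
  have h1 := hl t
  have h2 := hl' (l t)
  simp only [OrderIso.trans_apply]
  constructor
  · calc |((l' (l t) : unitInterval) : ℝ) - t|
        ≤ |((l' (l t) : unitInterval) : ℝ) - l t| + |((l t : unitInterval) : ℝ) - t| :=
          abs_sub_le _ _ _
      _ < a + b := by linarith [h1.1, h2.1]
  · calc |x t - z (l' (l t))| ≤ |x t - y (l t)| + |y (l t) - z (l' (l t))| := abs_sub_le _ _ _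
      _ < a + b := by linarith [h1.2, h2.2]

lemma Close.refl {a : ℝ} (ha : 0 < a) (x : SkorokhodSpace) : Close a x x :=
  ⟨OrderIso.refl _, fun t => by simpa using ha⟩

lemma Close.pos {a : ℝ} {x y : SkorokhodSpace} (h : Close a x y) : 0 < a := by
  obtain ⟨l, hl⟩ := h
  exact (abs_nonneg _).trans_lt (hl 0).1

/-- The Skorokhod distance to a set, truncated at `1`. -/
noncomputable def truncDist (A : Set SkorokhodSpace) (x : SkorokhodSpace) : ℝ :=
  sInf ({1} ∪ {η | ∃ y ∈ A, Close η x y})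

lemma truncDist_bddBelow (A : Set SkorokhodSpace) (x : SkorokhodSpace) :
    BddBelow ({1} ∪ {η | ∃ y ∈ A, Close η x y}) := by
  refine ⟨0, ?_⟩
  rintro η (h | ⟨y, _, h⟩)
  · rw [Set.mem_singleton_iff.1 h]; exact zero_le_one
  · exact h.pos.le

lemma truncDist_nonneg (A : Set SkorokhodSpace) (x : SkorokhodSpace) : 0 ≤ truncDist A x := by
  refine Real.sInf_nonneg ?_
  rintro η (h | ⟨y, _, h⟩)
  · rw [Set.mem_singleton_iff.1 h]; exact zero_le_one
  · exact h.pos.le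

lemma truncDist_le_add {A : Set SkorokhodSpace} {x x' : SkorokhodSpace} {r : ℝ}
    (h : Close r x x') : truncDist A x ≤ truncDist A x' + r := by
  rw [← sub_le_iff_le_add]
  refine le_csInf ⟨1, Or.inl rfl⟩ ?_
  rintro η (h1 | ⟨y, hy, h1⟩)
  · rw [Set.mem_singleton_iff.1 h1]
    have : truncDist A x ≤ 1 := csInf_le (truncDist_bddBelow A x) (Or.inl rfl)
    linarith [h.pos]
  · have : truncDist A x ≤ r + η :=
      csInf_le (truncDist_bddBelow A x) (Or.inr ⟨y, hy, h.trans h1⟩)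
    linarith

lemma truncDist_eq_zero {A : Set SkorokhodSpace} {x : SkorokhodSpace} (hx : x ∈ A) :
    truncDist A x = 0 := by
  refine le_antisymm (le_of_forall_pos_le_add fun η hη => ?_) (truncDist_nonneg A x)
  rw [zero_add]
  exact csInf_le (truncDist_bddBelow A x) (Or.inr ⟨x, hx, Close.refl hη x⟩)

lemma exists_close_of_truncDist_lt {A : Set SkorokhodSpace} {x : SkorokhodSpace} {r : ℝ}
    (hr : r ≤ 1) (h : truncDist A x < r) : ∃ y ∈ A, Close r x y := by
  obtain ⟨η, hη, hlt⟩ := exists_lt_of_csInf_lt (s := {1} ∪ {η | ∃ y ∈ A, Close η x y})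
    ⟨1, Set.mem_union_left _ rfl⟩ h
  rcases hη with h1 | ⟨y, hy, h1⟩
  · rw [Set.mem_singleton_iff.1 h1] at hlt; linarith
  · exact ⟨y, hy, h1.mono hlt.le⟩

/-- Open sets are defined through `Close`-balls, so a Lipschitz bound in `Close` makes preimages
open directly, without constructing a metric. -/
lemma continuous_of_close {f : SkorokhodSpace → ℝ} {L : ℝ} (hL : 0 < L)
    (hf : ∀ r x y, Close r x y → |f x - f y| ≤ L * r) : Continuous f := by
  refine continuous_def.2 fun s hs => ?_
  intro x hx
  obtain ⟨e, he, hball⟩ := Metric.isOpen_iff.1 hs (f x) hx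
  refine ⟨e / (2 * L), by positivity, fun y hy => hball ?_⟩
  rw [Metric.mem_ball, dist_comm, Real.dist_eq]
  calc |f x - f y| ≤ L * (e / (2 * L)) := hf _ _ _ hy
    _ = e / 2 := by field_simp
    _ < e := by linarith

/-- A tent function that equals `1` on `A` and vanishes away from `A`. -/
noncomputable def tent (A : Set SkorokhodSpace) (L : ℝ) (x : SkorokhodSpace) : ℝ :=
  max 0 (1 - L * truncDist A x)

lemma continuous_tent (A : Set SkorokhodSpace) {L : ℝ} (hL : 0 < L) : Continuous (tent A L) := by
  refine continuous_of_close hL fun r x y h => ?_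
  have h1 := truncDist_le_add (A := A) h
  have h2 := truncDist_le_add (A := A) h.symm
  refine (abs_max_sub_max_le_max _ _ _ _).trans ?_
  rw [sub_self, abs_zero, max_eq_right (abs_nonneg _)]
  have : 1 - L * truncDist A x - (1 - L * truncDist A y)
      = L * (truncDist A y - truncDist A x) := by ring
  rw [this, abs_mul, abs_of_pos hL]
  exact mul_le_mul_of_nonneg_left (abs_le.2 ⟨by linarith, by linarith⟩) hL.le

lemma tent_nonneg (A : Set SkorokhodSpace) (L : ℝ) (x : SkorokhodSpace) : 0 ≤ tent A L x :=
  le_max_left _ _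

lemma tent_le_one (A : Set SkorokhodSpace) {L : ℝ} (hL : 0 < L) (x : SkorokhodSpace) :
    tent A L x ≤ 1 :=
  max_le zero_le_one (by nlinarith [mul_nonneg hL.le (truncDist_nonneg A x)])

lemma tent_eq_one {A : Set SkorokhodSpace} {x : SkorokhodSpace} (hx : x ∈ A) (L : ℝ) :
    tent A L x = 1 := by
  rw [tent, truncDist_eq_zero hx]; simp

lemma exists_close_of_tent_ne_zero {A : Set SkorokhodSpace} {x : SkorokhodSpace} {L : ℝ}
    (hL : 1 ≤ L) (h : tent A L x ≠ 0) : ∃ y ∈ A, Close (1 / L) x y := by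
  have hL0 : 0 < L := by linarith
  refine exists_close_of_truncDist_lt ((div_le_one hL0).2 hL) ?_
  by_contra hcon
  push Not at hcon
  refine h (max_eq_left ?_)
  rw [div_le_iff₀ hL0] at hcon
  linarith

/-- If almost surely the limit path stays away from `A N` for some `N`, then `X n` is in `A N`
with small probability. -/
lemma exists_measure_mem_le {Ω Ω' : Type*} [MeasurableSpace Ω] [MeasurableSpace Ω']
    {P : Measure Ω} [IsProbabilityMeasure P] {P' : Measure Ω'} [IsProbabilityMeasure P']
    {X : ℕ → Ω → SkorokhodSpace} {Z : Ω' → SkorokhodSpace}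
    (hX : TendstoInDistribution X atTop Z (fun _ => P) P')
    {A : ℕ → Set SkorokhodSpace} (hA : Antitone A)
    (hZ : ∀ᵐ ω ∂P', ∃ N : ℕ, ∀ y ∈ A N, ¬ Close (1 / ((N : ℝ) + 1)) (Z ω) y)
    {η : ℝ} (hη : 0 < η) :
    ∃ N, ∀ᶠ n in atTop, P {ω | X n ω ∈ A N} ≤ ENNReal.ofReal η := by
  have hpos : ∀ N : ℕ, (0 : ℝ) < (N : ℝ) + 1 := fun N => by positivity
  have hone : ∀ N : ℕ, (1 : ℝ) ≤ (N : ℝ) + 1 := fun N => by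
    have : (0 : ℝ) ≤ N := Nat.cast_nonneg N
    linarith
  let f : ℕ → SkorokhodSpace → ℝ := fun N => tent (A N) ((N : ℝ) + 1)
  have hfc : ∀ N, Continuous (f N) := fun N => continuous_tent _ (hpos N)
  have hfb : ∀ N x, ‖f N x‖ ≤ 1 := fun N x => by
    rw [Real.norm_of_nonneg (tent_nonneg _ _ _)]; exact tent_le_one _ (hpos N) x
  have hlim : Tendsto (fun N => ∫ ω, f N (Z ω) ∂P') atTop (𝓝 (∫ _, (0 : ℝ) ∂P')) := by
    refine tendsto_integral_of_dominated_convergence (fun _ => 1) (fun N => ?_)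
      (integrable_const _) (fun N => Eventually.of_forall fun ω => hfb N _) ?_
    · exact ((hfc N).measurable.comp_aemeasurable hX.aemeasurable_limit).aestronglyMeasurable
    · filter_upwards [hZ] with ω hω
      obtain ⟨N, hN⟩ := hω
      -- For `M ≥ N` a nonzero tent at `Z ω` would give a point of `A M ⊆ A N` within `1 / (M + 1)`
      -- of `Z ω`.
      refine tendsto_const_nhds.congr' ?_
      filter_upwards [eventually_ge_atTop N] with M hM
      by_contra hcon
      obtain ⟨y, hy, hc⟩ := exists_close_of_tent_ne_zero (hone M) (Ne.symm hcon)
      refine hN y (hA hM hy) (hc.mono ?_)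
      have : (N : ℝ) ≤ M := Nat.cast_le.2 hM
      exact one_div_le_one_div_of_le (hpos N) (by linarith)
  rw [integral_zero] at hlim
  obtain ⟨N, hN⟩ := (hlim.eventually (gt_mem_nhds hη)).exists
  refine ⟨N, ?_⟩
  let F : BoundedContinuousFunction SkorokhodSpace ℝ :=
    BoundedContinuousFunction.ofNormedAddCommGroup (f N) (hfc N) 1 (hfb N)
  have h1 := (ProbabilityMeasure.tendsto_iff_forall_integral_tendsto.1 hX.tendsto) F
  have h2 : Tendsto (fun n => ∫ ω, f N (X n ω) ∂P) atTop (𝓝 (∫ ω, f N (Z ω) ∂P')) := by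
    have e1 : ∀ n, ∫ x, F x ∂(P.map (X n)) = ∫ ω, f N (X n ω) ∂P := fun n =>
      integral_map (hX.forall_aemeasurable n) (hfc N).measurable.aestronglyMeasurable
    have e2 : ∫ x, F x ∂(P'.map Z) = ∫ ω, f N (Z ω) ∂P' :=
      integral_map hX.aemeasurable_limit (hfc N).measurable.aestronglyMeasurable
    rw [← e2]
    exact h1.congr e1
  filter_upwards [h2.eventually (gt_mem_nhds hN)] with n hn
  have hint : Integrable (fun ω => f N (X n ω)) P :=
    Integrable.of_bound
      ((hfc N).measurable.comp_aemeasurable (hX.forall_aemeasurable n)).aestronglyMeasurable 1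
      (Eventually.of_forall fun ω => hfb N _)
  -- Markov's inequality at level `1`, the value of the tent on `A N`.
  have h3 := mul_meas_ge_le_integral_of_nonneg (μ := P)
    (Eventually.of_forall fun ω => tent_nonneg (A N) ((N : ℝ) + 1) (X n ω)) hint 1
  rw [one_mul] at h3
  have h4 : P {ω | X n ω ∈ A N} ≤ P {ω | 1 ≤ f N (X n ω)} :=
    measure_mono fun ω hω => (tent_eq_one hω _).ge
  refine h4.trans ((ENNReal.le_ofReal_iff_toReal_le (measure_ne_top _ _) hη.le).2 ?_)
  exact h3.trans hn.le

end SkorokhodSpace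

/-! ### Regularity of the limiting path -/

/-- The joint law is a product measure, and every slice of the diagonal is a singleton, null for the
law of `V`. -/
lemma ProbabilityTheory.IndepFun.ae_ne_of_nullSingleton {Ω : Type*} [MeasurableSpace Ω]
    {P : Measure Ω} [IsProbabilityMeasure P] {U V : Ω → ℝ} (hU : AEMeasurable U P)
    (hV : AEMeasurable V P) (hUV : IndepFun U V P) (hVa : ∀ x, P.map V {x} = 0) :
    ∀ᵐ ω ∂P, U ω ≠ V ω := by
  have h1 := (indepFun_iff_map_prod_eq_prod_map_map hU hV).1 hUV
  have : IsProbabilityMeasure (P.map V) := Measure.isProbabilityMeasure_map hV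
  have hm : MeasurableSet {p : ℝ × ℝ | p.1 = p.2} := measurableSet_eq_fun measurable_fst
    measurable_snd
  have h2 : ((P.map U).prod (P.map V)) {p : ℝ × ℝ | p.1 = p.2} = 0 := by
    rw [Measure.measure_prod_null hm]
    refine Eventually.of_forall fun x => ?_
    refine measure_mono_null ?_ (hVa x)
    intro y hy
    exact (Set.mem_singleton_iff.2 (Eq.symm hy))
  rw [← h1, Measure.map_apply_of_aemeasurable (hU.prodMk hV) hm] at h2
  rw [ae_iff]
  simp only [ne_eq, not_not]
  exact h2

/-- A vanishing second difference means that two independent increments coincide, and the later one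
is a nondegenerate Gaussian. -/
lemma ProbabilityTheory.IsPreBrownianReal.ae_second_diff_ne_zero {Ω : Type*} [MeasurableSpace Ω]
    {P : Measure Ω} [IsProbabilityMeasure P] {B : NNReal → Ω → ℝ} (hB : IsPreBrownianReal B P)
    {r s t : NNReal} (hrs : r ≤ s) (hst : s < t) :
    ∀ᵐ ω ∂P, B r ω - 2 * B s ω + B t ω ≠ 0 := by
  have hi : IndepFun (B s - B r) (B t - B s) P :=
    hB.hasIndepIncrements.indepFun_sub_sub hrs hst.le
  have hlaw := hB.hasLaw_sub t s
  have hv : nndist t.1 s.1 ≠ 0 := by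
    rw [Ne, nndist_eq_zero]
    intro h
    exact hst.ne' (NNReal.eq h)
  have := nullSingletonClass_gaussianReal (μ := 0) hv
  have h0 : ∀ x, P.map (B t - B s) {x} = 0 := fun x => by
    rw [hlaw.map_eq]; exact measure_singleton x
  filter_upwards [hi.ae_ne_of_nullSingleton ((hB.aemeasurable s).sub (hB.aemeasurable r))
    ((hB.aemeasurable t).sub (hB.aemeasurable s)) h0] with ω hω h
  refine hω ?_
  simp only [Pi.sub_apply]
  linarith

/-- Paths that exceed `N`, or have a second difference below `1 / (N + 1)` close to one of the
triples `j / J, (j + 1/3) / J, (j + 2/3) / J`. -/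
def irregularPaths (J N : ℕ) : Set SkorokhodSpace :=
  {y | (∃ t, (N : ℝ) < |y t|) ∨ ∃ j < J, ∃ t : Fin 3 → unitInterval,
    (∀ a : Fin 3, (t a : ℝ) ∈ Set.Icc ((3 * j + (a : ℝ)) / (3 * J))
      ((3 * j + (a : ℝ)) / (3 * J) + 1 / ((N : ℝ) + 1))) ∧
    |y (t 0) - 2 * y (t 1) + y (t 2)| < 1 / ((N : ℝ) + 1)}

lemma antitone_irregularPaths (J : ℕ) : Antitone (irregularPaths J) := by
  intro M N hMN y hy
  have h1 : (M : ℝ) ≤ N := Nat.cast_le.2 hMN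
  have h2 : 1 / ((N : ℝ) + 1) ≤ 1 / ((M : ℝ) + 1) :=
    one_div_le_one_div_of_le (by positivity) (by linarith)
  rcases hy with ⟨t, ht⟩ | ⟨j, hj, t, ht, hlt⟩
  · exact Or.inl ⟨t, h1.trans_lt ht⟩
  · exact Or.inr ⟨j, hj, t, fun a => ⟨(ht a).1, (ht a).2.trans (by linarith)⟩, hlt.trans_le h2⟩

/-- A continuous path is bounded and moves little under a small time change, so a sufficiently close
path inherits its bound and its nonzero second differences. -/
lemma exists_not_close_irregularPaths {J : ℕ} {z : SkorokhodSpace} (hz : Continuous z.toFun)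
    (r : ℕ → Fin 3 → unitInterval)
    (hr : ∀ j < J, ∀ a, ((r j a : unitInterval) : ℝ) = (3 * j + (a : ℝ)) / (3 * J))
    (hne : ∀ j < J, z (r j 0) - 2 * z (r j 1) + z (r j 2) ≠ 0) :
    ∃ N : ℕ, ∀ y ∈ irregularPaths J N, ¬ SkorokhodSpace.Close (1 / ((N : ℝ) + 1)) z y := by
  obtain ⟨K, hK⟩ : ∃ K, ∀ t, |z t| ≤ K := by
    obtain ⟨K, hK⟩ := isCompact_univ.exists_bound_of_continuousOn hz.continuousOn
    exact ⟨K, fun t => hK t (Set.mem_univ t)⟩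
  have hloc : ∀ j ∈ Finset.range J, ∀ᶠ N : ℕ in atTop, ∀ y,
      SkorokhodSpace.Close (1 / ((N : ℝ) + 1)) z y → ∀ t : Fin 3 → unitInterval,
      (∀ a : Fin 3, (t a : ℝ) ∈ Set.Icc ((3 * j + (a : ℝ)) / (3 * J))
        ((3 * j + (a : ℝ)) / (3 * J) + 1 / ((N : ℝ) + 1))) →
      1 / ((N : ℝ) + 1) ≤ |y (t 0) - 2 * y (t 1) + y (t 2)| := by
    intro j hj
    rw [Finset.mem_range] at hj
    set D := |z (r j 0) - 2 * z (r j 1) + z (r j 2)| with hD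
    have hDpos : 0 < D := abs_pos.2 (hne j hj)
    -- The budget: `D / 16` for the oscillation of `z` and `D / 16` for closeness give an error `D /
    -- 8` per value. The weights `1, 2, 1` turn this into `D / 2`, so a second difference of at
    -- least `D / 2` survives.
    have hcont : ∀ a, ∃ d > 0, ∀ s : unitInterval, |(s : ℝ) - r j a| < d →
        |z s - z (r j a)| < D / 16 := by
      intro a
      obtain ⟨d, hd, h⟩ := Metric.continuous_iff.1 hz (r j a) (D / 16) (by positivity)
      exact ⟨d, hd, fun s hs => h s hs⟩
    choose d hd hcd using hcont
    have hlim := tendsto_one_div_add_atTop_nhds_zero_nat (𝕜 := ℝ)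
    filter_upwards [hlim.eventually (gt_mem_nhds (half_pos (hd 0))),
      hlim.eventually (gt_mem_nhds (half_pos (hd 1))),
      hlim.eventually (gt_mem_nhds (half_pos (hd 2))),
      hlim.eventually (gt_mem_nhds (by positivity : 0 < D / 16))] with N h0 h1 h2 h3
    rintro y ⟨l, hl⟩ t ht
    have hda : ∀ a, 1 / ((N : ℝ) + 1) < d a / 2 := by
      intro a; fin_cases a
      exacts [h0, h1, h2]
    have key : ∀ a, |y (t a) - z (r j a)| < D / 8 := by
      intro a
      have e1 := hl (l.symm (t a))
      rw [l.apply_symm_apply] at e1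
      have e2 := hcd a (l.symm (t a)) ?_
      · calc |y (t a) - z (r j a)| ≤ |y (t a) - z (l.symm (t a))|
              + |z (l.symm (t a)) - z (r j a)| := abs_sub_le _ _ _
          _ < D / 8 := by
            rw [abs_sub_comm] at e1
            have := e1.2
            rw [abs_sub_comm] at this
            linarith
      · have e3 := ht a
        rw [← hr j hj a] at e3
        have e4 := hda a
        have e5 := abs_lt.1 e1.1
        rw [abs_lt]
        constructor <;> linarith [e3.1, e3.2, e5.1, e5.2]
    have k0 := abs_lt.1 (key 0)
    have k1 := abs_lt.1 (key 1)
    have k2 := abs_lt.1 (key 2)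
    have : D ≤ |y (t 0) - 2 * y (t 1) + y (t 2)| + D / 2 := by
      have e : z (r j 0) - 2 * z (r j 1) + z (r j 2)
          = (y (t 0) - 2 * y (t 1) + y (t 2)) + ((z (r j 0) - y (t 0))
            - 2 * (z (r j 1) - y (t 1)) + (z (r j 2) - y (t 2))) := by ring
      rw [hD, e]
      refine (abs_add_le _ _).trans ?_
      rw [← e, ← hD]
      gcongr
      rw [abs_le]
      constructor <;> linarith
    linarith
  have hall := (Finset.eventually_all (Finset.range J)).2 hloc
  obtain ⟨N, hN, hNK⟩ := (hall.and (eventually_ge_atTop (⌈K⌉₊ + 1))).exists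
  refine ⟨N, ?_⟩
  intro y hy hc
  rcases hy with ⟨t, ht⟩ | ⟨j, hj, t, ht, hlt⟩
  · obtain ⟨l, hl⟩ := hc
    have e1 := (hl (l.symm t)).2
    rw [l.apply_symm_apply] at e1
    have e2 := hK (l.symm t)
    have e3 : (⌈K⌉₊ : ℝ) + 1 ≤ N := by exact_mod_cast hNK
    have e4 := Nat.le_ceil K
    have e5 : 1 / ((N : ℝ) + 1) ≤ 1 := by
      rw [div_le_one (by positivity)]; linarith [Nat.cast_nonneg (α := ℝ) N]
    have e6 : |y t| ≤ |z (l.symm t)| + |z (l.symm t) - y t| := by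
      have := abs_sub_abs_le_abs_sub (y t) (z (l.symm t))
      rw [abs_sub_comm] at this
      linarith
    linarith
  · exact absurd hlt (not_lt.2 (hN j (Finset.mem_range.2 hj) y hc t ht))

/-- The partial-sum paths are regular with probability close to one. -/
lemma exists_measure_irregularPaths_le {Ω Ω' : Type*} [MeasurableSpace Ω] [MeasurableSpace Ω']
    {P : Measure Ω} [IsProbabilityMeasure P] {P' : Measure Ω'} [IsProbabilityMeasure P']
    {X : ℕ → Ω → SkorokhodSpace} {Z : Ω' → SkorokhodSpace} {σ : ℝ} (hσ : σ ≠ 0)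
    {B : NNReal → Ω' → ℝ} (hB : IsBrownianReal B P')
    (hZ : ∀ᵐ ω' ∂P', ∀ r : unitInterval, Z ω' r = σ * B (unitInterval.toNNReal r) ω')
    (hX : TendstoInDistribution X atTop Z (fun _ => P) P') (J : ℕ) {η : ℝ} (hη : 0 < η) :
    ∃ N, ∀ᶠ n in atTop, P {ω | X n ω ∈ irregularPaths J N} ≤ ENNReal.ofReal η := by
  refine SkorokhodSpace.exists_measure_mem_le hX (antitone_irregularPaths J) ?_ hη
  let r : ℕ → Fin 3 → unitInterval := fun j a =>
    Set.projIcc 0 1 zero_le_one ((3 * j + (a : ℝ)) / (3 * J))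
  have hr : ∀ j < J, ∀ a : Fin 3, ((r j a : unitInterval) : ℝ) = (3 * j + (a : ℝ)) / (3 * J) := by
    intro j hj a
    have hJ : (j : ℝ) + 1 ≤ J := by exact_mod_cast hj
    have ha : (a : ℝ) ≤ 2 := by exact_mod_cast Nat.le_of_lt_succ a.2
    have h0 : (0 : ℝ) ≤ j := Nat.cast_nonneg j
    refine congrArg Subtype.val (Set.projIcc_of_mem zero_le_one ⟨by positivity, ?_⟩)
    rw [div_le_one (by linarith)]
    linarith
  have hlt : ∀ j < J, ∀ a b : Fin 3, a < b →
      unitInterval.toNNReal (r j a) < unitInterval.toNNReal (r j b) := by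
    intro j hj a b hab
    rw [← NNReal.coe_lt_coe]
    change ((r j a : unitInterval) : ℝ) < r j b
    rw [hr j hj a, hr j hj b]
    have hJ : (j : ℝ) + 1 ≤ J := by exact_mod_cast hj
    have h0 : (0 : ℝ) ≤ j := Nat.cast_nonneg j
    have hab' : (a : ℝ) < b := by exact_mod_cast hab
    exact div_lt_div_of_pos_right (by linarith) (by linarith)
  have hall : ∀ᵐ ω ∂P', ∀ j < J, B (unitInterval.toNNReal (r j 0)) ω
      - 2 * B (unitInterval.toNNReal (r j 1)) ω + B (unitInterval.toNNReal (r j 2)) ω ≠ 0 := by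
    rw [ae_all_iff]
    intro j
    by_cases hj : j < J
    · filter_upwards [hB.toIsPreBrownianReal.ae_second_diff_ne_zero
        (hlt j hj 0 1 (by decide)).le (hlt j hj 1 2 (by decide))] with ω hω _ using hω
    · exact Eventually.of_forall fun ω h => absurd h hj
  filter_upwards [hZ, hB.cont, hall] with ω hω hc hne
  refine exists_not_close_irregularPaths ?_ r hr ?_
  · have : (Z ω).toFun = fun s => σ * B (unitInterval.toNNReal s) ω := funext hω
    rw [this]
    have : Continuous unitInterval.toNNReal := by
      refine Continuous.subtype_mk continuous_subtype_val _
    fun_prop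
  · intro j hj
    rw [hω, hω, hω]
    have := mul_ne_zero hσ (hne j hj)
    intro h
    apply this
    linarith

/-! ### Regular samples -/

lemma sum_comp_le_sum_of_injOn {ι κ : Type*} [DecidableEq κ] {s : Finset ι} {t : Finset κ}
    {f : ι → κ} {F : κ → ℝ} (hf : Set.InjOn f s) (hst : ∀ i ∈ s, f i ∈ t) (hF : ∀ x, 0 ≤ F x) :
    ∑ i ∈ s, F (f i) ≤ ∑ x ∈ t, F x := by
  rw [← Finset.sum_image hf]
  exact Finset.sum_le_sum_of_subset_of_nonneg (Finset.image_subset_iff.2 hst) fun x _ _ => hF x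

/-- The partial sum `∑_{t = 1}^{i} x t`. -/
noncomputable def partialSum (x : ℤ → ℝ) (i : ℤ) : ℝ := ∑ t ∈ Finset.Icc 1 i, x t

/-- A noise sample on `1, …, n` whose partial sums are at most `A √n`, and are far from every affine
function on each subinterval that is longer than `ρ n`. -/
structure RegularNoise (x : ℤ → ℝ) (n : ℤ) (A c ρ : ℝ) : Prop where
  abs_le : ∀ i ∈ Finset.Icc 0 n, |partialSum x i| ≤ A * √n
  le_sum : ∀ a b : ℤ, 1 ≤ a → b ≤ n → ρ * n ≤ b - a → ∀ α β : ℝ,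
    c * (n : ℝ) ^ 2 ≤ ∑ i ∈ Finset.Icc a b, (partialSum x i - (α + β * i)) ^ 2

lemma partialSumPath_apply {x : ℤ → ℝ} {n : ℕ} (hn : 0 < n) {i : ℤ} {t : unitInterval}
    (ht : (t : ℝ) = i / n) : partialSumPath x n t = (√n)⁻¹ * partialSum x i := by
  have hn' : (n : ℝ) ≠ 0 := by positivity
  simp only [partialSumPath, partialSum, ht]
  rw [mul_div_cancel₀ _ hn', Int.floor_intCast]

lemma div_mem_unitInterval {n : ℕ} (hn : 0 < n) {i : ℤ} (hi : i ∈ Finset.Icc (0 : ℤ) n) :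
    (i : ℝ) / n ∈ unitInterval := by
  rw [Finset.mem_Icc] at hi
  have hn' : (0 : ℝ) < n := by positivity
  have h0 : (0 : ℝ) ≤ i := by exact_mod_cast hi.1
  have h1 : (i : ℝ) ≤ n := by exact_mod_cast hi.2
  exact ⟨by positivity, (div_le_one hn').2 h1⟩

lemma sq_second_diff_le (x y z : ℝ) :
    (x - 2 * y + z) ^ 2 ≤ 6 * (x ^ 2 + y ^ 2 + z ^ 2) := by
  nlinarith [sq_nonneg (x - z), sq_nonneg (2 * x + y), sq_nonneg (2 * z + y)]

/-- Second differences annihilate affine functions. An interval longer than `2 n / J` contains a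
full block of the `J`-grid, hence about `n κ / 2` shifted copies of one triple, with `κ = 1 / (N +
1)`. Each copy has second difference at least `κ √n`, so the residuals at its three points have
squares summing to at least `n κ ^ 2 / 6`. At least `n κ / 4` copies, each of the three positions
being injective in the shift, give `κ ^ 3 n ^ 2 / 72`. -/
lemma regularNoise_of_notMem_irregularPaths {x : ℤ → ℝ} {n J N : ℕ} (hJ : 0 < J)
    (hNJ : 3 * J ≤ N + 1) (hn : 4 * (N + 1) ≤ n) (h : partialSumPath x n ∉ irregularPaths J N) :
    RegularNoise x n N (1 / (72 * ((N : ℝ) + 1) ^ 3)) (2 / J) := by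
  have hn0 : 0 < n := by omega
  have hn' : (0 : ℝ) < n := by positivity
  have hJ' : (0 : ℝ) < J := by positivity
  have hsq : 0 < √(n : ℝ) := Real.sqrt_pos.2 hn'
  have hN0 : (0 : ℝ) < (N : ℝ) + 1 := by positivity
  simp only [irregularPaths, Set.mem_ofPred_eq, not_or, not_exists, not_and, not_lt] at h
  obtain ⟨h1, h2⟩ := h
  refine ⟨fun i hi => ?_, fun a b ha hb hab α β => ?_⟩
  · have e := h1 ⟨_, div_mem_unitInterval hn0 hi⟩
    rw [partialSumPath_apply hn0 (i := i) rfl, abs_mul, abs_inv, abs_of_pos hsq,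
      inv_mul_le_iff₀ hsq] at e
    simpa [mul_comm] using e
  simp only [Int.cast_natCast] at hab ⊢
  set κ : ℝ := 1 / ((N : ℝ) + 1) with hκ
  have hκ0 : 0 < κ := by positivity
  have hκJ : κ ≤ 1 / (3 * J) := by
    refine one_div_le_one_div_of_le (by positivity) ?_
    exact_mod_cast hNJ
  have hnκ : 4 ≤ n * κ := by
    rw [hκ, mul_one_div, le_div_iff₀ hN0]
    exact_mod_cast hn
  have ha' : (1 : ℝ) ≤ a := by exact_mod_cast ha
  have hb' : (b : ℝ) ≤ n := by exact_mod_cast hb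
  obtain ⟨j, hj⟩ : ∃ j : ℕ, j = ⌈(a : ℝ) * J / n⌉₊ := ⟨_, rfl⟩
  have hj1 : (a : ℝ) * J / n ≤ j := hj ▸ Nat.le_ceil _
  have hj2 : (j : ℝ) < a * J / n + 1 := hj ▸ Nat.ceil_lt_add_one (by positivity)
  rw [div_le_iff₀ hn'] at hj1
  have hj3 : (j : ℝ) * n < a * J + n := by
    have := mul_lt_mul_of_pos_right hj2 hn'
    rwa [add_mul, div_mul_cancel₀ _ hn'.ne', one_mul] at this
  have hab' : 2 * (n : ℝ) ≤ (b - a) * J := by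
    have := mul_le_mul_of_nonneg_right hab hJ'.le
    field_simp at this
    linarith
  have hjJ : j < J := by
    have : (j : ℝ) * n < J * n := by nlinarith
    exact_mod_cast lt_of_mul_lt_mul_right this hn'.le
  obtain ⟨l, hl⟩ : ∃ l : ℤ, l = ⌈(n : ℝ) / (3 * J)⌉ := ⟨_, rfl⟩
  have hl1 : (n : ℝ) / (3 * J) ≤ l := hl ▸ Int.le_ceil _
  have hl2 : (l : ℝ) < n / (3 * J) + 1 := hl ▸ Int.ceil_lt_add_one _
  obtain ⟨s, hs⟩ : ∃ s : ℤ, s = ⌈(n : ℝ) * j / J⌉ := ⟨_, rfl⟩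
  have hs1 : (n : ℝ) * j / J ≤ s := hs ▸ Int.le_ceil _
  have hs2 : (s : ℝ) < n * j / J + 1 := hs ▸ Int.ceil_lt_add_one _
  obtain ⟨M, hM⟩ : ∃ M : ℕ, M = ⌊(n : ℝ) * κ / 2⌋₊ := ⟨_, rfl⟩
  have hM1 : (M : ℝ) ≤ n * κ / 2 := hM ▸ Nat.floor_le (by positivity)
  have hM2 : (n : ℝ) * κ / 2 < M + 1 := hM ▸ Nat.lt_floor_add_one _
  have hl0 : 0 ≤ l := by
    have : (0 : ℝ) ≤ l := le_trans (by positivity) hl1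
    exact_mod_cast this
  have hsa : a ≤ s := by
    have : (a : ℝ) ≤ s := by
      refine le_trans ?_ hs1
      rw [le_div_iff₀ hJ']
      linarith
    exact_mod_cast this
  -- Rounding up `s` and `q * l` costs at most `3` and the shift is at most `n κ / 2 - 1`; the total
  -- stays below `n κ` because `n κ ≥ 4`.
  have hpt : ∀ u ∈ Finset.range M, ∀ q : Fin 3,
      ((s + u + q * l : ℤ) : ℝ) / n ∈ Set.Icc ((3 * j + (q : ℝ)) / (3 * J))
        ((3 * j + (q : ℝ)) / (3 * J) + κ) := by
    intro u hu q
    have hu' : (u : ℝ) + 1 ≤ M := by exact_mod_cast Finset.mem_range.1 hu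
    have hq0 : (0 : ℝ) ≤ q := Nat.cast_nonneg _
    have hq2 : (q : ℝ) ≤ 2 := by exact_mod_cast Nat.le_of_lt_succ q.2
    have e1 := mul_le_mul_of_nonneg_left hl1 hq0
    have e2 := mul_le_mul_of_nonneg_left hl2.le hq0
    have hu0 : (0 : ℝ) ≤ u := Nat.cast_nonneg u
    have e3 : (3 * j + (q : ℝ)) / (3 * J) * n = n * j / J + q * (n / (3 * J)) := by
      field_simp
    push_cast
    rw [Set.mem_Icc, le_div_iff₀ hn', div_le_iff₀ hn', add_mul, e3]
    constructor
    · linarith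
    · linarith
  have hle : ∀ u ∈ Finset.range M, ∀ q : Fin 3, s + u + q * l ∈ Finset.Icc a b := by
    intro u hu q
    have hql : 0 ≤ ((q : ℕ) : ℤ) * l := mul_nonneg (Int.natCast_nonneg _) hl0
    refine Finset.mem_Icc.2 ⟨by omega, ?_⟩
    have e := (hpt u hu q).2
    have hq2 : (q : ℝ) ≤ 2 := by exact_mod_cast Nat.le_of_lt_succ q.2
    have e1 : (3 * j + (q : ℝ)) / (3 * J) + κ ≤ (j + 1) / J := by
      have : (3 * j + (q : ℝ)) / (3 * J) + 1 / (3 * J) ≤ (j + 1) / J := by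
        rw [← add_div, div_le_div_iff₀ (by positivity) hJ']
        nlinarith
      linarith
    have e2 := e.trans e1
    rw [div_le_div_iff₀ hn' hJ'] at e2
    have e3 : (((s + u + q * l : ℤ) : ℝ)) * J ≤ b * J := by nlinarith
    exact_mod_cast le_of_mul_le_mul_right e3 hJ'
  set g : ℤ → ℝ := fun i => partialSum x i - (α + β * i) with hg
  have hsum : ∀ q : Fin 3, ∑ u ∈ Finset.range M, g (s + u + q * l) ^ 2
      ≤ ∑ i ∈ Finset.Icc a b, g i ^ 2 := fun q =>
    sum_comp_le_sum_of_injOn (f := fun u : ℕ => s + u + q * l) (F := fun i => g i ^ 2)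
      (fun u _ v _ huv => by simpa using huv) (fun u hu => hle u hu q) fun _ => sq_nonneg _
  have hterm : ∀ u ∈ Finset.range M, n * κ ^ 2 ≤ 6 * (g (s + u + (0 : Fin 3) * l) ^ 2
      + g (s + u + (1 : Fin 3) * l) ^ 2 + g (s + u + (2 : Fin 3) * l) ^ 2) := by
    intro u hu
    have hmem : ∀ q : Fin 3, s + u + q * l ∈ Finset.Icc (0 : ℤ) n := fun q => by
      have := Finset.mem_Icc.1 (hle u hu q)
      exact Finset.mem_Icc.2 ⟨by omega, by omega⟩
    have e := h2 j hjJ (fun q => ⟨_, div_mem_unitInterval hn0 (hmem q)⟩) (hpt u hu)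
    rw [partialSumPath_apply hn0 (i := s + u + (0 : Fin 3) * l) rfl,
      partialSumPath_apply hn0 (i := s + u + (1 : Fin 3) * l) rfl,
      partialSumPath_apply hn0 (i := s + u + (2 : Fin 3) * l) rfl] at e
    have e1 : (√(n : ℝ))⁻¹ * partialSum x (s + u + (0 : Fin 3) * l)
        - 2 * ((√(n : ℝ))⁻¹ * partialSum x (s + u + (1 : Fin 3) * l))
        + (√(n : ℝ))⁻¹ * partialSum x (s + u + (2 : Fin 3) * l)
        = (√(n : ℝ))⁻¹ * (g (s + u + (0 : Fin 3) * l) - 2 * g (s + u + (1 : Fin 3) * l)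
          + g (s + u + (2 : Fin 3) * l)) := by
      simp only [hg]
      push_cast
      simp
      ring
    rw [e1, abs_mul, abs_inv, abs_of_pos hsq, ← div_eq_inv_mul, le_div_iff₀ hsq] at e
    have e2 := pow_le_pow_left₀ (by positivity) e 2
    rw [sq_abs, mul_pow, Real.sq_sqrt hn'.le] at e2
    refine le_trans (le_of_eq (mul_comm _ _)) (e2.trans (sq_second_diff_le _ _ _))
  have htot := Finset.sum_le_sum hterm
  rw [Finset.sum_const, Finset.card_range, nsmul_eq_mul, ← Finset.mul_sum, Finset.sum_add_distrib,
    Finset.sum_add_distrib] at htot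
  have hG0 := hsum 0
  have hG1 := hsum 1
  have hG2 := hsum 2
  have hc : 1 / (72 * ((N : ℝ) + 1) ^ 3) = κ ^ 3 / 72 := by
    rw [hκ]; field_simp
  rw [hc]
  have hMn : n * κ / 4 ≤ M := by linarith
  have := mul_le_mul_of_nonneg_right hMn (by positivity : 0 ≤ n * κ ^ 2)
  have e3 : (n : ℝ) * κ / 4 * (n * κ ^ 2) = 18 * (κ ^ 3 / 72 * n ^ 2) := by ring
  linarith

lemma RegularNoise.mono {x : ℤ → ℝ} {n : ℤ} (hn : 0 ≤ n) {A c ρ ρ' : ℝ} (h : RegularNoise x n A c ρ)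
    (hρ : ρ ≤ ρ') : RegularNoise x n A c ρ' :=
  ⟨h.abs_le, fun a b ha hb hab => h.le_sum a b ha hb
    ((mul_le_mul_of_nonneg_right hρ (Int.cast_nonneg hn)).trans hab)⟩

/-- The invariance principle makes the noise regular with probability close to one. -/
lemma exists_measure_not_regularNoise_le {Ω Ω' : Type*} [MeasurableSpace Ω] [MeasurableSpace Ω']
    {P : Measure Ω} [IsProbabilityMeasure P] {P' : Measure Ω'} [IsProbabilityMeasure P']
    {X : ℤ → Ω → ℝ} {Z : Ω' → SkorokhodSpace} {σ : ℝ} (hσ : σ ≠ 0)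
    {B : NNReal → Ω' → ℝ} (hB : IsBrownianReal B P')
    (hZ : ∀ᵐ ω' ∂P', ∀ r : unitInterval, Z ω' r = σ * B (unitInterval.toNNReal r) ω')
    (hX : TendstoInDistribution (fun (n : ℕ) ω => partialSumPath (fun t => X t ω) n)
      atTop Z (fun _ => P) P') {ρ : ℝ} (hρ : 0 < ρ) {η : ℝ} (hη : 0 < η) :
    ∃ A c : ℝ, 0 < A ∧ 0 < c ∧ ∀ᶠ n : ℕ in atTop,
      P {ω | ¬ RegularNoise (fun t => X t ω) n A c ρ} ≤ ENNReal.ofReal η := by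
  obtain ⟨J, hJ⟩ := exists_nat_gt (2 / ρ)
  have hJ0 : (0 : ℝ) < J := lt_trans (by positivity) hJ
  have hJρ : 2 / (J : ℝ) ≤ ρ := by
    rw [div_lt_iff₀ hρ] at hJ
    rw [div_le_iff₀ hJ0]
    linarith
  obtain ⟨N, hN⟩ := exists_measure_irregularPaths_le hσ hB hZ hX J hη
  -- Raising `N` to `N + 3 J` keeps the probability bound, since the irregular sets decrease, and
  -- makes the windows short compared with the grid.
  refine ⟨(N + 3 * J : ℕ), 1 / (72 * (((N + 3 * J : ℕ) : ℝ) + 1) ^ 3), ?_, by positivity, ?_⟩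
  · push_cast
    linarith [Nat.cast_nonneg (α := ℝ) N]
  filter_upwards [hN, eventually_ge_atTop (4 * (N + 3 * J + 1))] with n hn hnN
  refine (measure_mono fun ω hω => ?_).trans hn
  by_contra hcon
  refine hω ((regularNoise_of_notMem_irregularPaths (J := J) (by exact_mod_cast hJ0)
    (by omega) hnN fun hmem => hcon ?_).mono (by positivity) hJρ)
  exact antitone_irregularPaths J (by omega : N ≤ N + 3 * J) hmem

/-! ### A maximal inequality -/

/-- A quadratic form that dominates the squares of the partial sums of `x i, x (i + 1), …` of length
at most `2 ^ r`. -/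
noncomputable def dyadicMaximal (θ : ℝ) (x : ℕ → ℝ) : ℕ → ℕ → ℝ
  | 0, i => x i ^ 2
  | r + 1, i => dyadicMaximal θ x r i + (1 + θ) * dyadicMaximal θ x r (i + 2 ^ r) +
      (1 + 1 / θ) * (∑ t ∈ Finset.range (2 ^ r), x (i + t)) ^ 2

lemma dyadicMaximal_nonneg {θ : ℝ} (hθ : 0 < θ) (x : ℕ → ℝ) (r i : ℕ) :
    0 ≤ dyadicMaximal θ x r i := by
  induction r generalizing i with
  | zero => exact sq_nonneg _
  | succ r ih =>
    have h1 := ih i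
    have h2 := ih (i + 2 ^ r)
    rw [dyadicMaximal]
    positivity

lemma sq_add_le_weighted {θ : ℝ} (hθ : 0 < θ) (a b : ℝ) :
    (a + b) ^ 2 ≤ (1 + 1 / θ) * a ^ 2 + (1 + θ) * b ^ 2 := by
  have h : (1 + 1 / θ) * a ^ 2 + (1 + θ) * b ^ 2 - (a + b) ^ 2 = (a - θ * b) ^ 2 / θ := by
    field_simp
    ring
  have : 0 ≤ (a - θ * b) ^ 2 / θ := by positivity
  linarith

/-- A sum longer than `2 ^ r` splits into a full block of that length and a remainder; the unequal
weights put the factor `1 + 1 / θ` on the full block only. -/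
lemma sq_sum_le_dyadicMaximal {θ : ℝ} (hθ : 0 < θ) (x : ℕ → ℝ) (r i d : ℕ) (hd : d ≤ 2 ^ r) :
    (∑ t ∈ Finset.range d, x (i + t)) ^ 2 ≤ dyadicMaximal θ x r i := by
  induction r generalizing i d with
  | zero =>
    rw [pow_zero] at hd
    interval_cases d
    · simpa using dyadicMaximal_nonneg hθ x 0 i
    · simp [dyadicMaximal]
  | succ r ih =>
    have h1 := dyadicMaximal_nonneg hθ x r i
    have h2 := dyadicMaximal_nonneg hθ x r (i + 2 ^ r)
    have h3 : 0 ≤ (1 + 1 / θ) * (∑ t ∈ Finset.range (2 ^ r), x (i + t)) ^ 2 := by positivity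
    rw [dyadicMaximal]
    rcases le_total d (2 ^ r) with hle | hle
    · have := ih i d hle
      have : 0 ≤ (1 + θ) * dyadicMaximal θ x r (i + 2 ^ r) := by positivity
      linarith
    · obtain ⟨e, rfl⟩ := Nat.exists_eq_add_of_le hle
      rw [Finset.sum_range_add]
      have h4 := ih (i + 2 ^ r) e (by rw [pow_succ] at hd; omega)
      have h5 := sq_add_le_weighted hθ (∑ t ∈ Finset.range (2 ^ r), x (i + t))
        (∑ t ∈ Finset.range e, x (i + 2 ^ r + t))
      have h6 := mul_le_mul_of_nonneg_left h4 (by positivity : 0 ≤ 1 + θ)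
      simp only [← add_assoc] at h5 ⊢
      linarith

section

variable {Ω : Type*} [MeasurableSpace Ω] {P : Measure Ω}

lemma integrable_dyadicMaximal {x : ℕ → Ω → ℝ} (hx : ∀ t, MemLp (x t) 2 P) (θ : ℝ) (r i : ℕ) :
    Integrable (fun ω => dyadicMaximal θ (fun t => x t ω) r i) P := by
  induction r generalizing i with
  | zero => exact (hx i).integrable_sq
  | succ r ih =>
    simp only [dyadicMaximal]
    refine ((ih i).add ((ih _).const_mul _)).add (Integrable.const_mul ?_ _)
    exact (memLp_finsetSum _ fun t _ => hx (i + t)).integrable_sq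

/-- The two halves contribute `(2 + θ) K` and the full block `(1 + 1 / θ) C`, both times `(2 ^ r) ^
φ`. The recursion closes without a logarithmic loss because `2 ^ φ > 2` leaves room for a positive
`θ`. -/
lemma integral_dyadicMaximal_le {x : ℕ → Ω → ℝ} (hx : ∀ t, MemLp (x t) 2 P) {C φ θ K : ℝ}
    (hmom : ∀ i l : ℕ, ∫ ω, (∑ t ∈ Finset.range l, x (i + t) ω) ^ 2 ∂P ≤ C * (l : ℝ) ^ φ)
    (hθ : 0 < θ) (hCK : C ≤ K) (hK : (2 + θ) * K + (1 + 1 / θ) * C ≤ 2 ^ φ * K) (r i : ℕ) :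
    ∫ ω, dyadicMaximal θ (fun t => x t ω) r i ∂P ≤ K * ((2 : ℝ) ^ r) ^ φ := by
  induction r generalizing i with
  | zero =>
    have := hmom i 1
    simp only [Finset.range_one, Finset.sum_singleton, add_zero, Nat.cast_one, Real.one_rpow,
      mul_one] at this
    simpa [dyadicMaximal] using this.trans hCK
  | succ r ih =>
    simp only [dyadicMaximal]
    have i1 := integrable_dyadicMaximal hx θ r i
    have i2 := (integrable_dyadicMaximal hx θ r (i + 2 ^ r)).const_mul (1 + θ)
    have i3 : Integrable (fun ω => (1 + 1 / θ) *
        (∑ t ∈ Finset.range (2 ^ r), x (i + t) ω) ^ 2) P :=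
      ((memLp_finsetSum _ fun t _ => hx (i + t)).integrable_sq).const_mul _
    have i12 : Integrable (fun ω => dyadicMaximal θ (fun t => x t ω) r i +
        (1 + θ) * dyadicMaximal θ (fun t => x t ω) r (i + 2 ^ r)) P := i1.add i2
    rw [integral_add i12 i3, integral_add i1 i2, integral_const_mul, integral_const_mul]
    have e1 := ih i
    have e2 := mul_le_mul_of_nonneg_left (ih (i + 2 ^ r)) (by positivity : 0 ≤ 1 + θ)
    have e3 := mul_le_mul_of_nonneg_left (hmom i (2 ^ r)) (by positivity : 0 ≤ 1 + 1 / θ)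
    push_cast at e3
    have e4 : ((2 : ℝ) ^ (r + 1)) ^ φ = ((2 : ℝ) ^ r) ^ φ * 2 ^ φ := by
      rw [pow_succ, Real.mul_rpow (by positivity) (by positivity)]
    have e5 := mul_le_mul_of_nonneg_right hK (by positivity : 0 ≤ ((2 : ℝ) ^ r) ^ φ)
    rw [e4]
    linarith

/-- A Hájek–Rényi type inequality. -/
lemma exists_measure_sum_ge_le [IsFiniteMeasure P] {C φ : ℝ} (hC : 0 ≤ C) (hφ1 : 1 < φ)
    (hφ2 : φ < 2) :
    ∃ K : ℝ, 0 < K ∧ ∀ x : ℕ → Ω → ℝ, (∀ t, MemLp (x t) 2 P) →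
      (∀ i l : ℕ, ∫ ω, (∑ t ∈ Finset.range l, x (i + t) ω) ^ 2 ∂P ≤ C * (l : ℝ) ^ φ) →
      ∀ L d₀ : ℝ, 0 < L → 0 < d₀ →
      P {ω | ∃ d : ℕ, 1 ≤ d ∧ d₀ < d ∧ L * d ≤ |∑ t ∈ Finset.range d, x t ω|}
        ≤ ENNReal.ofReal (K * d₀ ^ (φ - 2) / L ^ 2) := by
  have h2φ : (2 : ℝ) < 2 ^ φ := by
    conv_lhs => rw [← Real.rpow_one 2]
    exact Real.rpow_lt_rpow_of_exponent_lt one_lt_two hφ1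
  -- Then `2 ^ φ = 2 + 2 * θ`, and the recursion only needs `(1 + 1 / θ) * C ≤ θ * K₀`, for which
  -- `K₀` is made.
  set θ : ℝ := (2 ^ φ - 2) / 2 with hθ
  have hθ0 : 0 < θ := by rw [hθ]; linarith
  set q : ℝ := 2 ^ (φ - 2) with hq
  have hq0 : 0 < q := by positivity
  have hq1 : q < 1 := Real.rpow_lt_one_of_one_lt_of_neg one_lt_two (by linarith)
  set K₀ : ℝ := C + (1 + 1 / θ) * C / θ + 1 with hK₀
  have hK₀0 : 0 < K₀ := by positivity
  have hCK : C ≤ K₀ := by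
    have : 0 ≤ (1 + 1 / θ) * C / θ := by positivity
    linarith
  have hK : (2 + θ) * K₀ + (1 + 1 / θ) * C ≤ 2 ^ φ * K₀ := by
    have e1 : (2 : ℝ) ^ φ = 2 + 2 * θ := by rw [hθ]; ring
    have e2 : (1 + 1 / θ) * C ≤ θ * K₀ := by
      have : θ * K₀ = θ * C + (1 + 1 / θ) * C + θ := by
        rw [hK₀]; field_simp
      nlinarith [mul_nonneg hθ0.le hC]
    rw [e1]
    linarith
  refine ⟨4 * K₀ / (1 - q), div_pos (by positivity) (by linarith), ?_⟩
  intro x hx hmom L d₀ hL hd₀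
  -- The dyadic blocks from level `r₀` on cover all `d > d₀`, and `2 ^ r₀ > d₀ / 2` yields the
  -- factor `4` in the final constant.
  obtain ⟨r₀, hr₀, hmin⟩ : ∃ r₀ : ℕ, d₀ < 2 ^ (r₀ + 1) ∧ ∀ r : ℕ, d₀ < 2 ^ (r + 1) → r₀ ≤ r := by
    have hex : ∃ r : ℕ, d₀ < 2 ^ (r + 1) := by
      obtain ⟨r, hr⟩ := pow_unbounded_of_one_lt d₀ one_lt_two
      exact ⟨r, hr.trans (pow_lt_pow_right₀ one_lt_two (Nat.lt_succ_self r))⟩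
    classical
    exact ⟨Nat.find hex, Nat.find_spec hex, fun r hr => Nat.find_min' hex hr⟩
  set V : ℕ → Ω → ℝ := fun r ω => dyadicMaximal θ (fun t => x t ω) r 0 with hV
  set b : ℝ := K₀ * 2 ^ φ / L ^ 2 * ((2 : ℝ) ^ r₀) ^ (φ - 2) with hb
  have hb0 : 0 ≤ b := by positivity
  -- For `2 ^ r ≤ d < 2 ^ (r + 1)` the form of level `r + 1` dominates the squared sum, and `L * d`
  -- is at least `L * 2 ^ r`.
  have hsub : {ω | ∃ d : ℕ, 1 ≤ d ∧ d₀ < d ∧ L * d ≤ |∑ t ∈ Finset.range d, x t ω|}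
      ⊆ ⋃ s : ℕ, {ω | L ^ 2 * ((2 : ℝ) ^ (r₀ + s)) ^ 2 ≤ V (r₀ + s + 1) ω} := by
    rintro ω ⟨d, hd1, hd2, hd3⟩
    have h1 : 2 ^ Nat.log 2 d ≤ d := Nat.pow_log_le_self 2 (by omega)
    have h2 : d < 2 ^ (Nat.log 2 d + 1) := Nat.lt_pow_succ_log_self one_lt_two d
    have h2' : (d : ℝ) < 2 ^ (Nat.log 2 d + 1) := by exact_mod_cast h2
    obtain ⟨s, hs⟩ := Nat.exists_eq_add_of_le (hmin _ (hd2.trans h2'))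
    refine Set.mem_iUnion.2 ⟨s, ?_⟩
    have h3 := sq_sum_le_dyadicMaximal hθ0 (fun t => x t ω) (Nat.log 2 d + 1) 0 d h2.le
    simp only [zero_add] at h3
    rw [hs] at h3 h1
    have h1' : (2 : ℝ) ^ (r₀ + s) ≤ d := by exact_mod_cast h1
    refine le_trans ?_ h3
    rw [← mul_pow, ← sq_abs (∑ t ∈ Finset.range d, x t ω)]
    exact pow_le_pow_left₀ (by positivity) ((mul_le_mul_of_nonneg_left h1' hL.le).trans hd3) 2
  have hterm : ∀ s : ℕ, P {ω | L ^ 2 * ((2 : ℝ) ^ (r₀ + s)) ^ 2 ≤ V (r₀ + s + 1) ω}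
      ≤ ENNReal.ofReal (b * q ^ s) := by
    intro s
    have hpos : 0 < L ^ 2 * ((2 : ℝ) ^ (r₀ + s)) ^ 2 := by positivity
    have h1 := mul_meas_ge_le_integral_of_nonneg (μ := P)
      (Eventually.of_forall fun ω => dyadicMaximal_nonneg hθ0 (fun t => x t ω) (r₀ + s + 1) 0)
      (integrable_dyadicMaximal hx θ (r₀ + s + 1) 0) (L ^ 2 * ((2 : ℝ) ^ (r₀ + s)) ^ 2)
    have h2 := h1.trans (integral_dyadicMaximal_le hx hmom hθ0 hCK hK (r₀ + s + 1) 0)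
    rw [← le_div_iff₀' hpos] at h2
    refine (ENNReal.le_ofReal_iff_toReal_le (measure_ne_top _ _) (by positivity)).2 ?_
    refine h2.trans (le_of_eq ?_)
    have e1 : ((2 : ℝ) ^ (r₀ + s + 1)) ^ φ = ((2 : ℝ) ^ (r₀ + s)) ^ φ * 2 ^ φ := by
      rw [pow_succ, Real.mul_rpow (by positivity) (by positivity)]
    have e2 : ((2 : ℝ) ^ r₀) ^ (φ - 2) * q ^ s
        = ((2 : ℝ) ^ (r₀ + s)) ^ φ / ((2 : ℝ) ^ (r₀ + s)) ^ 2 := by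
      rw [hq, ← Real.rpow_natCast (2 ^ (φ - 2)) s, ← Real.rpow_mul (by positivity),
        mul_comm (φ - 2), Real.rpow_mul (by positivity), Real.rpow_natCast,
        ← Real.mul_rpow (by positivity) (by positivity), ← pow_add,
        Real.rpow_sub (by positivity)]
      norm_cast
    rw [hb, mul_assoc, e2, e1]
    field_simp
  have hgeo : HasSum (fun s : ℕ => b * q ^ s) (b * (1 - q)⁻¹) :=
    (hasSum_geometric_of_lt_one hq0.le hq1).mul_left b
  calc P _ ≤ P (⋃ s : ℕ, {ω | L ^ 2 * ((2 : ℝ) ^ (r₀ + s)) ^ 2 ≤ V (r₀ + s + 1) ω}) :=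
        measure_mono hsub
    _ ≤ ∑' s : ℕ, ENNReal.ofReal (b * q ^ s) :=
        (measure_iUnion_le _).trans (ENNReal.tsum_le_tsum hterm)
    _ = ENNReal.ofReal (b * (1 - q)⁻¹) := by
        rw [← ENNReal.ofReal_tsum_of_nonneg (fun s => by positivity) hgeo.summable, hgeo.tsum_eq]
    _ ≤ _ := by
        refine ENNReal.ofReal_le_ofReal ?_
        have e1 : ((2 : ℝ) ^ r₀) ^ (φ - 2) ≤ (d₀ / 2) ^ (φ - 2) := by
          refine Real.rpow_le_rpow_of_nonpos (by positivity) ?_ (by linarith)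
          rw [pow_succ] at hr₀
          linarith
        have e2 : (2 : ℝ) ^ φ * (d₀ / 2) ^ (φ - 2) = 4 * d₀ ^ (φ - 2) := by
          rw [Real.div_rpow hd₀.le (by norm_num), Real.rpow_sub (by norm_num : (0 : ℝ) < 2)]
          have : (2 : ℝ) ^ (2 : ℝ) = 4 := by norm_num
          rw [this]
          field_simp
        have hq' : 0 < 1 - q := by linarith
        calc b * (1 - q)⁻¹ ≤ K₀ * 2 ^ φ / L ^ 2 * (d₀ / 2) ^ (φ - 2) * (1 - q)⁻¹ := by
              rw [hb]; gcongr
          _ = K₀ * (2 ^ φ * (d₀ / 2) ^ (φ - 2)) / L ^ 2 * (1 - q)⁻¹ := by ring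
          _ = 4 * K₀ / (1 - q) * d₀ ^ (φ - 2) / L ^ 2 := by rw [e2]; field_simp
end

/-! ### Stationary noise -/

section

variable {Ω : Type*} [MeasurableSpace Ω] {P : Measure Ω} {X : ℤ → Ω → ℝ}

lemma sum_range_int_eq_sum_Icc (f : ℤ → ℝ) (u : ℤ) (l : ℕ) :
    ∑ t ∈ Finset.range l, f (u + t) = ∑ t ∈ Finset.Icc u (u + l - 1), f t := by
  refine Finset.sum_bij' (fun t _ => u + t) (fun t _ => (t - u).toNat) ?_ ?_ ?_ ?_ ?_
  · intro t ht; rw [Finset.mem_range] at ht; rw [Finset.mem_Icc]; omega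
  · intro t ht; rw [Finset.mem_Icc] at ht; rw [Finset.mem_range]; omega
  · intro t _; simp
  · intro t ht; rw [Finset.mem_Icc] at ht; omega
  · intro t _; rfl

/-- The moment bound is assumed for blocks of positive times only; stationarity carries it to every
position, including the negative times reached when sums run leftwards. -/
lemma IsStrictlyStationary.integral_sq_sum_le (hstat : IsStrictlyStationary X P) {C φ : ℝ}
    (hφ : 0 < φ) (hmoment : ∀ i j : ℤ, 1 ≤ i → i ≤ j →
      ∫ ω, (∑ t ∈ Finset.Icc i j, X t ω) ^ 2 ∂P ≤ C * ((j : ℝ) - i + 1) ^ φ) (u : ℤ) (l : ℕ) :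
    ∫ ω, (∑ t ∈ Finset.range l, X (u + t) ω) ^ 2 ∂P ≤ C * (l : ℝ) ^ φ := by
  rcases Nat.eq_zero_or_pos l with rfl | hl
  · simp [Real.zero_rpow hφ.ne']
  have h1 := hstat l (fun j => 1 + j) (u - 1)
  have h2 := (h1.comp (u := fun v : Fin l → ℝ => (∑ j, v j) ^ 2) (by fun_prop)).integral_eq
  have e1 : ∀ ω, ∑ t ∈ Finset.range l, X (u + t) ω = ∑ j : Fin l, X (1 + j + (u - 1)) ω := by
    intro ω
    rw [Finset.sum_range]
    refine Finset.sum_congr rfl fun j _ => ?_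
    congr 1
    ring_nf
  have e2 : ∀ ω, ∑ j : Fin l, X (1 + j) ω = ∑ t ∈ Finset.Icc 1 (l : ℤ), X t ω := by
    intro ω
    rw [← Finset.sum_range (fun t : ℕ => X (1 + t) ω), sum_range_int_eq_sum_Icc (fun t => X t ω)]
    congr 2
    ring
  simp only [e1]
  simp only [Function.comp_def] at h2
  rw [h2]
  simp only [e2]
  refine (hmoment 1 l le_rfl (by omega)).trans (le_of_eq ?_)
  simp

lemma IsStrictlyStationary.integral_sq_sum_sub_le (hstat : IsStrictlyStationary X P) {C φ : ℝ}
    (hφ : 0 < φ) (hmoment : ∀ i j : ℤ, 1 ≤ i → i ≤ j →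
      ∫ ω, (∑ t ∈ Finset.Icc i j, X t ω) ^ 2 ∂P ≤ C * ((j : ℝ) - i + 1) ^ φ) (u : ℤ) (l : ℕ) :
    ∫ ω, (∑ t ∈ Finset.range l, X (u - t) ω) ^ 2 ∂P ≤ C * (l : ℝ) ^ φ := by
  refine le_of_eq_of_le ?_ (hstat.integral_sq_sum_le hφ hmoment (u - l + 1) l)
  congr 1
  ext ω
  rw [← Finset.sum_range_reflect]
  congr 1
  refine Finset.sum_congr rfl fun t ht => ?_
  rw [Finset.mem_range] at ht
  congr 1
  omega

end

/-! ### Bridges -/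

/-- The bridge `∑_{t = s}^{j} y t - (j - s + 1) θ̂_{s,e}`. -/
noncomputable def bridge (y : ℤ → ℝ) (s e j : ℤ) : ℝ :=
  ∑ t ∈ Finset.Icc s j, y t - ((j : ℝ) - s + 1) * thetaHat y s e

/-- The sum of squares of the bridge. -/
noncomputable def bridgeEnergy (y : ℤ → ℝ) (s e : ℤ) : ℝ :=
  ∑ i ∈ Finset.Icc s e, bridge y s e i ^ 2

lemma bridgeEnergy_nonneg (y : ℤ → ℝ) (s e : ℤ) : 0 ≤ bridgeEnergy y s e :=
  Finset.sum_nonneg fun _ _ => sq_nonneg _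

lemma sum_Icc_add_sum_Icc (y : ℤ → ℝ) {s j e : ℤ} (hs : s ≤ j + 1) (he : j ≤ e) :
    ∑ t ∈ Finset.Icc s j, y t + ∑ t ∈ Finset.Icc (j + 1) e, y t = ∑ t ∈ Finset.Icc s e, y t := by
  rw [← Finset.sum_union]
  · congr 1
    ext t
    simp only [Finset.mem_union, Finset.mem_Icc]
    omega
  · rw [Finset.disjoint_left]
    intro t ht ht'
    rw [Finset.mem_Icc] at ht ht'
    omega

lemma sum_Icc_of_eq {y : ℤ → ℝ} {s e : ℤ} {v : ℝ} (hse : s ≤ e + 1)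
    (hy : ∀ t, s ≤ t → t ≤ e → y t = v) :
    ∑ t ∈ Finset.Icc s e, y t = ((e : ℝ) - s + 1) * v := by
  rw [Finset.sum_congr rfl fun t ht => hy t (Finset.mem_Icc.1 ht).1 (Finset.mem_Icc.1 ht).2,
    Finset.sum_const, Int.card_Icc, nsmul_eq_mul]
  congr 1
  have : (((e + 1 - s).toNat : ℤ) : ℝ) = ((e + 1 - s : ℤ) : ℝ) := by
    rw [Int.toNat_of_nonneg (by omega)]
  rw [Int.cast_natCast] at this
  rw [this]
  push_cast
  ring

lemma intCast_length_pos {s e : ℤ} (h : s ≤ e) : (0 : ℝ) < (e : ℝ) - s + 1 := by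
  have : (s : ℝ) ≤ e := by exact_mod_cast h
  linarith

lemma length_mul_thetaHat (y : ℤ → ℝ) {s e : ℤ} (h : s ≤ e) :
    ((e : ℝ) - s + 1) * thetaHat y s e = ∑ t ∈ Finset.Icc s e, y t :=
  mul_div_cancel₀ _ (intCast_length_pos h).ne'

lemma bridge_sub_bridge (y : ℤ → ℝ) {s e i j : ℤ} (hi : s ≤ i + 1) (hij : i ≤ j) :
    bridge y s e j - bridge y s e i
      = ∑ t ∈ Finset.Icc (i + 1) j, y t - ((j : ℝ) - i) * thetaHat y s e := by
  rw [bridge, bridge, ← sum_Icc_add_sum_Icc y hi hij]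
  ring

lemma bridge_right (y : ℤ → ℝ) {s e : ℤ} (h : s ≤ e) : bridge y s e e = 0 := by
  rw [bridge, length_mul_thetaHat y h, sub_self]

lemma bridge_left (y : ℤ → ℝ) (s e : ℤ) : bridge y s e (s - 1) = 0 := by
  rw [bridge, Finset.Icc_eq_empty (by omega)]
  push_cast
  simp

lemma length_mul_bridge (y : ℤ → ℝ) {s j e : ℤ} (hs : s ≤ j) (he : j < e) :
    ((e : ℝ) - s + 1) * bridge y s e j
      = ((j : ℝ) - s + 1) * ((e : ℝ) - j) * (thetaHat y s j - thetaHat y (j + 1) e) := by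
  have h1 := length_mul_thetaHat y hs
  have h2 := length_mul_thetaHat y (show j + 1 ≤ e by omega)
  have h3 := length_mul_thetaHat y (show s ≤ e by omega)
  rw [← sum_Icc_add_sum_Icc y (show s ≤ j + 1 by omega) he.le] at h3
  push_cast at h2
  have h2' : ((e : ℝ) - j) * thetaHat y (j + 1) e = ∑ t ∈ Finset.Icc (j + 1) e, y t := by
    rw [← h2]; ring
  rw [bridge]
  rw [← h1, ← h2'] at h3
  rw [← h1]
  linear_combination (-((j : ℝ) - s + 1)) * h3

lemma sq_weighted_div (a b x N M : ℝ) :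
    a ^ 2 * b ^ 2 / (N ^ 2 * M ^ 2) * x ^ 2 = (a * b * x / M) ^ 2 / N ^ 2 := by
  ring

/-- The weighted differences of means are exactly the bridge values divided by the window length. -/
lemma normaliserL_eq (y : ℤ → ℝ) (t₁ k t₂ : ℤ) :
    normaliserL y t₁ k t₂ = bridgeEnergy y t₁ k / ((t₂ : ℝ) - t₁ + 1) ^ 2 := by
  rw [normaliserL, bridgeEnergy, Finset.sum_div]
  refine Finset.sum_congr rfl fun i hi => ?_
  rw [Finset.mem_Icc] at hi
  rcases hi.2.lt_or_eq with hlt | rfl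
  · have h1 := length_mul_bridge y hi.1 hlt
    have h2 := intCast_length_pos (hi.1.trans hi.2)
    have h3 : bridge y t₁ k i = ((i : ℝ) - t₁ + 1) * ((k : ℝ) - i) *
        (thetaHat y t₁ i - thetaHat y (i + 1) k) / ((k : ℝ) - t₁ + 1) := by
      rw [← h1, mul_div_cancel_left₀ _ h2.ne']
    rw [h3, sq_weighted_div]
  -- At `i = k` the right-hand mean is over an empty range, but its weight vanishes, as does the
  -- bridge.
  · rw [bridge_right y hi.1]
    simp

/-- The bridge vanishes at `s - 1` and at `e`, so the index range may be shifted by one. -/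
lemma bridgeEnergy_eq_sum_sub_one (y : ℤ → ℝ) {s e : ℤ} (h : s ≤ e) :
    bridgeEnergy y s e = ∑ i ∈ Finset.Icc s e, bridge y s e (i - 1) ^ 2 := by
  have h1 : ∑ i ∈ Finset.Icc s e, bridge y s e (i - 1) ^ 2
      = ∑ i ∈ Finset.Icc (s - 1) (e - 1), bridge y s e i ^ 2 := by
    refine Finset.sum_bij' (fun i _ => i - 1) (fun i _ => i + 1) ?_ ?_ ?_ ?_ ?_
    · intro i hi; rw [Finset.mem_Icc] at hi ⊢; omega
    · intro i hi; rw [Finset.mem_Icc] at hi ⊢; omega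
    · intro i _; ring
    · intro i _; ring
    · intro i _; rfl
  rw [h1, bridgeEnergy]
  have h2 : Finset.Icc s e = insert e (Finset.Icc s (e - 1)) := by
    ext t; simp only [Finset.mem_insert, Finset.mem_Icc]; omega
  have h3 : Finset.Icc (s - 1) (e - 1) = insert (s - 1) (Finset.Icc s (e - 1)) := by
    ext t; simp only [Finset.mem_insert, Finset.mem_Icc]; omega
  rw [h2, h3, Finset.sum_insert (by simp), Finset.sum_insert (by simp), bridge_right y h,
    bridge_left]

lemma normaliserR_eq (y : ℤ → ℝ) {t₁ k t₂ : ℤ} (hk : k < t₂) :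
    normaliserR y t₁ k t₂ = bridgeEnergy y (k + 1) t₂ / ((t₂ : ℝ) - t₁ + 1) ^ 2 := by
  rw [normaliserR, bridgeEnergy_eq_sum_sub_one y (show k + 1 ≤ t₂ by omega), Finset.sum_div]
  refine Finset.sum_congr rfl fun i hi => ?_
  rw [Finset.mem_Icc] at hi
  rcases hi.1.lt_or_eq with hlt | rfl
  · have h1 := length_mul_bridge y (show k + 1 ≤ i - 1 by omega) (show i - 1 < t₂ by omega)
    have h2 := intCast_length_pos (show k + 1 ≤ t₂ by omega)
    have h3 : bridge y (k + 1) t₂ (i - 1) = (((i - 1 : ℤ) : ℝ) - ((k + 1 : ℤ) : ℝ) + 1) *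
        ((t₂ : ℝ) - ((i - 1 : ℤ) : ℝ)) *
        (thetaHat y (k + 1) (i - 1) - thetaHat y i t₂) / ((t₂ : ℝ) - ((k + 1 : ℤ) : ℝ) + 1) := by
      rw [sub_add_cancel] at h1
      rw [← h1, mul_div_cancel_left₀ _ h2.ne']
    have e1 : ((t₂ : ℝ) - ((k + 1 : ℤ) : ℝ) + 1) = t₂ - k := by push_cast; ring
    have e2 : ((i - 1 : ℤ) : ℝ) - ((k + 1 : ℤ) : ℝ) + 1 = i - 1 - k := by push_cast; ring
    have e3 : (t₂ : ℝ) - ((i - 1 : ℤ) : ℝ) = t₂ - i + 1 := by push_cast; ring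
    rw [h3, e1, e2, e3, sq_weighted_div, mul_comm ((i : ℝ) - 1 - k),
      mul_assoc _ _ (thetaHat y (k + 1) (i - 1) - thetaHat y i t₂),
      ← neg_sub (thetaHat y i t₂), mul_neg, mul_neg, neg_div, neg_sq, ← mul_assoc]
  · rw [add_sub_cancel_right]
    have := bridge_left y (k + 1) t₂
    rw [add_sub_cancel_right] at this
    rw [this]
    push_cast
    simp

lemma cusum_sq (y : ℤ → ℝ) {s j e : ℤ} (hs : s ≤ j) (he : j < e) :
    cusum y s e j ^ 2 = bridge y s e j ^ 2 / (((j : ℝ) - s + 1) * ((e : ℝ) - j)) := by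
  have h1 := intCast_length_pos hs
  have h2 : (0 : ℝ) < (e : ℝ) - j := sub_pos.2 (by exact_mod_cast he)
  have h3 := intCast_length_pos (hs.trans he.le)
  have h4 := length_mul_bridge y hs he
  have h5 : bridge y s e j = ((j : ℝ) - s + 1) * ((e : ℝ) - j) *
      (thetaHat y s j - thetaHat y (j + 1) e) / ((e : ℝ) - s + 1) := by
    rw [← h4, mul_div_cancel_left₀ _ h3.ne']
  rw [cusum, mul_pow, div_pow, Real.sq_sqrt (by positivity), h5]
  field_simp
  ring

lemma contrastD_sq (y : ℤ → ℝ) {t₁ k t₂ : ℤ} (h₁ : t₁ ≤ k) (h₂ : k < t₂) :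
    contrastD y t₁ k t₂ ^ 2 = (((k : ℝ) - t₁ + 1) * ((t₂ : ℝ) - k)) ^ 2 /
      ((t₂ : ℝ) - t₁ + 1) ^ 3 * (thetaHat y t₁ k - thetaHat y (k + 1) t₂) ^ 2 := by
  have h3 := intCast_length_pos (h₁.trans h₂.le)
  rw [contrastD, mul_pow, div_pow, ← Real.rpow_natCast (((t₂ : ℝ) - t₁ + 1) ^ (3 / 2 : ℝ)),
    ← Real.rpow_mul h3.le]
  norm_num

lemma contrastD_sq_le (y : ℤ → ℝ) {t₁ k t₂ : ℤ} (h₁ : t₁ ≤ k) (h₂ : k < t₂) :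
    contrastD y t₁ k t₂ ^ 2
      ≤ ((t₂ : ℝ) - t₁ + 1) * (thetaHat y t₁ k - thetaHat y (k + 1) t₂) ^ 2 := by
  rw [contrastD_sq y h₁ h₂]
  have h3 := intCast_length_pos (h₁.trans h₂.le)
  have h4 := intCast_length_pos h₁
  have h5 : (0 : ℝ) < (t₂ : ℝ) - k := sub_pos.2 (by exact_mod_cast h₂)
  refine mul_le_mul_of_nonneg_right ?_ (sq_nonneg _)
  rw [div_le_iff₀ (by positivity)]
  have h6 : ((k : ℝ) - t₁ + 1) * ((t₂ : ℝ) - k) ≤ ((t₂ : ℝ) - t₁ + 1) ^ 2 := by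
    nlinarith
  calc (((k : ℝ) - t₁ + 1) * ((t₂ : ℝ) - k)) ^ 2 ≤ (((t₂ : ℝ) - t₁ + 1) ^ 2) ^ 2 :=
        pow_le_pow_left₀ (by positivity) h6 2
    _ = _ := by ring

lemma thetaHat_add (x f : ℤ → ℝ) (s e : ℤ) :
    thetaHat (fun t => x t + f t) s e = thetaHat x s e + thetaHat f s e := by
  simp only [thetaHat, Finset.sum_add_distrib, add_div]

lemma bridge_add (x f : ℤ → ℝ) (s e j : ℤ) :
    bridge (fun t => x t + f t) s e j = bridge x s e j + bridge f s e j := by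
  simp only [bridge, thetaHat_add, Finset.sum_add_distrib]
  ring

lemma bridgeEnergy_add_ge (x f : ℤ → ℝ) (s e : ℤ) :
    bridgeEnergy f s e / 2 - bridgeEnergy x s e ≤ bridgeEnergy (fun t => x t + f t) s e := by
  simp only [bridgeEnergy, Finset.sum_div, ← Finset.sum_sub_distrib, bridge_add]
  refine Finset.sum_le_sum fun i _ => ?_
  nlinarith [sq_nonneg (2 * bridge x s e i + bridge f s e i)]

lemma thetaHat_of_eq {f : ℤ → ℝ} {s e : ℤ} {v : ℝ} (hse : s ≤ e)
    (hf : ∀ t, s ≤ t → t ≤ e → f t = v) : thetaHat f s e = v := by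
  rw [thetaHat, sum_Icc_of_eq (by omega) hf, mul_div_cancel_left₀ _ (intCast_length_pos hse).ne']

/-! ### Reflection of time -/

lemma sum_Icc_neg (y : ℤ → ℝ) (a b : ℤ) :
    ∑ t ∈ Finset.Icc (-b) (-a), y (-t) = ∑ t ∈ Finset.Icc a b, y t := by
  refine Finset.sum_bij' (fun i _ => -i) (fun i _ => -i) ?_ ?_ ?_ ?_ ?_
  · intro i hi; rw [Finset.mem_Icc] at hi ⊢; omega
  · intro i hi; rw [Finset.mem_Icc] at hi ⊢; omega
  · intro i _; ring
  · intro i _; ring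
  · intro i _; rfl

lemma thetaHat_neg (y : ℤ → ℝ) (a b : ℤ) :
    thetaHat (fun t => y (-t)) (-b) (-a) = thetaHat y a b := by
  rw [thetaHat, thetaHat, sum_Icc_neg]
  push_cast
  ring

/-- The bridge lives on cuts between `j` and `j + 1`; reflection sends this cut to the one after `-j
- 1`, and the sign flips because the centred total is zero. -/
lemma bridge_neg (y : ℤ → ℝ) {s e j : ℤ} (hs : s ≤ j + 1) (he : j ≤ e) (hse : s ≤ e) :
    bridge (fun t => y (-t)) (-e) (-s) (-j - 1) = -bridge y s e j := by
  have h1 := length_mul_thetaHat y hse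
  rw [← sum_Icc_add_sum_Icc y hs he] at h1
  rw [bridge, bridge, thetaHat_neg, show -j - 1 = -(j + 1) by ring, sum_Icc_neg]
  push_cast
  linear_combination -h1

lemma bridgeEnergy_neg (y : ℤ → ℝ) {s e : ℤ} (hse : s ≤ e) :
    bridgeEnergy (fun t => y (-t)) (-e) (-s) = bridgeEnergy y s e := by
  rw [bridgeEnergy_eq_sum_sub_one _ (by omega), bridgeEnergy]
  refine Finset.sum_bij' (fun i _ => -i) (fun i _ => -i) ?_ ?_ ?_ ?_ ?_
  · intro i hi; rw [Finset.mem_Icc] at hi ⊢; omega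
  · intro i hi; rw [Finset.mem_Icc] at hi ⊢; omega
  · intro i _; ring
  · intro i _; ring
  · intro i hi
    rw [Finset.mem_Icc] at hi
    have := bridge_neg y (j := -i) (show s ≤ -i + 1 by omega) (by omega) hse
    rw [neg_neg] at this
    rw [this, neg_sq]

/-! ### Noise bounds -/

namespace RegularNoise

variable {x : ℤ → ℝ} {n : ℤ} {A c ρ : ℝ}

lemma abs_sum_le (h : RegularNoise x n A c ρ) {s j : ℤ} (hs : 1 ≤ s) (hsj : s ≤ j + 1)
    (hj : j ≤ n) : |∑ t ∈ Finset.Icc s j, x t| ≤ 2 * (A * √n) := by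
  have h1 := h.abs_le j (Finset.mem_Icc.2 ⟨by omega, hj⟩)
  have h2 := h.abs_le (s - 1) (Finset.mem_Icc.2 ⟨by omega, by omega⟩)
  have h3 := sum_Icc_add_sum_Icc x (s := 1) (j := s - 1) (e := j) (by omega) (by omega)
  rw [sub_add_cancel] at h3
  have h4 : ∑ t ∈ Finset.Icc s j, x t = partialSum x j - partialSum x (s - 1) := by
    rw [partialSum, partialSum]; linarith
  rw [h4]
  linarith [abs_sub (partialSum x j) (partialSum x (s - 1))]

lemma abs_thetaHat_le (h : RegularNoise x n A c ρ) {s e : ℤ} (hs : 1 ≤ s) (hse : s ≤ e)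
    (he : e ≤ n) : |thetaHat x s e| ≤ 2 * (A * √n) / ((e : ℝ) - s + 1) := by
  have h0 := intCast_length_pos hse
  rw [thetaHat, abs_div, abs_of_pos h0]
  exact div_le_div_of_nonneg_right (h.abs_sum_le hs (by omega) he) h0.le

lemma abs_bridge_le (h : RegularNoise x n A c ρ) {s e j : ℤ} (hs : 1 ≤ s) (hsj : s ≤ j + 1)
    (hje : j ≤ e) (hse : s ≤ e) (he : e ≤ n) : |bridge x s e j| ≤ 4 * (A * √n) := by
  have h0 := intCast_length_pos hse
  have h1 := h.abs_sum_le hs hsj (hje.trans he)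
  have h2 := h.abs_thetaHat_le hs hse he
  have h3 : (0 : ℝ) ≤ (j : ℝ) - s + 1 := by
    have : (s : ℝ) ≤ j + 1 := by exact_mod_cast hsj
    linarith
  have h4 : (j : ℝ) ≤ e := by exact_mod_cast hje
  have h5 : |((j : ℝ) - s + 1) * thetaHat x s e| ≤ 2 * (A * √n) := by
    rw [abs_mul, abs_of_nonneg h3]
    calc ((j : ℝ) - s + 1) * |thetaHat x s e|
        ≤ ((e : ℝ) - s + 1) * (2 * (A * √n) / ((e : ℝ) - s + 1)) :=
          mul_le_mul (by linarith) h2 (abs_nonneg _) h0.le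
      _ = _ := by field_simp
  rw [bridge]
  linarith [abs_sub (∑ t ∈ Finset.Icc s j, x t) (((j : ℝ) - s + 1) * thetaHat x s e)]

lemma bridgeEnergy_le (h : RegularNoise x n A c ρ) {s e : ℤ} (hs : 1 ≤ s) (hse : s ≤ e)
    (he : e ≤ n) : bridgeEnergy x s e ≤ ((e : ℝ) - s + 1) * (16 * (A ^ 2 * n)) := by
  have hn : (0 : ℝ) ≤ n := by exact_mod_cast (by omega : 0 ≤ n)
  have h1 : ∑ i ∈ Finset.Icc s e, (16 * (A ^ 2 * n)) = ((e : ℝ) - s + 1) * (16 * (A ^ 2 * n)) :=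
    sum_Icc_of_eq (y := fun _ => 16 * (A ^ 2 * n)) (by omega) fun _ _ _ => rfl
  rw [← h1]
  refine Finset.sum_le_sum fun i hi => ?_
  rw [Finset.mem_Icc] at hi
  have h2 := h.abs_bridge_le hs (by omega) hi.2 hse he
  rw [← sq_abs]
  calc |bridge x s e i| ^ 2 ≤ (4 * (A * √n)) ^ 2 := pow_le_pow_left₀ (abs_nonneg _) h2 2
    _ = 16 * (A ^ 2 * √n ^ 2) := by ring
    _ = _ := by rw [Real.sq_sqrt hn]

/-- Where the signal is constant, the bridge of signal plus noise is the noise partial sum minus an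
affine function, whatever the signal does elsewhere; the other terms of the energy are dropped. -/
lemma le_bridgeEnergy (h : RegularNoise x n A c ρ) {f : ℤ → ℝ} {s e a b : ℤ} {v : ℝ} (hs : 1 ≤ s)
    (he : e ≤ n) (hsa : s ≤ a) (hbe : b ≤ e) (hf : ∀ t, a ≤ t → t ≤ b → f t = v)
    (hab : ρ * n ≤ b - a) : c * (n : ℝ) ^ 2 ≤ bridgeEnergy (fun t => x t + f t) s e := by
  set y : ℤ → ℝ := fun t => x t + f t with hy
  set θ := thetaHat y s e
  refine (h.le_sum a b (by omega) (by omega) hab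
    (partialSum x (a - 1) - ∑ t ∈ Finset.Icc s (a - 1), y t + (a - 1) * v - (s - 1) * θ)
    (θ - v)).trans ?_
  refine le_trans (le_of_eq (Finset.sum_congr rfl fun i hi => ?_))
    (Finset.sum_le_sum_of_subset_of_nonneg (Finset.Icc_subset_Icc hsa hbe)
      fun i _ _ => sq_nonneg (bridge y s e i))
  rw [Finset.mem_Icc] at hi
  congr 1
  have h1 := sum_Icc_add_sum_Icc y (s := s) (j := a - 1) (e := i) (by omega) (by omega)
  have h2 := sum_Icc_add_sum_Icc x (s := 1) (j := a - 1) (e := i) (by omega) (by omega)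
  rw [sub_add_cancel] at h1 h2
  have h3 : ∑ t ∈ Finset.Icc a i, y t = ∑ t ∈ Finset.Icc a i, x t + ((i : ℝ) - a + 1) * v := by
    rw [← sum_Icc_of_eq (y := f) (by omega) fun t ha hi' => hf t ha (by omega),
      ← Finset.sum_add_distrib]
  rw [bridge, ← h1, h3, partialSum, partialSum, ← h2]
  ring

end RegularNoise

/-! ### Energy of a piecewise constant signal -/

lemma bridge_eq_of_eq_right {f : ℤ → ℝ} {s e i : ℤ} {v : ℝ} (hse : s ≤ e) (hi : s ≤ i + 1)
    (hie : i ≤ e) (hf : ∀ t, i < t → t ≤ e → f t = v) :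
    bridge f s e i = -(((e : ℝ) - i) * (v - thetaHat f s e)) := by
  have h1 := bridge_sub_bridge f (e := e) hi hie
  rw [bridge_right f hse, sum_Icc_of_eq (v := v) (by omega) fun t h1 h2 => hf t (by omega) h2] at h1
  push_cast at h1
  linear_combination -h1

/-- Seen from its zero at `e`, the bridge is linear with slope `v - θ̂` up to sign, hence at least
`l |v - θ̂|` in size at `l` places. -/
lemma le_bridgeEnergy_of_long {f : ℤ → ℝ} {s e : ℤ} {v : ℝ} {l : ℕ} (hl : s + 2 * l ≤ e)
    (hf : ∀ t, e - 2 * l < t → t ≤ e → f t = v) :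
    (l : ℝ) * (l : ℝ) ^ 2 * (v - thetaHat f s e) ^ 2 ≤ bridgeEnergy f s e := by
  refine le_trans ?_ (sum_comp_le_sum_of_injOn (s := Finset.range l) (t := Finset.Icc s e)
    (f := fun u : ℕ => e - l - u) (F := fun i => bridge f s e i ^ 2)
    (fun u _ v _ huv => by simpa using huv) (fun u hu => ?_) fun _ => sq_nonneg _)
  · have h1 : ∀ u ∈ Finset.range l, (l : ℝ) ^ 2 * (v - thetaHat f s e) ^ 2
        ≤ bridge f s e (e - l - u) ^ 2 := by
      intro u hu
      rw [Finset.mem_range] at hu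
      rw [bridge_eq_of_eq_right (v := v) (by omega) (by omega) (by omega)
        fun t ht ht' => hf t (by omega) ht', neg_sq, mul_pow]
      push_cast
      have : (0 : ℝ) ≤ u := Nat.cast_nonneg u
      have : (0 : ℝ) ≤ l := Nat.cast_nonneg l
      gcongr
      linarith
    have h2 := Finset.sum_le_sum h1
    rw [Finset.sum_const, Finset.card_range, nsmul_eq_mul] at h2
    linarith
  · rw [Finset.mem_range] at hu
    exact Finset.mem_Icc.2 ⟨by omega, by omega⟩

/-- At the jump `b` the bridge equals `(e - b) (v - θ̂)` up to sign. To the left it is linear with a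
slope depending on the unknown `v'`, which is eliminated by `B(b) = 2 B(b - r) - B(b - 2 r)`.
Squaring gives the weights `8` and `2`, and summing over `r = 1, …, l` the factor `10`. -/
lemma le_bridgeEnergy_of_jump {f : ℤ → ℝ} {s e b : ℤ} {v v' : ℝ} {l : ℕ} (hl : s + 2 * l ≤ b)
    (hbe : b ≤ e) (hf : ∀ t, b < t → t ≤ e → f t = v)
    (hf' : ∀ t, b - 2 * l < t → t ≤ b → f t = v') :
    (l : ℝ) * ((e : ℝ) - b) ^ 2 * (v - thetaHat f s e) ^ 2 ≤ 10 * bridgeEnergy f s e := by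
  have hb := bridge_eq_of_eq_right (s := s) (by omega) (by omega) hbe hf
  have hlin : ∀ r : ℤ, 0 ≤ r → r ≤ 2 * l →
      bridge f s e (b - r) = bridge f s e b - r * (v' - thetaHat f s e) := by
    intro r hr hr'
    have h1 := bridge_sub_bridge f (s := s) (e := e) (i := b - r) (j := b) (by omega) (by omega)
    rw [sum_Icc_of_eq (v := v') (by omega) fun t h1 h2 => hf' t (by omega) h2] at h1
    push_cast at h1
    linear_combination -h1
  have hmem : ∀ a : ℕ, 1 ≤ a → a ≤ 2 → ∑ u ∈ Finset.range l, bridge f s e (b - a * (u + 1)) ^ 2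
      ≤ bridgeEnergy f s e := by
    intro a ha1 ha2
    refine sum_comp_le_sum_of_injOn (s := Finset.range l) (t := Finset.Icc s e)
      (f := fun u : ℕ => b - a * ((u : ℤ) + 1)) (F := fun i => bridge f s e i ^ 2)
      (fun u _ v _ huv => ?_) (fun u hu => ?_) fun _ => sq_nonneg _
    · interval_cases a <;> simp at huv <;> omega
    · rw [Finset.mem_range] at hu
      interval_cases a <;> exact Finset.mem_Icc.2 ⟨by push_cast; omega, by push_cast; omega⟩
  have hterm : ∀ u ∈ Finset.range l, bridge f s e b ^ 2
      ≤ 8 * bridge f s e (b - (1 : ℕ) * (u + 1)) ^ 2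
        + 2 * bridge f s e (b - (2 : ℕ) * (u + 1)) ^ 2 := by
    intro u hu
    rw [Finset.mem_range] at hu
    rw [hlin _ (by push_cast; omega) (by push_cast; omega),
      hlin _ (by push_cast; omega) (by push_cast; omega)]
    push_cast
    nlinarith [sq_nonneg (3 * bridge f s e b - 4 * (((u : ℝ) + 1) * (v' - thetaHat f s e)))]
  have h1 := Finset.sum_le_sum hterm
  rw [Finset.sum_const, Finset.card_range, nsmul_eq_mul, Finset.sum_add_distrib, ← Finset.mul_sum,
    ← Finset.mul_sum, hb, neg_sq, mul_pow] at h1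
  have h2 := hmem 1 (by norm_num) (by norm_num)
  have h3 := hmem 2 (by norm_num) (by norm_num)
  linarith

/-! ### Segmentations -/

/-- The change-points `κ 1, …, κ m` split `1, …, n` into segments of length at least `g`, and `f`
takes the value `v (i + 1)` at the times `κ i < t ≤ κ (i + 1)`. -/
structure IsSegmentation (f : ℤ → ℝ) (v : ℕ → ℝ) (m : ℕ) (κ : ℕ → ℤ) (n g : ℤ) : Prop where
  zero : κ 0 = 0
  last : κ (m + 1) = n
  spacing : ∀ i ≤ m, κ i + g ≤ κ (i + 1)
  pos : 0 < g
  eq : ∀ i ≤ m, ∀ t, κ i < t → t ≤ κ (i + 1) → f t = v (i + 1)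

namespace IsSegmentation

variable {f : ℤ → ℝ} {v : ℕ → ℝ} {m : ℕ} {κ : ℕ → ℤ} {n g : ℤ}

lemma of_spacing {μ : ℕ → ℝ} (h0 : κ 0 = 0) (hlast : κ (m + 1) = n) (hg : 0 < g)
    (hsp : ∀ i ≤ m, κ i + g ≤ κ (i + 1)) : IsSegmentation (segmentMean m κ μ) μ m κ n g := by
  have hmono : ∀ i j, i ≤ j → j ≤ m + 1 → κ i ≤ κ j := by
    intro i j hij
    induction j, hij using Nat.le_induction with
    | base => intro _; exact le_rfl
    | succ j _ ih =>
      intro hj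
      have := hsp j (by omega)
      have := ih (by omega)
      omega
  refine ⟨h0, hlast, hsp, hg, fun i hi t h1 h2 => ?_⟩
  rw [segmentMean, Finset.sum_eq_single (i + 1)]
  · rw [Nat.add_sub_cancel, if_pos ⟨h1, h2⟩]
  · intro j hj hne
    rw [Finset.mem_Icc] at hj
    refine if_neg fun ⟨h3, h4⟩ => ?_
    rcases lt_or_gt_of_ne hne with hlt | hgt
    · have := hmono j i (by omega) (by omega)
      omega
    · have := hmono (i + 1) (j - 1) (by omega) (by omega)
      omega
  · intro h
    exact absurd (Finset.mem_Icc.2 ⟨by omega, by omega⟩) h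

lemma lt_of_lt (h : IsSegmentation f v m κ n g) {i j : ℕ} (hij : i < j) (hj : j ≤ m + 1) :
    κ i + g ≤ κ j := by
  induction j, hij using Nat.le_induction with
  | base => exact h.spacing i (by omega)
  | succ j _ ih =>
    have := h.spacing j (by omega)
    have := ih (by omega)
    have := h.pos
    omega

lemma mono (h : IsSegmentation f v m κ n g) {i j : ℕ} (hij : i ≤ j) (hj : j ≤ m + 1) :
    κ i ≤ κ j := by
  rcases hij.lt_or_eq with hlt | rfl
  · have := h.lt_of_lt hlt hj
    have := h.pos
    omega
  · exact le_rfl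

lemma exists_segment (h : IsSegmentation f v m κ n g) {t : ℤ} (h1 : 1 ≤ t) (hn : t ≤ n) :
    ∃ i ≤ m, κ i < t ∧ t ≤ κ (i + 1) := by
  have hex : ∃ i, t ≤ κ (i + 1) := ⟨m, by rw [h.last]; exact hn⟩
  classical
  refine ⟨Nat.find hex, Nat.find_min' hex (by rw [h.last]; exact hn), ?_, Nat.find_spec hex⟩
  by_contra hcon
  push Not at hcon
  rcases Nat.eq_zero_or_pos (Nat.find hex) with h0 | hpos
  · rw [h0, h.zero] at hcon
    omega
  · refine Nat.find_min hex (Nat.sub_lt hpos one_pos) ?_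
    rwa [Nat.sub_add_cancel (show 1 ≤ _ from hpos)]

/-- Every window of length `4 l` contains a piece of length `2 l` without change-point. -/
lemma exists_const_piece (h : IsSegmentation f v m κ n g) {l s e : ℤ} (hl : 1 ≤ l)
    (hg : 4 * l ≤ g) (hs : 1 ≤ s) (he : e ≤ n) (hse : s + 4 * l ≤ e + 1) :
    ∃ a b c, s ≤ a ∧ b ≤ e ∧ a + l ≤ b ∧ ∀ t, a ≤ t → t ≤ b → f t = c := by
  -- If the segment of the midpoint starts before the window, the first half is constant; otherwise
  -- the spacing makes the second half constant.
  obtain ⟨i, hi, h1, h2⟩ := h.exists_segment (t := s + 2 * l) (by omega) (by omega)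
  rcases lt_or_ge (κ i) s with hlt | hge
  · exact ⟨s, s + 2 * l, v (i + 1), le_rfl, by omega, by omega,
      fun t ht ht' => h.eq i hi t (by omega) (by omega)⟩
  · have := h.spacing i hi
    exact ⟨s + 2 * l, s + 4 * l - 1, v (i + 1), by omega, by omega, by omega,
      fun t ht ht' => h.eq i hi t (by omega) (by omega)⟩

/-- A half-window mean can deviate from the level at `k` only at the price of bridge energy in the
signal itself. The last change-point is either `2 l` or more before `k` (`le_bridgeEnergy_of_long`)
or nearer, at distance at least `q` (`le_bridgeEnergy_of_jump`). The start `κ 0` is no jump, and `k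
≥ 4 l` then puts it in the first case. -/
lemma le_bridgeEnergy_left (h : IsSegmentation f v m κ n g) {l : ℕ} (hl : 1 ≤ l)
    (hg : 4 * (l : ℤ) ≤ g) {i : ℕ} (hi : i ≤ m) {s k : ℤ} (hs : 1 ≤ s) (hik : κ i < k)
    (hki : k ≤ κ (i + 1)) (hsk : s + 4 * l ≤ k + 1) {q : ℝ} (hq : 0 < q) (hql : q ≤ l)
    (hdist : 1 ≤ i → q ≤ (k : ℝ) - κ i) :
    (l : ℝ) * q ^ 2 * (v (i + 1) - thetaHat f s k) ^ 2 ≤ 10 * bridgeEnergy f s k := by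
  have hl0 : (0 : ℝ) ≤ l := Nat.cast_nonneg l
  rcases le_or_gt (κ i) (k - 2 * l) with hle | hgt
  · have h1 := le_bridgeEnergy_of_long (f := f) (s := s) (e := k) (v := v (i + 1)) (l := l)
      (by omega) fun t ht ht' => h.eq i hi t (by omega) (by omega)
    have h2 : (l : ℝ) * q ^ 2 * (v (i + 1) - thetaHat f s k) ^ 2
        ≤ (l : ℝ) * (l : ℝ) ^ 2 * (v (i + 1) - thetaHat f s k) ^ 2 := by
      gcongr
    have h3 := bridgeEnergy_nonneg f s k
    linarith
  · have hi1 : 1 ≤ i := by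
      by_contra hcon
      have : i = 0 := by omega
      rw [this, h.zero] at hgt
      omega
    have hsp := h.spacing (i - 1) (by omega)
    rw [Nat.sub_add_cancel hi1] at hsp
    have h1 := le_bridgeEnergy_of_jump (f := f) (s := s) (e := k) (b := κ i) (v := v (i + 1))
      (v' := v i) (l := l) (by omega) hik.le (fun t ht ht' => h.eq i hi t ht (by omega))
      (fun t ht ht' => by
        have := h.eq (i - 1) (by omega) t (by omega) (by rw [Nat.sub_add_cancel hi1]; exact ht')
        rwa [Nat.sub_add_cancel hi1] at this)
    have h2 := hdist hi1
    refine le_trans ?_ h1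
    gcongr

/-- Time reflection of the left bound; the last cut before the reflected segment is `-κ (i + 1) -
1`. -/
lemma le_bridgeEnergy_right (h : IsSegmentation f v m κ n g) {l : ℕ} (hl : 1 ≤ l)
    (hg : 4 * (l : ℤ) ≤ g) {i : ℕ} (hi : i ≤ m) {k e : ℤ} (he : e ≤ n) (hik : κ i ≤ k)
    (hki : k < κ (i + 1)) (hke : k + 4 * l ≤ e) {q : ℝ} (hq : 0 < q) (hql : q ≤ l)
    (hdist : i < m → q ≤ (κ (i + 1) : ℝ) - k) :
    (l : ℝ) * q ^ 2 * (v (i + 1) - thetaHat f (k + 1) e) ^ 2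
      ≤ 10 * bridgeEnergy f (k + 1) e := by
  have hl0 : (0 : ℝ) ≤ l := Nat.cast_nonneg l
  rw [← bridgeEnergy_neg f (show k + 1 ≤ e by omega), ← thetaHat_neg]
  rcases le_or_gt (k + 2 * l) (κ (i + 1)) with hle | hgt
  · have h1 := le_bridgeEnergy_of_long (f := fun t => f (-t)) (s := -e) (e := -(k + 1))
      (v := v (i + 1)) (l := l) (by omega) fun t ht ht' => h.eq i hi (-t) (by omega) (by omega)
    have h2 : (l : ℝ) * q ^ 2 * (v (i + 1) - thetaHat (fun t => f (-t)) (-e) (-(k + 1))) ^ 2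
        ≤ (l : ℝ) * (l : ℝ) ^ 2
          * (v (i + 1) - thetaHat (fun t => f (-t)) (-e) (-(k + 1))) ^ 2 := by
      gcongr
    have h3 := bridgeEnergy_nonneg (fun t => f (-t)) (-e) (-(k + 1))
    linarith
  · have him : i < m := by
      by_contra hcon
      have : i = m := by omega
      rw [this, h.last] at hgt
      omega
    have hsp := h.spacing (i + 1) (by omega)
    have h1 := le_bridgeEnergy_of_jump (f := fun t => f (-t)) (s := -e) (e := -(k + 1))
      (b := -κ (i + 1) - 1) (v := v (i + 1)) (v' := v (i + 1 + 1)) (l := l) (by omega) (by omega)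
      (fun t ht ht' => h.eq i hi (-t) (by omega) (by omega))
      (fun t ht ht' => h.eq (i + 1) (by omega) (-t) (by omega) (by omega))
    have h2 := hdist him
    refine le_trans ?_ h1
    push_cast
    have h3 : q ≤ -((k : ℝ) + 1) - (-(κ (i + 1) : ℝ) - 1) := by linarith
    gcongr

end IsSegmentation

/-! ### Bounds for the self-normalised statistic -/

lemma sq_add_add_le (a b c d : ℝ) :
    (a + b - (c + d)) ^ 2 ≤ 4 * (a ^ 2 + b ^ 2 + c ^ 2 + d ^ 2) := by
  nlinarith [sq_nonneg (a - b), sq_nonneg (a + c), sq_nonneg (a + d), sq_nonneg (b + c),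
    sq_nonneg (b + d), sq_nonneg (c - d)]

section

variable {x f : ℤ → ℝ} {v : ℕ → ℝ} {m : ℕ} {κ : ℕ → ℤ} {n g : ℤ} {A c ρ Λ : ℝ} {l : ℕ}

lemma sq_thetaHat_le (hx : RegularNoise x n A c ρ) (hl : 1 ≤ l) (hΛ : (n : ℝ) ≤ Λ * l) {s e : ℤ}
    (hs : 1 ≤ s) (hse : s + 4 * l ≤ e + 1) (he : e ≤ n) :
    n * thetaHat x s e ^ 2 ≤ A ^ 2 * Λ ^ 2 / 4 := by
  have hn : (0 : ℝ) ≤ n := by exact_mod_cast (by omega : 0 ≤ n)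
  have hl' : (1 : ℝ) ≤ l := by exact_mod_cast hl
  have h1 := hx.abs_thetaHat_le hs (by omega) he
  have h2 : 4 * (l : ℝ) ≤ (e : ℝ) - s + 1 := by
    have : (s : ℝ) + 4 * l ≤ e + 1 := by exact_mod_cast hse
    linarith
  rw [le_div_iff₀ (by linarith)] at h1
  have h3 : |thetaHat x s e| * (4 * l) ≤ 2 * (A * √n) :=
    (mul_le_mul_of_nonneg_left h2 (abs_nonneg _)).trans h1
  have h4 := pow_le_pow_left₀ (by positivity) h3 2
  have h5 : thetaHat x s e ^ 2 * (16 * (l : ℝ) ^ 2) ≤ 4 * A ^ 2 * n := by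
    calc thetaHat x s e ^ 2 * (16 * (l : ℝ) ^ 2) = (|thetaHat x s e| * (4 * l)) ^ 2 := by
          rw [mul_pow, sq_abs]; ring
      _ ≤ (2 * (A * √n)) ^ 2 := h4
      _ = 4 * A ^ 2 * √n ^ 2 := by ring
      _ = _ := by rw [Real.sq_sqrt hn]
  have h6 : (n : ℝ) * n ≤ (Λ * l) * (Λ * l) := mul_le_mul hΛ hΛ hn (hn.trans hΛ)
  have h7 : (n * thetaHat x s e ^ 2) * (16 * (l : ℝ) ^ 2) ≤ A ^ 2 * Λ ^ 2 / 4 * (16 * (l : ℝ) ^ 2) := by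
    calc (n * thetaHat x s e ^ 2) * (16 * (l : ℝ) ^ 2)
        = n * (thetaHat x s e ^ 2 * (16 * (l : ℝ) ^ 2)) := by ring
      _ ≤ n * (4 * A ^ 2 * n) := mul_le_mul_of_nonneg_left h5 hn
      _ = 4 * A ^ 2 * (n * n) := by ring
      _ ≤ 4 * A ^ 2 * ((Λ * l) * (Λ * l)) := mul_le_mul_of_nonneg_left h6 (by positivity)
      _ = _ := by ring
  exact le_of_mul_le_mul_right h7 (by positivity)

/-- The self-normaliser of the noise is bounded. -/
lemma normaliser_noise_le (hx : RegularNoise x n A c ρ) (hl : 1 ≤ l) (hΛ : (n : ℝ) ≤ Λ * l)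
    {t₁ k t₂ : ℤ} (h1 : 1 ≤ t₁) (h1k : t₁ + 4 * l ≤ k + 1) (hk2 : k + 4 * l ≤ t₂) (h2 : t₂ ≤ n) :
    (bridgeEnergy x t₁ k + bridgeEnergy x (k + 1) t₂) / ((t₂ : ℝ) - t₁ + 1) ^ 2
      ≤ 2 * A ^ 2 * Λ := by
  have hl' : (1 : ℝ) ≤ l := by exact_mod_cast hl
  have e1 := hx.bridgeEnergy_le h1 (show t₁ ≤ k by omega) (by omega)
  have e2 := hx.bridgeEnergy_le (show 1 ≤ k + 1 by omega) (show k + 1 ≤ t₂ by omega) h2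
  push_cast at e2
  have h3 : 8 * (l : ℝ) ≤ (t₂ : ℝ) - t₁ + 1 := by
    have : (t₁ : ℝ) + 8 * l ≤ t₂ + 1 := by exact_mod_cast (by omega : t₁ + 8 * l ≤ t₂ + 1)
    linarith
  set N : ℝ := (t₂ : ℝ) - t₁ + 1 with hN
  have hN0 : 0 < N := by linarith
  rw [div_le_iff₀ (by positivity)]
  calc bridgeEnergy x t₁ k + bridgeEnergy x (k + 1) t₂ ≤ N * (16 * (A ^ 2 * n)) := by
        rw [hN]; linarith
    _ ≤ N * (16 * (A ^ 2 * (Λ * l))) := by gcongr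
    _ = N * (2 * (A ^ 2 * Λ) * (8 * l)) := by ring
    _ ≤ N * (2 * (A ^ 2 * Λ) * N) := by
        have hn : (0 : ℝ) ≤ n := by exact_mod_cast (by omega : 0 ≤ n)
        have hΛ0 : 0 ≤ Λ := by
          by_contra hcon
          push Not at hcon
          nlinarith
        gcongr
    _ = _ := by ring

lemma le_normaliser (hx : RegularNoise x n A c ρ) (hf : IsSegmentation f v m κ n g) (hc : 0 < c)
    (hl : 1 ≤ l) (hg : 4 * (l : ℤ) ≤ g) (hρ : ρ * n ≤ l)
    {t₁ k t₂ : ℤ} (h1 : 1 ≤ t₁) (h1k : t₁ + 4 * l ≤ k + 1) (hk2 : k + 4 * l ≤ t₂) (h2 : t₂ ≤ n) :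
    c ≤ normaliserL (fun t => x t + f t) t₁ k t₂ + normaliserR (fun t => x t + f t) t₁ k t₂ := by
  obtain ⟨a, b, w, hsa, hbe, hab, hw⟩ := hf.exists_const_piece (by exact_mod_cast hl) hg h1
    (show k ≤ n by omega) h1k
  have e1 : ρ * n ≤ (b : ℝ) - a := by
    have : (a : ℝ) + l ≤ b := by exact_mod_cast hab
    linarith
  have e2 := hx.le_bridgeEnergy h1 (show k ≤ n by omega) hsa hbe hw e1
  rw [normaliserL_eq, normaliserR_eq _ (by omega)]
  have hN0 := intCast_length_pos (show t₁ ≤ t₂ by omega)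
  have hNn : (t₂ : ℝ) - t₁ + 1 ≤ n := by
    have : (t₂ : ℝ) + 1 ≤ n + t₁ := by exact_mod_cast (by omega : t₂ + 1 ≤ n + t₁)
    linarith
  have e3 := bridgeEnergy_nonneg (fun t => x t + f t) (k + 1) t₂
  rw [← add_div, le_div_iff₀ (by positivity)]
  have : c * ((t₂ : ℝ) - t₁ + 1) ^ 2 ≤ c * (n : ℝ) ^ 2 := by gcongr
  linarith

/-- Away from the change-points the self-normalised statistic is small. -/
lemma statT_le (hx : RegularNoise x n A c ρ) (hf : IsSegmentation f v m κ n g) (hc : 0 < c)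
    (hl : 1 ≤ l) (hg : 4 * (l : ℤ) ≤ g) (hρ : ρ * n ≤ l) (hΛ : (n : ℝ) ≤ Λ * l)
    {t₁ k t₂ : ℤ} (h1 : 1 ≤ t₁) (h1k : t₁ + 4 * l ≤ k + 1) (hk2 : k + 4 * l ≤ t₂) (h2 : t₂ ≤ n)
    {q : ℝ} (hq : 0 < q) (hql : q ≤ l) (hdist : ∀ i ∈ Finset.Icc 1 m, q ≤ |(k : ℝ) - κ i|) :
    statT (fun t => x t + f t) t₁ k t₂ ≤ (2 * A ^ 2 * Λ ^ 2 / c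
      + 80 * Λ * (1 + 2 * A ^ 2 * Λ / c)) * (1 + (n / q) ^ 2) := by
  have hl' : (1 : ℝ) ≤ l := by exact_mod_cast hl
  have hn0 : (0 : ℝ) < n := by exact_mod_cast (by omega : 0 < n)
  have hΛ0 : 0 < Λ := by
    by_contra hcon
    push Not at hcon
    nlinarith
  obtain ⟨i, hi, hik, hki⟩ := hf.exists_segment (t := k) (by omega) (by omega)
  have hki' : k < κ (i + 1) := by
    refine lt_of_le_of_ne hki fun heq => ?_
    rcases hi.lt_or_eq with hlt | rfl
    · have := hdist (i + 1) (Finset.mem_Icc.2 ⟨by omega, by omega⟩)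
      rw [← heq, sub_self, abs_zero] at this
      linarith
    · rw [hf.last] at heq
      omega
  have hEL := hf.le_bridgeEnergy_left hl hg hi h1 hik hki h1k hq hql fun h => by
    have := hdist i (Finset.mem_Icc.2 ⟨h, hi⟩)
    rwa [abs_of_pos (sub_pos.2 (by exact_mod_cast hik))] at this
  have hER := hf.le_bridgeEnergy_right hl hg hi h2 hik.le hki' hk2 hq hql fun h => by
    have := hdist (i + 1) (Finset.mem_Icc.2 ⟨by omega, by omega⟩)
    rwa [abs_sub_comm, abs_of_pos (sub_pos.2 (by exact_mod_cast hki'))] at this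
  have hE := le_normaliser hx hf hc hl hg hρ h1 h1k hk2 h2
  have hnoise := normaliser_noise_le hx hl hΛ h1 h1k hk2 h2
  have hθL := sq_thetaHat_le hx hl hΛ h1 h1k (show k ≤ n by omega)
  have hθR := sq_thetaHat_le hx hl hΛ (show 1 ≤ k + 1 by omega)
    (show k + 1 + 4 * l ≤ t₂ + 1 by omega) h2
  have hN0 := intCast_length_pos (show t₁ ≤ t₂ by omega)
  have hNn : (t₂ : ℝ) - t₁ + 1 ≤ n := by
    have : (t₂ : ℝ) + 1 ≤ n + t₁ := by exact_mod_cast (by omega : t₂ + 1 ≤ n + t₁)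
    linarith
  have hD := contrastD_sq_le (fun t => x t + f t) (show t₁ ≤ k by omega) (show k < t₂ by omega)
  set a := v (i + 1) - thetaHat f t₁ k with ha
  set b := v (i + 1) - thetaHat f (k + 1) t₂ with hb
  set E := normaliserL (fun t => x t + f t) t₁ k t₂ + normaliserR (fun t => x t + f t) t₁ k t₂
    with hEdef
  set N : ℝ := (t₂ : ℝ) - t₁ + 1 with hN
  have hEpos : 0 < E := hc.trans_le hE
  -- `W` is the signal energy guaranteed by the two half-windows; `20` is the factor `10` there
  -- times the `2` lost in separating signal from noise.
  set W : ℝ := l * q ^ 2 * (a ^ 2 + b ^ 2) / (20 * (n : ℝ) ^ 2) with hW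
  have hW0 : 0 ≤ W := by positivity
  have hWE : W ≤ E + 2 * A ^ 2 * Λ := by
    have e1 := bridgeEnergy_add_ge x f t₁ k
    have e2 := bridgeEnergy_add_ge x f (k + 1) t₂
    have e3 : W ≤ (bridgeEnergy f t₁ k / 2 + bridgeEnergy f (k + 1) t₂ / 2) / N ^ 2 := by
      rw [hW, div_le_div_iff₀ (by positivity) (by positivity)]
      calc l * q ^ 2 * (a ^ 2 + b ^ 2) * N ^ 2 ≤ l * q ^ 2 * (a ^ 2 + b ^ 2) * (n : ℝ) ^ 2 := by
            gcongr
        _ ≤ (10 * bridgeEnergy f t₁ k + 10 * bridgeEnergy f (k + 1) t₂) * (n : ℝ) ^ 2 := by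
            gcongr
            linarith
        _ = _ := by ring
    have e4 : (bridgeEnergy f t₁ k / 2 + bridgeEnergy f (k + 1) t₂ / 2) / N ^ 2
        ≤ E + (bridgeEnergy x t₁ k + bridgeEnergy x (k + 1) t₂) / N ^ 2 := by
      rw [hEdef, normaliserL_eq, normaliserR_eq _ (show k < t₂ by omega),
        ← add_div (bridgeEnergy (fun t => x t + f t) t₁ k), ← add_div (_ + _)]
      exact div_le_div_of_nonneg_right (by linarith) (sq_nonneg N)
    linarith
  -- Since `E ≥ c`, the additive noise term becomes a multiple of `E`.
  have hWE' : W ≤ E * (1 + 2 * A ^ 2 * Λ / c) := by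
    have : 2 * A ^ 2 * Λ ≤ E * (2 * A ^ 2 * Λ / c) := by
      calc 2 * A ^ 2 * Λ = c * (2 * A ^ 2 * Λ / c) := by field_simp
        _ ≤ _ := by gcongr
    linarith
  have hDle : contrastD (fun t => x t + f t) t₁ k t₂ ^ 2
      ≤ 2 * A ^ 2 * Λ ^ 2 + 80 * Λ * (n / q) ^ 2 * W := by
    rw [thetaHat_add, thetaHat_add] at hD
    -- The common level `v (i + 1)` at `k` cancels, leaving only the deviations `a` and `b` that `W`
    -- controls.
    have e1 : (thetaHat x t₁ k + thetaHat f t₁ k - (thetaHat x (k + 1) t₂ + thetaHat f (k + 1) t₂))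
        = (thetaHat x t₁ k + (-a)) - (thetaHat x (k + 1) t₂ + (-b)) := by
      rw [ha, hb]; ring
    rw [e1] at hD
    have e2 := sq_add_add_le (thetaHat x t₁ k) (-a) (thetaHat x (k + 1) t₂) (-b)
    have e3 : 4 * n * (a ^ 2 + b ^ 2) ≤ 80 * Λ * (n / q) ^ 2 * W := by
      have : 80 * Λ * (n / q) ^ 2 * W = 4 * (Λ * l) * (a ^ 2 + b ^ 2) := by
        rw [hW]; field_simp; ring
      rw [this]
      gcongr
    calc _ ≤ N * (4 * (thetaHat x t₁ k ^ 2 + (-a) ^ 2 + thetaHat x (k + 1) t₂ ^ 2 + (-b) ^ 2)) :=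
          hD.trans (mul_le_mul_of_nonneg_left e2 hN0.le)
      _ ≤ n * (4 * (thetaHat x t₁ k ^ 2 + (-a) ^ 2 + thetaHat x (k + 1) t₂ ^ 2 + (-b) ^ 2)) := by
          gcongr
      _ = 4 * (n * thetaHat x t₁ k ^ 2) + 4 * (n * thetaHat x (k + 1) t₂ ^ 2)
          + 4 * n * (a ^ 2 + b ^ 2) := by ring
      _ ≤ _ := by linarith
  rw [statT, div_le_iff₀ hEpos]
  set r := ((n : ℝ) / q) ^ 2 with hr
  have hr0 : 0 ≤ r := by positivity
  have e1 : 2 * A ^ 2 * Λ ^ 2 ≤ 2 * A ^ 2 * Λ ^ 2 / c * E := by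
    calc 2 * A ^ 2 * Λ ^ 2 = 2 * A ^ 2 * Λ ^ 2 / c * c := by field_simp
      _ ≤ _ := by gcongr
  have e2 : 80 * Λ * r * W ≤ 80 * Λ * r * (E * (1 + 2 * A ^ 2 * Λ / c)) := by gcongr
  have e3 : 0 ≤ 2 * A ^ 2 * Λ ^ 2 / c * E * r := by positivity
  have e4 : 0 ≤ 80 * Λ * (1 + 2 * A ^ 2 * Λ / c) * E := by positivity
  calc _ ≤ 2 * A ^ 2 * Λ ^ 2 + 80 * Λ * r * W := hDle
    _ ≤ 2 * A ^ 2 * Λ ^ 2 / c * E + 80 * Λ * r * (E * (1 + 2 * A ^ 2 * Λ / c)) := add_le_add e1 e2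
    _ ≤ 2 * A ^ 2 * Λ ^ 2 / c * E + 80 * Λ * r * (E * (1 + 2 * A ^ 2 * Λ / c))
        + 2 * A ^ 2 * Λ ^ 2 / c * E * r + 80 * Λ * (1 + 2 * A ^ 2 * Λ / c) * E := by linarith
    _ = _ := by ring

/-- At a change-point the self-normalised statistic is large. -/
lemma le_statT (hx : RegularNoise x n A c ρ) (hf : IsSegmentation f v m κ n g) (hA : 0 < A)
    (hc : 0 < c) (hl : 1 ≤ l) (hg : 4 * (l : ℤ) ≤ g) (hρ : ρ * n ≤ l) (hΛ : (n : ℝ) ≤ Λ * l)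
    {h : ℤ} (hlh : 4 * l ≤ h) (hhg : h ≤ g) {i : ℕ} (hi1 : 1 ≤ i) (him : i ≤ m) :
    n * (v (i + 1) - v i) ^ 2 / (8 * A ^ 2 * Λ ^ 2) - 1 / 4
      ≤ statT (fun t => x t + f t) (κ i - h + 1) (κ i) (κ i + h) := by
  have hl' : (1 : ℝ) ≤ l := by exact_mod_cast hl
  have hsp1 := hf.spacing (i - 1) (by omega)
  have hsp2 := hf.spacing i him
  have hm1 := hf.mono (show 0 ≤ i - 1 by omega) (by omega)
  have hm2 := hf.mono (show i + 1 ≤ m + 1 by omega) le_rfl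
  rw [Nat.sub_add_cancel hi1] at hsp1
  rw [hf.zero] at hm1
  rw [hf.last] at hm2
  have hn0 : (0 : ℝ) < n := by exact_mod_cast (by omega : 0 < n)
  have hΛ0 : 0 < Λ := by
    by_contra hcon
    push Not at hcon
    nlinarith
  have hfL : ∀ t, κ i - h + 1 ≤ t → t ≤ κ i → f t = v i := fun t ht ht' => by
    have := hf.eq (i - 1) (by omega) t (by omega) (by rwa [Nat.sub_add_cancel hi1])
    rwa [Nat.sub_add_cancel hi1] at this
  have hfR : ∀ t, κ i + 1 ≤ t → t ≤ κ i + h → f t = v (i + 1) := fun t ht ht' =>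
    hf.eq i him t (by omega) (by omega)
  have hE := le_normaliser hx hf hc hl hg hρ (t₁ := κ i - h + 1) (k := κ i) (t₂ := κ i + h)
    (by omega) (by omega) (by omega) (by omega)
  have hnoise := normaliser_noise_le hx hl hΛ (t₁ := κ i - h + 1) (k := κ i) (t₂ := κ i + h)
    (by omega) (by omega) (by omega) (by omega)
  -- Each half of this window is free of jumps, so the normaliser is pure noise and bounded above.
  have hbr : ∀ s e : ℤ, ∀ w : ℝ, s ≤ e → (∀ t, s ≤ t → t ≤ e → f t = w) →
      bridgeEnergy (fun t => x t + f t) s e = bridgeEnergy x s e := by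
    intro s e w hse hw
    refine Finset.sum_congr rfl fun j hj => ?_
    rw [Finset.mem_Icc] at hj
    rw [bridge_add, bridge_eq_of_eq_right hse (by omega) hj.2 fun t h1 h2 => hw t (by omega) h2,
      thetaHat_of_eq hse hw]
    simp
  have hEeq : normaliserL (fun t => x t + f t) (κ i - h + 1) (κ i) (κ i + h)
      + normaliserR (fun t => x t + f t) (κ i - h + 1) (κ i) (κ i + h) ≤ 2 * A ^ 2 * Λ := by
    rw [normaliserL_eq, normaliserR_eq _ (by omega), hbr _ _ _ (by omega) hfL,
      hbr _ _ _ (by omega) hfR, ← add_div]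
    exact hnoise
  have hθL := sq_thetaHat_le hx hl hΛ (s := κ i - h + 1) (e := κ i) (by omega) (by omega) (by omega)
  have hθR := sq_thetaHat_le hx hl hΛ (s := κ i + 1) (e := κ i + h) (by omega) (by omega) (by omega)
  have hD := contrastD_sq (fun t => x t + f t) (show κ i - h + 1 ≤ κ i by omega)
    (show κ i < κ i + h by omega)
  rw [thetaHat_add, thetaHat_add, thetaHat_of_eq (by omega) hfL, thetaHat_of_eq (by omega) hfR]
    at hD
  have hh0 : (0 : ℝ) < h := by exact_mod_cast (by omega : 0 < h)
  have hlh' : 4 * (l : ℝ) ≤ h := by exact_mod_cast hlh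
  push_cast at hD
  have e1 : (κ i : ℝ) - (κ i - h + 1) + 1 = h := by ring
  have e2 : (κ i : ℝ) + h - κ i = h := by ring
  have e3 : (κ i : ℝ) + h - (κ i - h + 1) + 1 = 2 * h := by ring
  rw [e1, e2, e3] at hD
  have e4 : ((h : ℝ) * h) ^ 2 / (2 * h) ^ 3 = h / 8 := by field_simp; norm_num
  rw [e4] at hD
  set X1 := thetaHat x (κ i - h + 1) (κ i)
  set X2 := thetaHat x (κ i + 1) (κ i + h)
  set J := v (i + 1) - v i with hJ
  have e5 : J ^ 2 / 2 - 2 * (X1 ^ 2 + X2 ^ 2) ≤ (X1 + v i - (X2 + v (i + 1))) ^ 2 := by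
    have : X1 + v i - (X2 + v (i + 1)) = X1 - X2 - J := by rw [hJ]; ring
    rw [this]
    nlinarith [sq_nonneg (J - 2 * (X1 - X2)), sq_nonneg (X1 + X2)]
  have hEpos := hc.trans_le hE
  rw [statT, le_div_iff₀ hEpos, hD]
  -- The upper bound on the normaliser can be multiplied in only if the claimed lower bound is
  -- nonnegative.
  rcases le_or_gt (n * J ^ 2 / (8 * A ^ 2 * Λ ^ 2) - 1 / 4) 0 with hneg | hpos
  · exact (mul_nonpos_of_nonpos_of_nonneg hneg hEpos.le).trans (by positivity)
  have h8 : (n : ℝ) ≤ Λ * h / 4 := by nlinarith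
  have key : n * (J ^ 2 / 2 - 2 * (X1 ^ 2 + X2 ^ 2)) ≤ Λ * h / 4 * (X1 + v i - (X2 + v (i + 1))) ^ 2 :=
    calc n * (J ^ 2 / 2 - 2 * (X1 ^ 2 + X2 ^ 2)) ≤ n * (X1 + v i - (X2 + v (i + 1))) ^ 2 := by
          gcongr
      _ ≤ _ := by gcongr
  have key2 : n * J ^ 2 / 2 - A ^ 2 * Λ ^ 2 ≤ Λ * h / 4 * (X1 + v i - (X2 + v (i + 1))) ^ 2 := by
    linarith
  calc _ ≤ (n * J ^ 2 / (8 * A ^ 2 * Λ ^ 2) - 1 / 4) * (2 * A ^ 2 * Λ) := by gcongr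
    _ = (n * J ^ 2 / 2 - A ^ 2 * Λ ^ 2) / (2 * Λ) := by field_simp; ring
    _ ≤ Λ * h / 4 * (X1 + v i - (X2 + v (i + 1))) ^ 2 / (2 * Λ) := by gcongr
    _ = _ := by field_simp; ring

end

/-! ### The segmentation algorithm -/

lemma mem_nestedWindows_bounds {n h k : ℤ} (hh : 0 < h) {p : ℤ × ℤ}
    (hp : p ∈ nestedWindows n h k) :
    1 ≤ p.1 ∧ p.1 + h ≤ k + 1 ∧ k + h ≤ p.2 ∧ p.2 ≤ n := by
  simp only [nestedWindows, Finset.mem_image, Finset.mem_product, Finset.mem_Icc] at hp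
  obtain ⟨⟨a, b⟩, ⟨⟨ha1, ha2⟩, hb1, hb2⟩, rfl⟩ := hp
  have e1 := (Int.le_ediv_iff_mul_le hh).1 ha2
  have e2 := (Int.le_ediv_iff_mul_le hh).1 hb2
  have e3 : h ≤ a * h := by nlinarith
  have e4 : h ≤ b * h := by nlinarith
  refine ⟨?_, ?_, ?_, ?_⟩ <;> dsimp only at * <;> linarith

lemma mem_subWindows_self {n h s e k : ℤ} (hh : 0 < h) (hk : h ≤ k) (hkn : k + h ≤ n)
    (hs : s ≤ k - h + 1) (he : k + h ≤ e) : (k - h + 1, k + h) ∈ subWindows n h s e k := by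
  simp only [subWindows, nestedWindows, Finset.mem_filter, Finset.mem_image, Finset.mem_product,
    Finset.mem_Icc]
  refine ⟨⟨(1, 1), ⟨⟨le_rfl, ?_⟩, le_rfl, ?_⟩, by simp⟩, hs, by omega, he⟩
  · exact (Int.le_ediv_iff_mul_le hh).2 (by omega)
  · exact (Int.le_ediv_iff_mul_le hh).2 (by omega)

lemma le_maxStat {y : ℤ → ℝ} {n h s e k : ℤ} {p : ℤ × ℤ} (hp : p ∈ subWindows n h s e k) :
    statT y p.1 k p.2 ≤ maxStat y n h s e k := by
  rw [maxStat, dif_pos ⟨p, hp⟩]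
  exact Finset.le_sup' (fun w : ℤ × ℤ => statT y w.1 k w.2) hp

lemma exists_lt_statT {y : ℤ → ℝ} {n h s e k : ℤ} {U : ℝ} (hU : 0 ≤ U)
    (h' : U < maxStat y n h s e k) : ∃ p ∈ subWindows n h s e k, U < statT y p.1 k p.2 := by
  rw [maxStat] at h'
  split_ifs at h' with hne
  · exact (Finset.lt_sup'_iff hne).1 h'
  · exact absurd h' (not_lt.2 hU)

/-- As long as a change-point remains strictly between the ends, the spacing leaves room for the
shortest window on both sides of it, even when the ends err by `w`. -/
lemma IsSegmentation.le_maxStat_of_mem {y : ℤ → ℝ} {n h w g : ℤ} {Lo : ℝ} {f : ℤ → ℝ}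
    {v : ℕ → ℝ} {m : ℕ} {κ : ℕ → ℤ} (hf : IsSegmentation f v m κ n g) (hh : 0 < h)
    (hg : h + 4 * w ≤ g)
    (hat : ∀ i ∈ Finset.Icc 1 m, Lo ≤ statT y (κ i - h + 1) (κ i) (κ i + h))
    {s e : ℤ} {a b : ℕ} (hab : a + 1 < b) (hb : b ≤ m + 1) (hs : |s - 1 - κ a| < w)
    (he : |e - κ b| < w) :
    κ (a + 1) ∈ Finset.Icc s e ∧ 2 * h ≤ e - s + 1 ∧ Lo ≤ maxStat y n h s e (κ (a + 1)) := by
  rw [abs_lt] at hs he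
  have h1 := hf.spacing a (by omega)
  have h2 := hf.lt_of_lt hab hb
  have h3 := hf.mono (show 0 ≤ a by omega) (by omega)
  have h4 := hf.mono hb le_rfl
  rw [hf.zero] at h3
  rw [hf.last] at h4
  refine ⟨Finset.mem_Icc.2 ⟨by omega, by omega⟩, by omega, ?_⟩
  have h5 : (κ (a + 1) - h + 1, κ (a + 1) + h) ∈ subWindows n h s e (κ (a + 1)) :=
    mem_subWindows_self hh (by omega) (by omega) (by omega) (by omega)
  have h6 := hat (a + 1) (Finset.mem_Icc.2 ⟨by omega, by omega⟩)
  have h7 := le_maxStat (y := y) h5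
  dsimp only at h7
  exact h6.trans h7

/-- If the statistics away from the change-points are small and those at the change-points are
large, then the algorithm finds exactly the change-points of its subsample, up to errors less
than `w`. -/
lemma SNCPOutput.exists_near {y : ℤ → ℝ} {n h w l g : ℤ} {K U Lo : ℝ} {f : ℤ → ℝ} {v : ℕ → ℝ}
    {m : ℕ} {κ : ℕ → ℤ} (hf : IsSegmentation f v m κ n g) (hw : 1 ≤ w) (hl : 1 ≤ l)
    (hlh : l + 2 * w ≤ h) (hg : h + 4 * w ≤ g) (hK : 0 ≤ K) (hU : 0 ≤ U) (hKL : K < Lo)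
    (hUL : U < Lo)
    (hfar : ∀ t₁ k t₂ : ℤ, 1 ≤ t₁ → t₁ + h ≤ k + 1 → k + h ≤ t₂ → t₂ ≤ n →
      (∀ i ∈ Finset.Icc 1 m, w ≤ |k - κ i|) → statT y t₁ k t₂ ≤ U)
    (hvfar : ∀ t₁ k t₂ : ℤ, 1 ≤ t₁ → t₁ + h ≤ k + 1 → k + h ≤ t₂ → t₂ ≤ n →
      (∀ i ∈ Finset.Icc 1 m, l ≤ |k - κ i|) → statT y t₁ k t₂ ≤ K)
    (hat : ∀ i ∈ Finset.Icc 1 m, Lo ≤ statT y (κ i - h + 1) (κ i) (κ i + h))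
    {s e : ℤ} {S : Finset ℤ} (hS : SNCPOutput y n h K s e S) :
    ∀ a b : ℕ, a < b → b ≤ m + 1 → |s - 1 - κ a| < w → |e - κ b| < w → 1 ≤ s → e ≤ n →
      ∃ G : ℕ → ℤ, (∀ i ∈ Finset.Ioo a b, |G i - κ i| < w) ∧ S = (Finset.Ioo a b).image G := by
  have hempty : ∀ a b : ℕ, b ≤ a + 1 → ∃ G : ℕ → ℤ,
      (∀ i ∈ Finset.Ioo a b, |G i - κ i| < w) ∧ (∅ : Finset ℤ) = (Finset.Ioo a b).image G := by
    intro a b hab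
    have : Finset.Ioo a b = ∅ := by
      ext i; simp only [Finset.mem_Ioo, Finset.notMem_empty, iff_false]; omega
    refine ⟨fun _ => 0, ?_, ?_⟩ <;> simp [this]
  have hbig := fun (s e : ℤ) (a b : ℕ) (hab : a + 1 < b) (hb : b ≤ m + 1)
    (hs : |s - 1 - κ a| < w) (he : |e - κ b| < w) =>
    hf.le_maxStat_of_mem (y := y) (by omega) hg hat hab hb hs he
  induction hS with
  | short s e hlen =>
    intro a b hab hb hs he _ _
    refine hempty a b ?_
    by_contra hcon
    have := (hbig s e a b (by omega) hb hs he).2.1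
    omega
  | halt s e hlen hmax =>
    intro a b hab hb hs he _ _
    refine hempty a b ?_
    by_contra hcon
    obtain ⟨h1, -, h3⟩ := hbig s e a b (by omega) hb hs he
    exact absurd (h3.trans (hmax _ h1)) (not_le.2 hKL)
  | split s e k A B hlen hk hmax hKlt hA hB ihA ihB =>
    intro a b hab hb hs he hs1 hen
    have hwin : ∀ p ∈ subWindows n h s e k, 1 ≤ p.1 ∧ p.1 + h ≤ k + 1 ∧ k + h ≤ p.2 ∧ p.2 ≤ n ∧
        s ≤ p.1 ∧ p.2 ≤ e := by
      intro p hp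
      rw [subWindows, Finset.mem_filter] at hp
      obtain ⟨e1, e2, e3, e4⟩ := mem_nestedWindows_bounds (show 0 < h by omega) hp.1
      exact ⟨e1, e2, e3, e4, hp.2.1, hp.2.2.2⟩
    have hs' := abs_lt.1 hs
    have he' := abs_lt.1 he
    -- A window around `k` inside `[s, e]` keeps `k` about `h` away from both ends, hence at least
    -- `l` away from the change-points already found.
    have houter : ∀ p ∈ subWindows n h s e k, ∀ i ≤ m + 1, i ≤ a ∨ b ≤ i → l ≤ |k - κ i| := by
      intro p hp i hi hiab
      obtain ⟨-, e2, e3, -, e5, e6⟩ := hwin p hp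
      rcases hiab with hia | hbi
      · have := hf.mono hia (by omega)
        exact le_abs.2 (Or.inl (by omega))
      · have := hf.mono hbi hi
        exact le_abs.2 (Or.inr (by omega))
    -- With no change-point left inside, `k` would be far from all of them and could not exceed `K`.
    have hab2 : a + 1 < b := by
      by_contra hcon
      obtain ⟨p, hp, hpK⟩ := exists_lt_statT hK hKlt
      obtain ⟨e1, e2, e3, e4, -, -⟩ := hwin p hp
      refine absurd (hvfar p.1 k p.2 e1 e2 e3 e4 fun i hi => ?_) (not_le.2 hpK)
      rw [Finset.mem_Icc] at hi
      exact houter p hp i (by omega) (by omega)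
    obtain ⟨h1, -, h3⟩ := hbig s e a b hab2 hb hs he
    -- The maximum is at least the value at an undetected change-point, so the maximiser lies within
    -- `w` of some change-point.
    obtain ⟨p, hp, hpU⟩ := exists_lt_statT hU (hUL.trans_le (h3.trans (hmax _ h1)))
    obtain ⟨e1, e2, e3, e4, e5, e6⟩ := hwin p hp
    obtain ⟨i, hi, hik⟩ : ∃ i ∈ Finset.Icc 1 m, |k - κ i| < w := by
      by_contra hcon
      push Not at hcon
      exact absurd (hfar p.1 k p.2 e1 e2 e3 e4 hcon) (not_le.2 hpU)
    rw [Finset.mem_Icc] at hi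
    have hai : a < i := by
      by_contra hcon
      have := hf.mono (show i ≤ a by omega) (by omega)
      rw [abs_lt] at hik
      omega
    have hib : i < b := by
      by_contra hcon
      have := hf.mono (show b ≤ i by omega) (by omega)
      rw [abs_lt] at hik
      omega
    rw [Finset.mem_Icc] at hk
    -- The split point, within `w` of `κ i`, is an admissible end for both halves, so the invariant
    -- passes to the index ranges `(a, i)` and `(i, b)`.
    obtain ⟨G₁, hG₁, rfl⟩ := ihA a i hai (by omega) hs hik hs1 (by omega)
    obtain ⟨G₂, hG₂, rfl⟩ := ihB i b hib hb (by rwa [add_sub_cancel_right]) he (by omega) hen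
    refine ⟨fun j => if j < i then G₁ j else if j = i then k else G₂ j, fun j hj => ?_, ?_⟩
    · rw [Finset.mem_Ioo] at hj
      rcases lt_trichotomy j i with hlt | rfl | hgt
      · simpa [hlt] using hG₁ j (Finset.mem_Ioo.2 ⟨hj.1, hlt⟩)
      · simpa using hik
      · simpa [hgt.not_gt, hgt.ne'] using hG₂ j (Finset.mem_Ioo.2 ⟨hgt, hj.2⟩)
    · ext z
      simp only [Finset.mem_insert, Finset.mem_union, Finset.mem_image, Finset.mem_Ioo]
      constructor
      · rintro (rfl | ⟨j, hj, rfl⟩ | ⟨j, hj, rfl⟩)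
        · exact ⟨i, ⟨hai, hib⟩, by simp⟩
        · exact ⟨j, ⟨hj.1, by omega⟩, by simp [hj.2]⟩
        · exact ⟨j, ⟨by omega, hj.2⟩, by simp [hj.1.not_gt, hj.1.ne']⟩
      · rintro ⟨j, hj, rfl⟩
        rcases lt_trichotomy j i with hlt | rfl | hgt
        · exact Or.inr (Or.inl ⟨j, ⟨hj.1, hlt⟩, by simp [hlt]⟩)
        · exact Or.inl (by simp)
        · exact Or.inr (Or.inr ⟨j, ⟨hgt, hj.2⟩, by simp [hgt.not_gt, hgt.ne']⟩)

/-! ### The ordered estimates -/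

lemma image_Ioo_eq_toFinset (G : ℕ → ℤ) (m : ℕ) :
    (Finset.Ioo 0 (m + 1)).image G = ((List.range m).map fun i => G (i + 1)).toFinset := by
  ext z
  simp only [Finset.mem_image, Finset.mem_Ioo, List.mem_toFinset, List.mem_map, List.mem_range]
  constructor
  · rintro ⟨j, hj, rfl⟩
    exact ⟨j - 1, by omega, by rw [Nat.sub_add_cancel (by omega)]⟩
  · rintro ⟨j, hj, rfl⟩
    exact ⟨j + 1, ⟨by omega, by omega⟩, rfl⟩

lemma sort_image_Ioo {G : ℕ → ℤ} {m : ℕ} (hG : ∀ i j, 1 ≤ i → i < j → j ≤ m → G i < G j) :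
    ((Finset.Ioo 0 (m + 1)).image G).sort (· ≤ ·) = (List.range m).map fun i => G (i + 1) := by
  have hp : ((List.range m).map fun i => G (i + 1)).Pairwise (· < ·) := by
    rw [List.pairwise_map]
    refine List.pairwise_lt_range.imp_of_mem ?_
    intro a b _ hb hab
    rw [List.mem_range] at hb
    exact hG _ _ (by omega) (by omega) (by omega)
  rw [image_Ioo_eq_toFinset]
  exact (List.toFinset_sort _ (hp.imp fun h => h.ne)).2 (hp.imp fun h => h.le)

lemma card_image_Ioo {G : ℕ → ℤ} {m : ℕ} (hG : ∀ i j, 1 ≤ i → i < j → j ≤ m → G i < G j) :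
    ((Finset.Ioo 0 (m + 1)).image G).card = m := by
  rw [← Finset.length_sort (· ≤ ·), sort_image_Ioo hG]
  simp

lemma khatExt_image_Ioo {G : ℕ → ℤ} {m : ℕ} (hG : ∀ i j, 1 ≤ i → i < j → j ≤ m → G i < G j)
    (n w : ℤ) {i : ℕ} (hi : 1 ≤ i) (him : i ≤ m) :
    khatExt n w ((Finset.Ioo 0 (m + 1)).image G) i = G i := by
  rw [khatExt, if_neg (by omega), card_image_Ioo hG, if_neg (by omega), sort_image_Ioo hG,
    List.getD_eq_getElem _ _ (by simp; omega)]
  simp only [List.getElem_map, List.getElem_range]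
  rw [Nat.sub_add_cancel hi]

/-- The local intervals around the change-points. -/
lemma local_interval_bounds {f : ℤ → ℝ} {v : ℕ → ℝ} {m : ℕ} {κ : ℕ → ℤ} {n g w : ℤ}
    (hf : IsSegmentation f v m κ n g) (hw : 1 ≤ w) (hwg : 2 * w ≤ g) {G : ℕ → ℤ}
    (hG : ∀ i ∈ Finset.Ioo 0 (m + 1), |G i - κ i| < w) {i : ℕ} (hi : 1 ≤ i) (him : i ≤ m) :
    ((Finset.Ioo 0 (m + 1)).image G).card = m ∧
    κ (i - 1) + 1 ≤ localLeft n w ((Finset.Ioo 0 (m + 1)).image G) i ∧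
    localLeft n w ((Finset.Ioo 0 (m + 1)).image G) i ≤ κ (i - 1) + 2 * w ∧
    κ (i + 1) - 2 * w ≤ localRight n w ((Finset.Ioo 0 (m + 1)).image G) i ∧
    localRight n w ((Finset.Ioo 0 (m + 1)).image G) i ≤ κ (i + 1) := by
  have hmono : ∀ i j, 1 ≤ i → i < j → j ≤ m → G i < G j := by
    intro i j hi hij hj
    have h1 := hf.lt_of_lt hij (by omega)
    have h2 := abs_lt.1 (hG i (Finset.mem_Ioo.2 ⟨by omega, by omega⟩))
    have h3 := abs_lt.1 (hG j (Finset.mem_Ioo.2 ⟨by omega, by omega⟩))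
    omega
  have hcard := card_image_Ioo hmono
  refine ⟨hcard, ?_⟩
  -- The estimate errs by less than `w`, so moving inwards by `w` passes the neighbouring
  -- change-point; the conventions for `k̂_0` and `k̂_{m+1}` make the outer ends `1` and `n`.
  have hL : κ (i - 1) + 1 ≤ localLeft n w ((Finset.Ioo 0 (m + 1)).image G) i ∧
      localLeft n w ((Finset.Ioo 0 (m + 1)).image G) i ≤ κ (i - 1) + 2 * w := by
    rw [localLeft]
    rcases hi.lt_or_eq with hlt | rfl
    · rw [khatExt_image_Ioo hmono n w (show 1 ≤ i - 1 by omega) (by omega)]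
      have := abs_lt.1 (hG (i - 1) (Finset.mem_Ioo.2 ⟨by omega, by omega⟩))
      omega
    · rw [Nat.sub_self, hf.zero, khatExt, if_pos rfl]
      omega
  have hR : κ (i + 1) - 2 * w ≤ localRight n w ((Finset.Ioo 0 (m + 1)).image G) i ∧
      localRight n w ((Finset.Ioo 0 (m + 1)).image G) i ≤ κ (i + 1) := by
    rw [localRight]
    rcases him.lt_or_eq with hlt | rfl
    · rw [khatExt_image_Ioo hmono n w (show 1 ≤ i + 1 by omega) (by omega)]
      have := abs_lt.1 (hG (i + 1) (Finset.mem_Ioo.2 ⟨by omega, by omega⟩))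
      omega
    · rw [khatExt, if_neg (by omega), hcard, if_pos rfl, hf.last]
      omega
  exact ⟨hL.1, hL.2, hR.1, hR.2⟩

/-! ### The local refinement -/

lemma abs_div_le_of_le {U p B t : ℝ} (hp : 0 < p) (hU : |U| ≤ B) (hB : B ≤ t * p) :
    |U / p| ≤ t := by
  rw [abs_div, abs_of_pos hp, div_le_iff₀ hp]
  exact hU.trans hB

/-- Comparison of two squared CUSUM values close to the change-point. -/
lemma jump_mul_le_of_cusum_le {p q d n ρ Δ U V : ℝ} (hρ : 0 < ρ) (hρ1 : ρ ≤ 1) (hn : 0 < n)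
    (hp : ρ * n ≤ p) (hq : ρ * n ≤ q) (hpq : p + q ≤ n) (hd : 0 < d) (hdp : d ≤ p / 2)
    (hΔ : Δ ≠ 0) (hU : |U| ≤ ρ ^ 2 / 16 * |Δ| * n) (hV : |V| ≤ ρ ^ 2 / 16 * |Δ| * n)
    (h : (Δ * p * q / (p + q) - U) ^ 2 / (p * q)
      ≤ (Δ * (p - d) * q / (p + q) - V) ^ 2 / ((p - d) * (q + d))) :
    |Δ| * d ≤ 3 * |U - V| := by
  have hρn : 0 < ρ * n := by positivity
  have hp0 : 0 < p := by linarith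
  have hq0 : 0 < q := by linarith
  have ha : p / 2 ≤ p - d := by linarith
  have ha0 : 0 < p - d := by linarith
  have hb0 : 0 < q + d := by linarith
  set x := |Δ| with hx
  have hx0 : 0 < x := abs_pos.2 hΔ
  -- An exact expansion of the difference of the two values times `(p + q) (q + d) / q`. The pure
  -- signal part is `-Δ ^ 2 * d`; the remaining terms involve `U - V` or carry a small factor.
  have key : Δ ^ 2 * d ≤ 2 * Δ * (d * (U / q) + (U - V)) + (p + q) / q *
      (-((U + V) / (p - d)) * (U - V) + U / (p - d) * (U / p) * ((q - p + d) / q) * d) := by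
    have e : 2 * Δ * (d * (U / q) + (U - V)) + (p + q) / q *
        (-((U + V) / (p - d)) * (U - V) + U / (p - d) * (U / p) * ((q - p + d) / q) * d)
        - Δ ^ 2 * d = (p + q) * (q + d) / q *
        ((Δ * (p - d) * q / (p + q) - V) ^ 2 / ((p - d) * (q + d))
          - (Δ * p * q / (p + q) - U) ^ 2 / (p * q)) := by
      have : p + q ≠ 0 := by linarith
      field_simp
      ring
    have : 0 ≤ (p + q) * (q + d) / q *
        ((Δ * (p - d) * q / (p + q) - V) ^ 2 / ((p - d) * (q + d))
          - (Δ * p * q / (p + q) - U) ^ 2 / (p * q)) :=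
      mul_nonneg (by positivity) (sub_nonneg.2 h)
    linarith
  have hscale : ∀ r, ρ * n ≤ r → ρ ^ 2 / 16 * x * n ≤ ρ / 16 * x * r := fun r hr => by
    have := mul_le_mul_of_nonneg_left hr (by positivity : 0 ≤ ρ / 16 * x)
    linarith
  have hUq : |U / q| ≤ ρ / 16 * x := abs_div_le_of_le hq0 hU (hscale q hq)
  have hUp : |U / p| ≤ ρ / 16 * x := abs_div_le_of_le hp0 hU (hscale p hp)
  have hscale' := hscale (2 * (p - d)) (by linarith)
  have hUa : |U / (p - d)| ≤ ρ / 8 * x := abs_div_le_of_le ha0 hU (by linarith)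
  have hUV : |(U + V) / (p - d)| ≤ ρ / 4 * x :=
    abs_div_le_of_le ha0 ((abs_add_le _ _).trans (add_le_add hU hV)) (by linarith)
  have hNq : (p + q) / q ≤ 1 / ρ := by
    rw [div_le_div_iff₀ hq0 hρ]
    have := mul_le_mul_of_nonneg_right hpq hρ.le
    linarith
  have hNq0 : 0 < (p + q) / q := by positivity
  set W := |U - V| with hW
  have hW0 : 0 ≤ W := abs_nonneg _
  have t1 : 2 * Δ * (d * (U / q)) ≤ x ^ 2 * d / 8 := by
    have e1 : Δ * (U / q) ≤ x * (ρ / 16 * x) := (le_abs_self _).trans (by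
      rw [abs_mul]; exact mul_le_mul_of_nonneg_left hUq hx0.le)
    have e2 : x * (ρ / 16 * x) ≤ x ^ 2 / 16 := by nlinarith [sq_nonneg x]
    have e3 := mul_le_mul_of_nonneg_right (e1.trans e2) hd.le
    linarith
  have t2 : 2 * Δ * (U - V) ≤ 2 * x * W := by
    have : Δ * (U - V) ≤ x * W := (le_abs_self _).trans (abs_mul _ _).le
    linarith
  have t3 : -((U + V) / (p - d)) * (U - V) ≤ ρ / 4 * x * W := by
    refine (le_abs_self _).trans ?_
    rw [abs_mul, abs_neg]
    exact mul_le_mul_of_nonneg_right hUV hW0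
  have t4 : U / (p - d) * (U / p) * ((q - p + d) / q) * d ≤ ρ ^ 2 / 128 * x ^ 2 * d := by
    have e1 : (q - p + d) / q ≤ 1 := by rw [div_le_one hq0]; linarith
    have e2 : 0 ≤ U / (p - d) * (U / p) := by
      rw [div_mul_div_comm]
      exact div_nonneg (mul_self_nonneg U) (mul_pos ha0 hp0).le
    have e3 : U / (p - d) * (U / p) ≤ (ρ / 8 * x) * (ρ / 16 * x) := by
      refine (le_abs_self _).trans ?_
      rw [abs_mul]
      exact mul_le_mul hUa hUp (abs_nonneg _) (by positivity)
    refine mul_le_mul_of_nonneg_right ?_ hd.le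
    calc U / (p - d) * (U / p) * ((q - p + d) / q) ≤ U / (p - d) * (U / p) * 1 :=
          mul_le_mul_of_nonneg_left e1 e2
      _ ≤ _ := by rw [mul_one]; refine e3.trans (le_of_eq (by ring))
  have t5 : (p + q) / q *
      (-((U + V) / (p - d)) * (U - V) + U / (p - d) * (U / p) * ((q - p + d) / q) * d)
      ≤ x * W / 4 + x ^ 2 * d / 128 := by
    calc _ ≤ (p + q) / q * (ρ / 4 * x * W + ρ ^ 2 / 128 * x ^ 2 * d) :=
          mul_le_mul_of_nonneg_left (add_le_add t3 t4) hNq0.le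
      _ ≤ 1 / ρ * (ρ / 4 * x * W + ρ ^ 2 / 128 * x ^ 2 * d) :=
          mul_le_mul_of_nonneg_right hNq (by positivity)
      _ = x * W / 4 + ρ * (x ^ 2 * d) / 128 := by field_simp
      _ ≤ _ := by
        have : ρ * (x ^ 2 * d) ≤ 1 * (x ^ 2 * d) := mul_le_mul_of_nonneg_right hρ1 (by positivity)
        linarith
  have hsq : Δ ^ 2 = x ^ 2 := (sq_abs Δ).symm
  rw [hsq] at key
  -- The error terms sum to at most `(1 / 8 + 1 / 128) x ^ 2 d + (9 / 4) x W`; absorbing the first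
  -- part leaves a constant below `3`.
  have hfin : x * (x * d) ≤ x * (3 * W) := by
    have e1 : 2 * Δ * (d * (U / q) + (U - V)) = 2 * Δ * (d * (U / q)) + 2 * Δ * (U - V) := by ring
    have e2 : x * (x * d) = x ^ 2 * d := by ring
    have e3 : 0 ≤ x * W := by positivity
    have e4 : 0 ≤ x ^ 2 * d := by positivity
    rw [e1] at key
    linarith
  exact le_of_mul_le_mul_left hfin hx0

/-- Comparison of two squared CUSUM values far from the change-point. -/
lemma jump_sq_mul_le_of_cusum_le {p q d n ρ w Δ U V u : ℝ} (hρ : 0 < ρ) (hn : 0 < n)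
    (hp : ρ * n ≤ p) (hq : ρ * n ≤ q) (hpq : p + q ≤ n) (hdp : p / 2 ≤ d) (hw : 0 < w)
    (hwp : w ≤ p - d) (hU : |U| ≤ u) (hV : |V| ≤ u)
    (h : (Δ * p * q / (p + q) - U) ^ 2 / (p * q)
      ≤ (Δ * (p - d) * q / (p + q) - V) ^ 2 / ((p - d) * (q + d))) :
    Δ ^ 2 * ρ ^ 3 * w * n ≤ 52 * u ^ 2 := by
  have hρn : 0 < ρ * n := by positivity
  have hp0 : 0 < p := by linarith
  have hq0 : 0 < q := by linarith
  have ha0 : 0 < p - d := by linarith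
  have hd0 : 0 < d := by linarith
  have hb0 : 0 < q + d := by linarith
  have hN0 : 0 < p + q := by linarith
  have hU2 : U ^ 2 ≤ u ^ 2 := by rw [← sq_abs U]; exact pow_le_pow_left₀ (abs_nonneg _) hU 2
  have hV2 : V ^ 2 ≤ u ^ 2 := by rw [← sq_abs V]; exact pow_le_pow_left₀ (abs_nonneg _) hV 2
  set X := Δ * p * q / (p + q) with hX
  set Y := Δ * (p - d) * q / (p + q) with hY
  set E := Δ ^ 2 * (p * q) / (p + q) ^ 2 with hE
  have hE0 : 0 ≤ E := by positivity
  set r := u ^ 2 / (w * (ρ * n)) with hr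
  have hXE : X ^ 2 / (p * q) = E := by rw [hX, hE]; field_simp
  have hYE : Y ^ 2 / ((p - d) * (q + d)) ≤ E / 2 := by
    have e1 : Y ^ 2 / ((p - d) * (q + d)) = E * ((p - d) * q / (p * (q + d))) := by
      rw [hY, hE]; field_simp
    have e2 : (p - d) * q / (p * (q + d)) ≤ 1 / 2 := by
      rw [div_le_div_iff₀ (by positivity) two_pos]
      nlinarith
    rw [e1]
    calc E * ((p - d) * q / (p * (q + d))) ≤ E * (1 / 2) := mul_le_mul_of_nonneg_left e2 hE0
      _ = E / 2 := by ring
  have hrU : U ^ 2 / (p * q) ≤ r := by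
    refine div_le_div₀ (sq_nonneg u) hU2 (by positivity) ?_
    exact mul_le_mul (by linarith) hq hρn.le hp0.le
  -- Trimming the search range by `w` is what bounds this denominator from below.
  have hrV : V ^ 2 / ((p - d) * (q + d)) ≤ r := by
    refine div_le_div₀ (sq_nonneg u) hV2 (by positivity) ?_
    exact mul_le_mul hwp (by linarith) hρn.le ha0.le
  have h1 : 7 / 8 * E - 7 * r ≤ (X - U) ^ 2 / (p * q) := by
    have e : 7 / 8 * X ^ 2 - 7 * U ^ 2 ≤ (X - U) ^ 2 := by nlinarith [sq_nonneg (X - 8 * U)]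
    calc 7 / 8 * E - 7 * r ≤ 7 / 8 * (X ^ 2 / (p * q)) - 7 * (U ^ 2 / (p * q)) := by
          rw [hXE]; linarith
      _ = (7 / 8 * X ^ 2 - 7 * U ^ 2) / (p * q) := by ring
      _ ≤ _ := by gcongr
  have h2 : (Y - V) ^ 2 / ((p - d) * (q + d)) ≤ 9 / 16 * E + 9 * r := by
    have e : (Y - V) ^ 2 ≤ 9 / 8 * Y ^ 2 + 9 * V ^ 2 := by nlinarith [sq_nonneg (Y + 8 * V)]
    calc (Y - V) ^ 2 / ((p - d) * (q + d))
        ≤ (9 / 8 * Y ^ 2 + 9 * V ^ 2) / ((p - d) * (q + d)) := by gcongr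
      _ = 9 / 8 * (Y ^ 2 / ((p - d) * (q + d))) + 9 * (V ^ 2 / ((p - d) * (q + d))) := by ring
      _ ≤ _ := by linarith
  -- The signal part at the distant point is at most `E / 2`, so `7/8 E - 7 r ≤ 9/16 E + 9 r`, that
  -- is, `E ≤ 51.2 r`.
  have h3 : E ≤ 52 * r := by
    have : 0 ≤ r := by positivity
    linarith
  have h4 : Δ ^ 2 * ρ ^ 2 ≤ E := by
    rw [hE, le_div_iff₀ (by positivity)]
    have e1 : (p + q) ^ 2 ≤ n ^ 2 := pow_le_pow_left₀ hN0.le hpq 2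
    have e2 : ρ * n * (ρ * n) ≤ p * q := mul_le_mul hp hq hρn.le hp0.le
    calc Δ ^ 2 * ρ ^ 2 * (p + q) ^ 2 ≤ Δ ^ 2 * ρ ^ 2 * n ^ 2 := by gcongr
      _ = Δ ^ 2 * (ρ * n * (ρ * n)) := by ring
      _ ≤ _ := by gcongr
  have h5 := h4.trans h3
  rw [hr, mul_div_assoc', le_div_iff₀ (by positivity)] at h5
  linarith

lemma bridge_jump_left {f : ℤ → ℝ} {s k e j : ℤ} {v₁ v₂ : ℝ} (hsk : s ≤ k) (hke : k < e)
    (hf₁ : ∀ t, s ≤ t → t ≤ k → f t = v₁) (hf₂ : ∀ t, k < t → t ≤ e → f t = v₂)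
    (hj : s ≤ j + 1) (hjk : j ≤ k) :
    bridge f s e j = -((v₂ - v₁) * ((j : ℝ) - s + 1) * ((e : ℝ) - k) /
      (((k : ℝ) - s + 1) + ((e : ℝ) - k))) := by
  have h1 := length_mul_thetaHat f (show s ≤ e by omega)
  rw [← sum_Icc_add_sum_Icc f (show s ≤ k + 1 by omega) hke.le, sum_Icc_of_eq (by omega) hf₁,
    sum_Icc_of_eq (v := v₂) (by omega) fun t h1 h2 => hf₂ t (by omega) h2] at h1
  push_cast at h1
  have h0 := intCast_length_pos (show s ≤ e by omega)
  have h2 : ((k : ℝ) - s + 1) + ((e : ℝ) - k) = (e : ℝ) - s + 1 := by ring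
  rw [bridge, sum_Icc_of_eq (v := v₁) hj fun t h1 h2 => hf₁ t h1 (by omega), h2, ← neg_div,
    eq_div_iff h0.ne']
  linear_combination (-((j : ℝ) - s + 1)) * h1

lemma bridge_jump_right {f : ℤ → ℝ} {s k e j : ℤ} {v₁ v₂ : ℝ} (hsk : s ≤ k) (hke : k < e)
    (hf₁ : ∀ t, s ≤ t → t ≤ k → f t = v₁) (hf₂ : ∀ t, k < t → t ≤ e → f t = v₂)
    (hj : k ≤ j) (hje : j ≤ e) :
    bridge f s e j = -((v₂ - v₁) * ((e : ℝ) - j) * ((k : ℝ) - s + 1) /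
      (((e : ℝ) - k) + ((k : ℝ) - s + 1))) := by
  have h1 := length_mul_thetaHat f (show s ≤ e by omega)
  rw [← sum_Icc_add_sum_Icc f (show s ≤ k + 1 by omega) hke.le, sum_Icc_of_eq (by omega) hf₁,
    sum_Icc_of_eq (v := v₂) (by omega) fun t h1 h2 => hf₂ t (by omega) h2] at h1
  push_cast at h1
  have h0 := intCast_length_pos (show s ≤ e by omega)
  have h2 : ((e : ℝ) - k) + ((k : ℝ) - s + 1) = (e : ℝ) - s + 1 := by ring
  rw [bridge_eq_of_eq_right (by omega) (by omega) hje fun t h1 h2 => hf₂ t (by omega) h2, h2,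
    neg_inj, eq_div_iff h0.ne']
  linear_combination (-((e : ℝ) - j)) * h1

/-- If a point at distance `d` from the only change-point of a subsample maximises the squared
CUSUM statistic, then the noise next to the change-point is at least of order `d`. -/
lemma jump_mul_le_of_isCusumArgmax {x f : ℤ → ℝ} {n s k e j : ℤ} {w : ℕ} {A c ρ₀ ρ v₁ v₂ : ℝ}
    (hx : RegularNoise x n A c ρ₀) (hA : 0 < A) (hρ : 0 < ρ) (hρ1 : ρ ≤ 1) (hs : 1 ≤ s)
    (he : e ≤ n) (hw : 1 ≤ w) (hp : ρ * n ≤ (k : ℝ) - s + 1) (hq : ρ * n ≤ (e : ℝ) - k)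
    (hwk : s + w ≤ k) (hkw : k ≤ e - w)
    (hf₁ : ∀ t, s ≤ t → t ≤ k → f t = v₁) (hf₂ : ∀ t, k < t → t ≤ e → f t = v₂)
    (hbig : 64 * (A * √n) ≤ ρ ^ 2 * |v₂ - v₁| * n)
    (hfar : 52 * (16 * A ^ 2) < (v₂ - v₁) ^ 2 * ρ ^ 3 * w)
    (hj : IsCusumArgmax (fun t => x t + f t) s e w j) :
    (j < k → |v₂ - v₁| * ((k : ℝ) - j) ≤ 6 * |∑ t ∈ Finset.Icc (j + 1) k, x t|) ∧
    (k < j → |v₂ - v₁| * ((j : ℝ) - k) ≤ 6 * |∑ t ∈ Finset.Icc (k + 1) j, x t|) := by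
  obtain ⟨hjm, hjmax⟩ := hj
  rw [Finset.mem_Icc] at hjm
  have hcmp := hjmax k (Finset.mem_Icc.2 ⟨hwk, hkw⟩)
  rw [cusum_sq _ (show s ≤ k by omega) (show k < e by omega),
    cusum_sq _ (show s ≤ j by omega) (show j < e by omega), bridge_add, bridge_add] at hcmp
  have hn0 : (0 : ℝ) < n := by exact_mod_cast (by omega : 0 < n)
  have hsq : √(n : ℝ) ^ 2 = n := Real.sq_sqrt hn0.le
  have hU := hx.abs_bridge_le (j := k) hs (by omega) (show k ≤ e by omega) (by omega) he
  have hV := hx.abs_bridge_le (j := j) hs (by omega) (show j ≤ e by omega) (by omega) he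
  have hθ := hx.abs_thetaHat_le hs (show s ≤ e by omega) he
  set p : ℝ := (k : ℝ) - s + 1 with hpdef
  set q : ℝ := (e : ℝ) - k with hqdef
  set U := bridge x s e k with hUdef
  set V := bridge x s e j with hVdef
  set Δ := v₂ - v₁ with hΔ
  have hw' : (1 : ℝ) ≤ w := by exact_mod_cast hw
  have hpq : p + q ≤ n := by
    have : (e : ℝ) + 1 ≤ n + s := by exact_mod_cast (by omega : e + 1 ≤ n + s)
    rw [hpdef, hqdef]; linarith
  have hA0 : 0 < A * √(n : ℝ) := mul_pos hA (Real.sqrt_pos.2 hn0)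
  have hΔ0 : Δ ≠ 0 := by
    intro h0
    rw [h0, abs_zero, mul_zero, zero_mul] at hbig
    linarith
  have hbig' : 4 * (A * √(n : ℝ)) ≤ ρ ^ 2 / 16 * |Δ| * n := by linarith
  have hθ' : |thetaHat x s e| ≤ |Δ| / 6 := by
    have e1 : (e : ℝ) - s + 1 = p + q := by rw [hpdef, hqdef]; ring
    have hρn : 0 < ρ * n := by positivity
    rw [e1] at hθ
    refine hθ.trans ?_
    rw [div_le_iff₀ (by linarith)]
    have e2 : ρ ^ 2 * |Δ| * n ≤ |Δ| * (ρ * n) := by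
      have : 0 ≤ |Δ| * n * ρ := by positivity
      nlinarith
    have e3 : |Δ| * (2 * (ρ * n)) ≤ |Δ| * (p + q) :=
      mul_le_mul_of_nonneg_left (by linarith) (abs_nonneg _)
    linarith
  have hcontr : ¬ (Δ ^ 2 * ρ ^ 3 * w * n ≤ 52 * (4 * (A * √(n : ℝ))) ^ 2) := by
    intro h
    have e1 : 52 * (4 * (A * √(n : ℝ))) ^ 2 = 52 * (16 * A ^ 2) * n := by
      rw [mul_pow, mul_pow, hsq]; ring
    rw [e1] at h
    exact absurd (le_of_mul_le_mul_right h hn0) (not_le.2 hfar)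
  -- The noise mean is at most `|Δ| / 6`, so replacing the bridge increment by the plain sum costs
  -- half of the left side; this doubles `3` to `6`.
  have hfinish : ∀ {d S : ℝ}, 0 < d → |Δ| * d ≤ 3 * |S - d * thetaHat x s e| →
      |Δ| * d ≤ 6 * |S| := by
    intro d S hd h
    have e1 := abs_sub S (d * thetaHat x s e)
    rw [abs_mul, abs_of_pos hd] at e1
    have e2 : d * |thetaHat x s e| ≤ d * (|Δ| / 6) := mul_le_mul_of_nonneg_left hθ' hd.le
    linarith
  constructor
  · intro hjk
    have hd : (0 : ℝ) < (k : ℝ) - j := sub_pos.2 (by exact_mod_cast hjk)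
    have hW := bridge_sub_bridge x (s := s) (e := e) (i := j) (j := k) (by omega) hjk.le
    have ea : (j : ℝ) - s + 1 = p - (k - j) := by rw [hpdef]; ring
    have eb : (e : ℝ) - j = q + (k - j) := by rw [hqdef]; ring
    have hwa : (w : ℝ) ≤ p - (k - j) := by
      rw [← ea]
      have : (s : ℝ) + w ≤ j := by exact_mod_cast hjm.1
      linarith
    rw [bridge_jump_left (by omega) (by omega) hf₁ hf₂ (show s ≤ k + 1 by omega) le_rfl,
      bridge_jump_left (by omega) (by omega) hf₁ hf₂ (show s ≤ j + 1 by omega) hjk.le, ← hpdef,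
      ← hqdef, ← hΔ, ea, eb, ← sub_eq_add_neg, ← sub_eq_add_neg, sub_sq_comm,
      sub_sq_comm V] at hcmp
    -- Beyond half of the stretch the uniform noise bound already contradicts `hfar`; only nearby
    -- maximisers need the sharper comparison.
    rcases le_or_gt ((k : ℝ) - j) (p / 2) with hnear | hfar'
    · refine hfinish hd ?_
      rw [← hW]
      exact jump_mul_le_of_cusum_le hρ hρ1 hn0 hp hq hpq hd hnear hΔ0 (hU.trans hbig')
        (hV.trans hbig') hcmp
    · exact absurd (jump_sq_mul_le_of_cusum_le hρ hn0 hp hq hpq hfar'.le (by linarith) hwa hU hV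
        hcmp) hcontr
  · intro hkj
    have hd : (0 : ℝ) < (j : ℝ) - k := sub_pos.2 (by exact_mod_cast hkj)
    have hW := bridge_sub_bridge x (s := s) (e := e) (i := k) (j := j) (by omega) hkj.le
    have ea : (j : ℝ) - s + 1 = p + (j - k) := by rw [hpdef]; ring
    have eb : (e : ℝ) - j = q - (j - k) := by rw [hqdef]; ring
    have hwa : (w : ℝ) ≤ q - (j - k) := by
      rw [← eb]
      have : (j : ℝ) + w ≤ e := by exact_mod_cast (by omega : j + w ≤ e)
      linarith
    -- The mirror image, with `p` and `q` exchanged.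
    rw [bridge_jump_right (by omega) (by omega) hf₁ hf₂ le_rfl (show k ≤ e by omega),
      bridge_jump_right (by omega) (by omega) hf₁ hf₂ hkj.le (show j ≤ e by omega), ← hpdef,
      ← hqdef, ← hΔ, ea, eb, ← sub_eq_add_neg, ← sub_eq_add_neg, sub_sq_comm,
      sub_sq_comm V, mul_comm p q, mul_comm (p + ((j : ℝ) - k))] at hcmp
    rcases le_or_gt ((j : ℝ) - k) (q / 2) with hnear | hfar'
    · refine hfinish hd ?_
      rw [← hW, abs_sub_comm (bridge x s e j)]
      exact jump_mul_le_of_cusum_le hρ hρ1 hn0 hq hp (by linarith) hd hnear hΔ0 (hU.trans hbig')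
        (hV.trans hbig') hcmp
    · exact absurd (jump_sq_mul_le_of_cusum_le hρ hn0 hq hp (by linarith) hfar'.le (by linarith) hwa
        hU hV hcmp) hcontr

/-! ### Asymptotics -/

lemma tendsto_mul_sq_atTop {δ : ℕ → ℝ} {φ : ℝ} (hφ : 1 < φ)
    (hδ : Tendsto (fun n : ℕ => (n : ℝ) ^ (2 - φ) * δ n ^ 2) atTop atTop) :
    Tendsto (fun n : ℕ => (n : ℝ) * δ n ^ 2) atTop atTop := by
  refine tendsto_atTop_mono' _ ?_ hδ
  filter_upwards [eventually_ge_atTop 1] with n hn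
  have hn' : (1 : ℝ) ≤ n := by exact_mod_cast hn
  refine mul_le_mul_of_nonneg_right ?_ (sq_nonneg _)
  calc (n : ℝ) ^ (2 - φ) ≤ (n : ℝ) ^ (1 : ℝ) := Real.rpow_le_rpow_of_exponent_le hn' (by linarith)
    _ = n := Real.rpow_one _

/-- Applied at `x = n δ ^ 2`, this puts the threshold below the level reached at change-points. -/
lemma eventually_rpow_lt_mul_sub {γ a b : ℝ} (hγ : γ < 1) (ha : 0 < a) :
    ∀ᶠ x : ℝ in atTop, x ^ γ < a * x - b := by
  have h1 : Tendsto (fun x : ℝ => x ^ (-(1 - γ))) atTop (𝓝 0) :=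
    tendsto_rpow_neg_atTop (by linarith)
  filter_upwards [h1.eventually (gt_mem_nhds (half_pos ha)), eventually_gt_atTop 0,
    eventually_gt_atTop (2 * b / a)] with x hx hx0 hxb
  have e1 : x ^ γ = x ^ (-(1 - γ)) * x := by
    conv_rhs => rw [← Real.rpow_one x]
    rw [← Real.rpow_mul hx0.le, ← Real.rpow_add hx0]
    congr 1
    ring
  rw [div_lt_iff₀ ha] at hxb
  have := mul_lt_mul_of_pos_right hx hx0
  rw [e1]
  linarith

/-- The window length `w` of the refinement inherits the rate conditions of `ι`. -/
lemma tendsto_div_sq_of_isBigO {ι δ : ℕ → ℝ} {w : ℕ → ℕ} (hι : ∀ n, 0 < ι n)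
    (hι2 : Tendsto (fun n : ℕ => (n : ℝ) / (ι n ^ 2 * δ n ^ 2)) atTop (𝓝 0))
    (hw : ι =O[atTop] (fun n => (w n : ℝ))) :
    (∀ᶠ n in atTop, 1 ≤ w n) ∧
    Tendsto (fun n : ℕ => (n : ℝ) / ((w n : ℝ) ^ 2 * δ n ^ 2)) atTop (𝓝 0) := by
  obtain ⟨C, hC, hCw⟩ := hw.exists_pos
  rw [isBigOWith_iff] at hCw
  have hle : ∀ᶠ n in atTop, ι n ≤ C * w n := by
    filter_upwards [hCw] with n hn
    rwa [Real.norm_of_nonneg (hι n).le, Real.norm_of_nonneg (Nat.cast_nonneg _)] at hn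
  have hpos : ∀ᶠ n in atTop, 1 ≤ w n := by
    filter_upwards [hle] with n hn
    by_contra hcon
    have h0 : w n = 0 := by omega
    rw [h0, Nat.cast_zero, mul_zero] at hn
    exact absurd (hι n) (not_lt.2 hn)
  refine ⟨hpos, ?_⟩
  have h2 := hι2.const_mul (C ^ 2)
  rw [mul_zero] at h2
  refine tendsto_of_tendsto_of_tendsto_of_le_of_le' tendsto_const_nhds h2
    (Eventually.of_forall fun n => by positivity) ?_
  filter_upwards [hle, hpos] with n hn hwn
  rcases eq_or_ne (δ n) 0 with h0 | h0
  · simp [h0]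
  have hw0 : (0 : ℝ) < w n := by exact_mod_cast hwn
  have hι0 := hι n
  rw [mul_div_assoc', div_le_div_iff₀ (by positivity) (by positivity)]
  have e1 : ι n ^ 2 ≤ (C * w n) ^ 2 := pow_le_pow_left₀ hι0.le hn 2
  calc (n : ℝ) * (ι n ^ 2 * δ n ^ 2) ≤ n * ((C * w n) ^ 2 * δ n ^ 2) := by gcongr
    _ = _ := by ring

/-- If the first-stage estimates are close to the change-points, an error of the refined
estimator is explained by large partial sums of the noise next to the change-point. -/
lemma jump_mul_le_of_near {x f : ℤ → ℝ} {v : ℕ → ℝ} {m : ℕ} {κ : ℕ → ℤ} {n h : ℤ} {w : ℕ}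
    {A b ρ₀ ρ : ℝ} (hreg : RegularNoise x n A b ρ₀) (hA : 0 < A) (hρ0 : 0 < ρ) (hρ1 : ρ ≤ 1)
    (hseg : IsSegmentation f v m κ n (h + 4 * w)) (hw : 1 ≤ w) (hh : 0 ≤ h)
    (hρh : ρ * n ≤ h) {G : ℕ → ℤ} (hG : ∀ i ∈ Finset.Ioo 0 (m + 1), |G i - κ i| < w)
    {kt : ℕ → ℤ} {i : ℕ} (hi : i ∈ Finset.Icc 1 m)
    (hkt : ∀ i ∈ Finset.Icc 1 ((Finset.Ioo 0 (m + 1)).image G).card,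
      (∃ j, IsCusumArgmax (fun t => x t + f t) (localLeft n w ((Finset.Ioo 0 (m + 1)).image G) i)
        (localRight n w ((Finset.Ioo 0 (m + 1)).image G) i) w j) →
      IsCusumArgmax (fun t => x t + f t) (localLeft n w ((Finset.Ioo 0 (m + 1)).image G) i)
        (localRight n w ((Finset.Ioo 0 (m + 1)).image G) i) w (kt i))
    (hbig : 64 * (A * √n) ≤ ρ ^ 2 * |v (i + 1) - v i| * n)
    (hfar : 52 * (16 * A ^ 2) < (v (i + 1) - v i) ^ 2 * ρ ^ 3 * w) :
    (kt i < κ i → |v (i + 1) - v i| * ((κ i : ℝ) - kt i)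
      ≤ 6 * |∑ t ∈ Finset.Icc (kt i + 1) (κ i), x t|) ∧
    (κ i < kt i → |v (i + 1) - v i| * ((kt i : ℝ) - κ i)
      ≤ 6 * |∑ t ∈ Finset.Icc (κ i + 1) (kt i), x t|) := by
  have hi' := Finset.mem_Icc.1 hi
  obtain ⟨hcard, b1, b2, b3, b4⟩ := local_interval_bounds hseg (by exact_mod_cast hw)
    (by omega) hG hi'.1 hi'.2
  have hkt' := hkt i (Finset.mem_Icc.2 ⟨hi'.1, by rw [hcard]; exact hi'.2⟩)
  generalize localLeft n w ((Finset.Ioo 0 (m + 1)).image G) i = s at *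
  generalize localRight n w ((Finset.Ioo 0 (m + 1)).image G) i = e at *
  have hs1 := hseg.spacing (i - 1) (by omega)
  rw [Nat.sub_add_cancel hi'.1] at hs1
  have hs2 := hseg.spacing i hi'.2
  have hm1 := hseg.mono (show 0 ≤ i - 1 by omega) (by omega)
  have hm2 := hseg.mono (show i + 1 ≤ m + 1 by omega) le_rfl
  rw [hseg.zero] at hm1
  rw [hseg.last] at hm2
  have hkmem : κ i ∈ Finset.Icc (s + w) (e - w) := Finset.mem_Icc.2 ⟨by omega, by omega⟩
  obtain ⟨j, hj, hjmax⟩ := Finset.exists_max_image _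
    (fun k' => cusum (fun t => x t + f t) s e k' ^ 2) ⟨_, hkmem⟩
  refine jump_mul_le_of_isCusumArgmax hreg hA hρ0 hρ1 (show 1 ≤ s by omega)
    (show e ≤ n by omega) hw ?_ ?_ (by omega) (by omega) ?_ ?_ hbig hfar (hkt' ⟨j, hj, hjmax⟩)
  · have : ((h : ℤ) : ℝ) ≤ ((κ i - s + 1 : ℤ) : ℝ) := by exact_mod_cast (by omega)
    push_cast at this
    linarith
  · have : ((h : ℤ) : ℝ) ≤ ((e - κ i : ℤ) : ℝ) := by exact_mod_cast (by omega)
    push_cast at this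
    linarith
  · intro t h1 h2
    have := hseg.eq (i - 1) (by omega) t (by omega) (by rwa [Nat.sub_add_cancel hi'.1])
    rwa [Nat.sub_add_cancel hi'.1] at this
  · intro t h1 h2
    exact hseg.eq i hi'.2 t h1 (by omega)

set_option maxHeartbeats 1000000 in
/-- In large samples with regular noise, an error of the refined estimator is explained by large
partial sums of the noise next to the change-point. -/
lemma eventually_jump_mul_le {φ : ℝ} (hφ1 : 1 < φ)
    {m : ℕ} {k : ℕ → ℕ → ℤ} (hk0 : ∀ n, k n 0 = 0) (hkm : ∀ n : ℕ, k n (m + 1) = n)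
    {τ : ℕ → ℝ} (hτ0 : τ 0 = 0) (hτm : τ (m + 1) = 1)
    (hkτ : ∀ i ∈ Finset.Icc 1 m, Tendsto (fun n : ℕ => (k n i : ℝ) / n) atTop (𝓝 (τ i)))
    {ε : ℝ} (hε0 : 0 < ε) (hε1 : ε < 1 / 2)
    (hspacing : ∀ i ∈ Finset.Icc 1 (m + 1), ε < τ i - τ (i - 1))
    {μ : ℕ → ℕ → ℝ} {δ : ℕ → ℝ} {c : ℕ → ℝ} (hc : ∀ i ∈ Finset.Icc 1 m, c i ≠ 0)
    (hμ : ∀ n, ∀ i ∈ Finset.Icc 1 m, μ n (i + 1) - μ n i = c i * δ n)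
    (hδ : Tendsto (fun n : ℕ => (n : ℝ) ^ (2 - φ) * δ n ^ 2) atTop atTop)
    {γ : ℝ} (hγ0 : 0 < γ) (hγ1 : γ < 1) {w : ℕ → ℕ} (hw1 : ∀ᶠ n in atTop, 1 ≤ w n)
    (hwδ : Tendsto (fun n : ℕ => (n : ℝ) / ((w n : ℝ) ^ 2 * δ n ^ 2)) atTop (𝓝 0))
    (hw2 : (fun n => (w n : ℝ)) =o[atTop] (fun n : ℕ => (n : ℝ))) {A b : ℝ} (hA : 0 < A)
    (hb : 0 < b) :
    ∀ᶠ n : ℕ in atTop, ∀ (x : ℤ → ℝ) (S : Finset ℤ) (kt : ℕ → ℤ), RegularNoise x n A b (ε / 8) →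
      SNCPOutput (fun t => x t + segmentMean m (k n) (μ n) t) n ⌊(n : ℝ) * ε⌋
        (((n : ℝ) * δ n ^ 2) ^ γ) 1 n S →
      (∀ i ∈ Finset.Icc 1 S.card, (∃ j, IsCusumArgmax
          (fun t => x t + segmentMean m (k n) (μ n) t) (localLeft n (w n) S i)
          (localRight n (w n) S i) (w n) j) →
        IsCusumArgmax (fun t => x t + segmentMean m (k n) (μ n) t) (localLeft n (w n) S i)
          (localRight n (w n) S i) (w n) (kt i)) →
      ∀ i ∈ Finset.Icc 1 m,
        (kt i < k n i → |c i * δ n| * ((k n i : ℝ) - kt i)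
          ≤ 6 * |∑ t ∈ Finset.Icc (kt i + 1) (k n i), x t|) ∧
        (k n i < kt i → |c i * δ n| * ((kt i : ℝ) - k n i)
          ≤ 6 * |∑ t ∈ Finset.Icc (k n i + 1) (kt i), x t|) := by
  have hx := tendsto_mul_sq_atTop hφ1 hδ
  have hwn : Tendsto (fun n => (w n : ℝ) / n) atTop (𝓝 0) := hw2.tendsto_div_nhds_zero
  have hkτ' : ∀ i ≤ m + 1, Tendsto (fun n : ℕ => (k n i : ℝ) / n) atTop (𝓝 (τ i)) := by
    intro i hi
    rcases Nat.eq_zero_or_pos i with rfl | hi0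
    · simp [hk0, hτ0]
    rcases hi.lt_or_eq with hlt | rfl
    · exact hkτ i (Finset.mem_Icc.2 ⟨hi0, by omega⟩)
    · rw [hτm]
      refine tendsto_const_nhds.congr' ?_
      filter_upwards [eventually_gt_atTop 0] with n hn
      rw [hkm, Int.cast_natCast, div_self (by positivity)]
  -- The limiting spacings exceed `ε` strictly, and the surplus, of order `n`, absorbs `4 w = o(n)`.
  have hsp : ∀ i ∈ Finset.range (m + 1), ∀ᶠ n : ℕ in atTop,
      k n i + (⌊(n : ℝ) * ε⌋ + 4 * w n) ≤ k n (i + 1) := by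
    intro i hi
    rw [Finset.mem_range] at hi
    have h1 := ((hkτ' (i + 1) (by omega)).sub (hkτ' i (by omega))).sub (hwn.const_mul 4)
    have h2 := hspacing (i + 1) (Finset.mem_Icc.2 ⟨by omega, by omega⟩)
    rw [Nat.add_sub_cancel] at h2
    filter_upwards [h1.eventually (lt_mem_nhds (a := ε) (by linarith)), eventually_gt_atTop 0]
      with n hn hn0
    have hn' : (0 : ℝ) < n := by positivity
    have h3 : (n : ℝ) * ε < k n (i + 1) - k n i - 4 * w n := by
      have := mul_lt_mul_of_pos_right hn hn'
      field_simp at this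
      linarith
    have h4 : ((k n i + (⌊(n : ℝ) * ε⌋ + 4 * w n) : ℤ) : ℝ) ≤ k n (i + 1) := by
      push_cast
      linarith [Int.floor_le ((n : ℝ) * ε)]
    exact_mod_cast h4
  obtain ⟨c₀, hc₀, hcmin⟩ : ∃ c₀ : ℝ, 0 < c₀ ∧ ∀ i ∈ Finset.Icc 1 m, c₀ ≤ c i ^ 2 := by
    rcases (Finset.Icc 1 m).eq_empty_or_nonempty with hem | hne
    · exact ⟨1, one_pos, by simp [hem]⟩
    · obtain ⟨i, hi, hmin⟩ := Finset.exists_min_image _ (fun i => c i ^ 2) hne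
      exact ⟨c i ^ 2, by have := hc i hi; positivity, hmin⟩
  -- With `l = ⌊n ε / 4⌋`, at least `n ε / 8` once `n ε ≥ 8`, this gives `n ≤ Λ * l`, while `4 l ≤
  -- h`.
  set Λ : ℝ := 8 / ε with hΛ
  set C₀ : ℝ := 2 * A ^ 2 * Λ ^ 2 / b + 80 * Λ * (1 + 2 * A ^ 2 * Λ / b) with hC₀
  have hΛ0 : 0 < Λ := by positivity
  have hC₀0 : 0 < C₀ := by positivity
  set a : ℝ := c₀ / (8 * A ^ 2 * Λ ^ 2) with ha
  have ha0 : 0 < a := by positivity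
  set ρ : ℝ := ε / 2 with hρ
  have hρ0 : 0 < ρ := by positivity
  have hK := (tendsto_rpow_atTop hγ0).comp hx
  -- The first bound keeps the statistics at distance `w` below those at change-points; the second
  -- supplies the lower bound on `δ ^ 2 * w` that excludes distant maximisers.
  have hηpos : 0 < min (a / (2 * C₀)) (c₀ * ρ ^ 3 / (52 * (16 * A ^ 2))) := by positivity
  filter_upwards [(Finset.eventually_all (Finset.range (m + 1))).2 hsp, hw1,
    hx.eventually (eventually_rpow_lt_mul_sub (b := 1 / 4) hγ1 ha0),
    hK.eventually_ge_atTop (C₀ * (1 + Λ ^ 2)),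
    hwδ.eventually (gt_mem_nhds hηpos),
    hx.eventually_gt_atTop (2 * (C₀ + 1 / 4) / a),
    hx.eventually_ge_atTop ((64 * A / ρ ^ 2) ^ 2 / c₀),
    hx.eventually_gt_atTop 0,
    hwn.eventually (gt_mem_nhds (by positivity : 0 < ε / 8)),
    eventually_ge_atTop (⌈8 / ε⌉₊ + 1)] with n e_sp e_w1 e_KL e_vK e_wδ e_UL e_big e_x0 e_wn e_n
  intro x S kt hreg hS hkt i hi
  have hn8 : 8 / ε ≤ n := (Nat.le_ceil _).trans (by exact_mod_cast (by omega : ⌈8 / ε⌉₊ ≤ n))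
  have hn0 : (0 : ℝ) < n := lt_of_lt_of_le (by positivity) hn8
  have hn8' : 8 ≤ n * ε := by rwa [div_le_iff₀ hε0] at hn8
  have hwn' : (w n : ℝ) ≤ n * (ε / 8) := by
    rw [div_lt_iff₀ hn0] at e_wn
    linarith
  have hw0 : (1 : ℝ) ≤ w n := by exact_mod_cast e_w1
  have hδ0 : δ n ≠ 0 := by
    intro h0
    simp [h0] at e_x0
  obtain ⟨h, hh⟩ : ∃ h : ℤ, h = ⌊(n : ℝ) * ε⌋ := ⟨_, rfl⟩
  obtain ⟨l, hl⟩ : ∃ l : ℕ, l = ⌊(n : ℝ) * ε / 4⌋₊ := ⟨_, rfl⟩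
  rw [← hh] at hS e_sp
  have hl1 : (l : ℝ) ≤ n * ε / 4 := hl ▸ Nat.floor_le (by positivity)
  have hl2 : (n : ℝ) * ε / 4 < l + 1 := hl ▸ Nat.lt_floor_add_one _
  have hh2 : (n : ℝ) * ε < h + 1 := hh ▸ Int.lt_floor_add_one _
  have hll : 1 ≤ l := by
    have : (0 : ℝ) < l := by linarith
    exact_mod_cast this
  have hlh : 4 * (l : ℤ) ≤ h := by
    rw [hh, Int.le_floor]
    push_cast
    linarith
  have hlw : (l : ℤ) + 2 * w n ≤ h := by
    rw [hh, Int.le_floor]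
    push_cast
    linarith
  have hwl : (w n : ℝ) ≤ l := by linarith
  have hΛl : ((n : ℤ) : ℝ) ≤ Λ * l := by
    rw [hΛ, Int.cast_natCast, div_mul_eq_mul_div, le_div_iff₀ hε0]
    linarith
  have hρl : ε / 8 * ((n : ℤ) : ℝ) ≤ l := by
    rw [Int.cast_natCast]
    linarith
  have hseg : IsSegmentation (segmentMean m (k n) (μ n)) (μ n) m (k n) n (h + 4 * w n) :=
    IsSegmentation.of_spacing (hk0 n) (hkm n) (by omega)
      fun i hi => e_sp i (Finset.mem_range.2 (by omega))
  have hglarge : 4 * (l : ℤ) ≤ h + 4 * w n := by omega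
  set y : ℤ → ℝ := fun t => x t + segmentMean m (k n) (μ n) t with hy
  set K : ℝ := ((n : ℝ) * δ n ^ 2) ^ γ with hKdef
  have hbound : ∀ {q : ℝ}, 0 < q → q ≤ l → ∀ t₁ k' t₂ : ℤ, 1 ≤ t₁ → t₁ + h ≤ k' + 1 →
      k' + h ≤ t₂ → t₂ ≤ n → (∀ i ∈ Finset.Icc 1 m, q ≤ |(k' : ℝ) - k n i|) →
      statT y t₁ k' t₂ ≤ C₀ * (1 + (n / q) ^ 2) := by
    intro q hq hql t₁ k' t₂ h1 h2 h3 h4 h5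
    have := statT_le hreg hseg hb hll hglarge hρl hΛl h1 (show t₁ + 4 * l ≤ k' + 1 by omega)
      (show k' + 4 * l ≤ t₂ by omega) h4 hq hql h5
    rwa [Int.cast_natCast] at this
  have hcast : ∀ {q : ℕ} {k' : ℤ}, (∀ i ∈ Finset.Icc 1 m, (q : ℤ) ≤ |k' - k n i|) →
      ∀ i ∈ Finset.Icc 1 m, (q : ℝ) ≤ |(k' : ℝ) - k n i| := by
    intro q k' h i hi
    have := h i hi
    have h' : (((q : ℤ)) : ℝ) ≤ ((|k' - k n i| : ℤ) : ℝ) := by exact_mod_cast this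
    simpa using h'
  -- The point is `(n / w) ^ 2 = n δ ^ 2 · n / (w ^ 2 δ ^ 2)`, with second factor at most `a / (2
  -- C₀)`; half of `a n δ ^ 2` is left for the constants.
  have hUL : C₀ * (1 + (n / (w n : ℝ)) ^ 2) < a * (n * δ n ^ 2) - 1 / 4 := by
    have e1 := e_wδ.trans_le (min_le_left _ _)
    have e2 : ((n : ℝ) / w n) ^ 2 = n * δ n ^ 2 * (n / ((w n : ℝ) ^ 2 * δ n ^ 2)) := by
      have : (w n : ℝ) ≠ 0 := by linarith
      field_simp
    rw [div_lt_iff₀ ha0] at e_UL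
    have e3 : C₀ * (n / (w n : ℝ)) ^ 2 ≤ a / 2 * (n * δ n ^ 2) := by
      rw [e2]
      calc C₀ * (n * δ n ^ 2 * (n / ((w n : ℝ) ^ 2 * δ n ^ 2)))
          ≤ C₀ * (n * δ n ^ 2 * (a / (2 * C₀))) := by gcongr
        _ = _ := by field_simp
    linarith
  obtain ⟨G, hG, rfl⟩ := SNCPOutput.exists_near (y := y) (n := n) (h := h) (w := w n) (l := l)
    (K := K) (U := C₀ * (1 + (n / (w n : ℝ)) ^ 2)) (Lo := a * (n * δ n ^ 2) - 1 / 4)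
    hseg (by exact_mod_cast e_w1) (by exact_mod_cast hll) hlw le_rfl (by positivity)
    (by positivity) e_KL hUL
    (fun t₁ k' t₂ h1 h2 h3 h4 h5 =>
      hbound (by linarith) hwl t₁ k' t₂ h1 h2 h3 h4 (hcast h5))
    (fun t₁ k' t₂ h1 h2 h3 h4 h5 => by
      have hl0 : (0 : ℝ) < l := by linarith
      refine (hbound hl0 le_rfl t₁ k' t₂ h1 h2 h3 h4 (hcast h5)).trans
        (le_trans ?_ e_vK)
      have : (n : ℝ) / l ≤ Λ := by
        rw [div_le_iff₀ hl0]
        simpa using hΛl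
      gcongr)
    (fun i hi => by
      have hi' := Finset.mem_Icc.1 hi
      have := le_statT hreg hseg hA hb hll hglarge hρl hΛl hlh (show h ≤ h + 4 * w n by omega)
        hi'.1 hi'.2
      refine le_trans ?_ this
      rw [hμ n i hi, mul_pow, Int.cast_natCast]
      refine sub_le_sub_right ?_ _
      rw [ha, div_mul_eq_mul_div]
      refine div_le_div_of_nonneg_right ?_ (by positivity)
      calc c₀ * (n * δ n ^ 2) ≤ c i ^ 2 * (n * δ n ^ 2) :=
            mul_le_mul_of_nonneg_right (hcmin i hi) e_x0.le
        _ = n * (c i ^ 2 * δ n ^ 2) := by ring)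
    hS 0 (m + 1) (by omega) le_rfl (by rw [hk0]; simpa using Nat.pos_of_ne_zero (by omega))
    (by rw [hkm]; simpa using Nat.pos_of_ne_zero (by omega)) le_rfl le_rfl
  have hi' := Finset.mem_Icc.1 hi
  have hci := hcmin i hi
  have hsqμ : (μ n (i + 1) - μ n i) ^ 2 = c i ^ 2 * δ n ^ 2 := by rw [hμ n i hi, mul_pow]
  rw [← hμ n i hi]
  refine jump_mul_le_of_near hreg hA hρ0 (by linarith) hseg e_w1 (by omega) ?_ hG hi hkt ?_ ?_
  · rw [hρ, Int.cast_natCast]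
    linarith
  · rw [Int.cast_natCast]
    have hsq : √(n : ℝ) ^ 2 = n := Real.sq_sqrt hn0.le
    have hsq0 : 0 < √(n : ℝ) := Real.sqrt_pos.2 hn0
    have e1 : (64 * A / ρ ^ 2) ^ 2 ≤ (|μ n (i + 1) - μ n i| * √n) ^ 2 := by
      rw [mul_pow, sq_abs, hsqμ, hsq]
      rw [div_le_iff₀ hc₀] at e_big
      have : n * δ n ^ 2 * c₀ ≤ n * δ n ^ 2 * c i ^ 2 := by gcongr
      linarith
    have e2 := abs_le_of_sq_le_sq' e1 (by positivity)
    have e3 := e2.2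
    rw [div_le_iff₀ (by positivity)] at e3
    have e4 := mul_le_mul_of_nonneg_right e3 hsq0.le
    calc 64 * (A * √n) = 64 * A * √n := by ring
      _ ≤ |μ n (i + 1) - μ n i| * √n * ρ ^ 2 * √n := e4
      _ = ρ ^ 2 * |μ n (i + 1) - μ n i| * √n ^ 2 := by ring
      _ = _ := by rw [hsq]
  -- Because `w ≤ n`, smallness of `n / (w ^ 2 δ ^ 2)` implies smallness of `1 / (w δ ^ 2)`.
  · have e1 := e_wδ.trans_le (min_le_right _ _)
    rw [div_lt_div_iff₀ (by positivity) (by positivity)] at e1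
    have e2 : (w n : ℝ) * (52 * (16 * A ^ 2)) ≤ n * (52 * (16 * A ^ 2)) := by
      gcongr
      exact_mod_cast hwn'.trans (mul_le_of_le_one_right hn0.le (by linarith))
    have e3 : (w n : ℝ) * (52 * (16 * A ^ 2)) < w n * (c₀ * δ n ^ 2 * ρ ^ 3 * w n) := by
      refine e2.trans_lt (e1.trans_le (le_of_eq (by ring)))
    have e4 := lt_of_mul_lt_mul_left e3 (by linarith)
    refine e4.trans_le ?_
    rw [hsqμ]
    gcongr

/-! ### The rate of the refined estimators -/

/-- A maximal inequality for the partial sums of a stationary process next to a given time. -/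
lemma exists_measure_sum_Icc_ge_le {Ω : Type*} [MeasurableSpace Ω] {P : Measure Ω}
    [IsFiniteMeasure P] {X : ℤ → Ω → ℝ} (hstat : IsStrictlyStationary X P)
    (hL2 : ∀ t, MemLp (X t) 2 P) {C φ : ℝ} (hφ1 : 1 < φ) (hφ2 : φ < 2)
    (hmoment : ∀ i j : ℤ, 1 ≤ i → i ≤ j →
      ∫ ω, (∑ t ∈ Finset.Icc i j, X t ω) ^ 2 ∂P ≤ C * ((j : ℝ) - i + 1) ^ φ) :
    ∃ K : ℝ, 0 < K ∧ ∀ (k : ℤ) (L d₀ : ℝ), 0 < L → 0 < d₀ →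
      P {ω | ∃ j : ℤ, d₀ < |(j : ℝ) - k| ∧
        ((j < k → L * ((k : ℝ) - j) ≤ |∑ t ∈ Finset.Icc (j + 1) k, X t ω|) ∧
         (k < j → L * ((j : ℝ) - k) ≤ |∑ t ∈ Finset.Icc (k + 1) j, X t ω|))}
        ≤ ENNReal.ofReal (K * d₀ ^ (φ - 2) / L ^ 2) := by
  have hC : 0 ≤ C := by
    have h1 := hmoment 1 1 le_rfl le_rfl
    have h2 : 0 ≤ ∫ ω, (∑ t ∈ Finset.Icc (1 : ℤ) 1, X t ω) ^ 2 ∂P :=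
      integral_nonneg fun ω => sq_nonneg _
    simp only [Int.cast_one, sub_self, zero_add, Real.one_rpow, mul_one] at h1
    exact h2.trans h1
  obtain ⟨K, hK, hmax⟩ := exists_measure_sum_ge_le (P := P) hC hφ1 hφ2
  refine ⟨2 * K, by positivity, fun k L d₀ hL hd => ?_⟩
  have hφ0 : 0 < φ := by linarith
  have hright := hmax (fun t => X (k + 1 + t)) (fun t => hL2 _) (fun i l => by
    have := hstat.integral_sq_sum_le hφ0 hmoment (k + 1 + i) l
    simpa only [Nat.cast_add, add_assoc] using this) L d₀ hL hd
  have hleft := hmax (fun t => X (k - t)) (fun t => hL2 _) (fun i l => by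
    have := hstat.integral_sq_sum_sub_le hφ0 hmoment (k - i) l
    simpa only [Nat.cast_add, sub_sub] using this) L d₀ hL hd
  have hsum : ENNReal.ofReal (2 * K * d₀ ^ (φ - 2) / L ^ 2)
      = ENNReal.ofReal (K * d₀ ^ (φ - 2) / L ^ 2) + ENNReal.ofReal (K * d₀ ^ (φ - 2) / L ^ 2) := by
    rw [← ENNReal.ofReal_add (by positivity) (by positivity)]
    congr 1
    ring
  rw [hsum]
  refine le_trans (measure_mono ?_) ((measure_union_le _ _).trans (add_le_add hleft hright))
  rintro ω ⟨j, hj, h1, h2⟩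
  rcases lt_trichotomy j k with hlt | rfl | hlt
  · left
    obtain ⟨d, rfl⟩ : ∃ d : ℕ, j = k - d := ⟨(k - j).toNat, by omega⟩
    have e1 : ∑ t ∈ Finset.range d, X (k - t) ω = ∑ t ∈ Finset.Icc (k - d + 1) k, X t ω := by
      have := sum_range_int_eq_sum_Icc (fun t => X t ω) (k - d + 1) d
      rw [show k - d + 1 + (d : ℤ) - 1 = k by ring] at this
      rw [← this, ← Finset.sum_range_reflect]
      refine Finset.sum_congr rfl fun t ht => ?_
      rw [Finset.mem_range] at ht
      congr 1
      omega
    have e2 : (k : ℝ) - ((k - d : ℤ) : ℝ) = d := by push_cast; ring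
    refine ⟨d, by omega, ?_, ?_⟩
    · rw [abs_sub_comm, e2, Nat.abs_cast] at hj
      exact hj
    · have := h1 hlt
      rwa [e2, ← e1] at this
  · simp only [sub_self, abs_zero] at hj
    exact absurd hj hd.not_gt
  · right
    obtain ⟨d, rfl⟩ : ∃ d : ℕ, j = k + d := ⟨(j - k).toNat, by omega⟩
    have e1 : ∑ t ∈ Finset.range d, X (k + 1 + t) ω = ∑ t ∈ Finset.Icc (k + 1) (k + d), X t ω := by
      rw [sum_range_int_eq_sum_Icc (fun t => X t ω)]
      congr 2
      ring
    have e2 : ((k + d : ℤ) : ℝ) - k = d := by push_cast; ring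
    refine ⟨d, by omega, ?_, ?_⟩
    · rw [e2, Nat.abs_cast] at hj
      exact hj
    · have := h2 hlt
      rwa [e2, ← e1] at this

lemma exists_mul_rpow_le {a p η : ℝ} (hp : p < 0) (hη : 0 < η) :
    ∃ M : ℝ, 0 < M ∧ a * M ^ p ≤ η := by
  have h := (tendsto_rpow_neg_atTop (neg_pos.2 hp)).const_mul a
  simp only [neg_neg, mul_zero] at h
  obtain ⟨M, hM, hM0⟩ := ((h.eventually (gt_mem_nhds hη)).and (eventually_gt_atTop 0)).exists
  exact ⟨M, hM0, hM.le⟩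

theorem theoremS3
    {Ω : Type*} [MeasurableSpace Ω] (P : Measure Ω) [IsProbabilityMeasure P]
    -- the centred stationary noise with its moment bound
    (X : ℤ → Ω → ℝ) (hstat : IsStrictlyStationary X P)
    (hL2 : ∀ t, MemLp (X t) 2 P) (hmean : ∀ t, ∫ ω, X t ω ∂P = 0)
    (C φ : ℝ) (hφ1 : 1 < φ) (hφ2 : φ < 2)
    (hmoment : ∀ i j : ℤ, 1 ≤ i → i ≤ j →
      ∫ ω, (∑ t ∈ Finset.Icc i j, X t ω) ^ 2 ∂P ≤ C * ((j : ℝ) - i + 1) ^ φ)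
    -- the invariance principle with limit `σ B`, where `B` is a standard Brownian motion
    {Ω' : Type*} [MeasurableSpace Ω'] (P' : Measure Ω') [IsProbabilityMeasure P']
    (σ : ℝ) (hσ : 0 < σ) (B : NNReal → Ω' → ℝ) (hB : IsBrownianReal B P')
    (Z : Ω' → SkorokhodSpace)
    (hZ : ∀ᵐ ω' ∂P', ∀ r : unitInterval, Z ω' r = σ * B (unitInterval.toNNReal r) ω')
    (hFCLT : TendstoInDistribution (fun (n : ℕ) ω => partialSumPath (fun t => X t ω) n)
      atTop Z (fun _ => P) P')
    -- the change-points `k n 1 < … < k n m` and their limiting relative locations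
    (m : ℕ) (k : ℕ → ℕ → ℤ) (hk0 : ∀ n, k n 0 = 0) (hkm : ∀ n : ℕ, k n (m + 1) = n)
    (τ : ℕ → ℝ) (hτ0 : τ 0 = 0) (hτm : τ (m + 1) = 1)
    (hkτ : ∀ i ∈ Finset.Icc 1 m, Tendsto (fun n : ℕ => (k n i : ℝ) / n) atTop (𝓝 (τ i)))
    -- the window size parameter, smaller than the minimal spacing
    (ε : ℝ) (hε0 : 0 < ε) (hε1 : ε < 1 / 2)
    (hspacing : ∀ i ∈ Finset.Icc 1 (m + 1), ε < τ i - τ (i - 1))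
    -- the segment means and the change sizes `c i * δ n`
    (μ : ℕ → ℕ → ℝ) (δ : ℕ → ℝ) (c : ℕ → ℝ) (hc : ∀ i ∈ Finset.Icc 1 m, c i ≠ 0)
    (hμ : ∀ n, ∀ i ∈ Finset.Icc 1 m, μ n (i + 1) - μ n i = c i * δ n)
    (hδ : Tendsto (fun n : ℕ => (n : ℝ) ^ (2 - φ) * δ n ^ 2) atTop atTop)
    -- the observations
    (Y : ℕ → ℤ → Ω → ℝ) (hY : ∀ n t ω, Y n t ω = X t ω + segmentMean m (k n) (μ n) t)
    -- the SNCP estimates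
    (γ : ℝ) (hγ0 : 1 / 2 < γ) (hγ1 : γ < 1)
    (khat : ℕ → Ω → Finset ℤ)
    (hkhat : ∀ (n : ℕ) ω, SNCPOutput (fun t => Y n t ω) n ⌊(n : ℝ) * ε⌋
      (((n : ℝ) * δ n ^ 2) ^ γ) 1 n (khat n ω))
    -- the localization rate `ι` of SNCP and the sequence `w` used in the refinement
    (ι : ℕ → ℝ) (hι : ∀ n, 0 < ι n)
    (hι1 : Tendsto (fun n : ℕ => ι n / n) atTop (𝓝 0))
    (hι2 : Tendsto (fun n : ℕ => (n : ℝ) / (ι n ^ 2 * δ n ^ 2)) atTop (𝓝 0))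
    (w : ℕ → ℕ) (hw1 : ι =O[atTop] (fun n => (w n : ℝ)))
    (hw2 : (fun n => (w n : ℝ)) =o[atTop] (fun n : ℕ => (n : ℝ)))
    -- the locally refined estimates, whenever they are defined
    (ktilde : ℕ → Ω → ℕ → ℤ)
    (hktilde : ∀ (n : ℕ) ω, ∀ i ∈ Finset.Icc 1 (khat n ω).card,
      (∃ j, IsCusumArgmax (fun t => Y n t ω) (localLeft n (w n) (khat n ω) i)
        (localRight n (w n) (khat n ω) i) (w n) j) →
      IsCusumArgmax (fun t => Y n t ω) (localLeft n (w n) (khat n ω) i)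
        (localRight n (w n) (khat n ω) i) (w n) (ktilde n ω i)) :
    ∀ i ∈ Finset.Icc 1 m,
      IsBigOp P (fun n ω => (ktilde n ω i : ℝ) - k n i) (fun n => |δ n| ^ (2 / (φ - 2))) ∧
      ((∀ n, δ n = δ 0) →
        IsBigOp P (fun n ω => (ktilde n ω i : ℝ) / n - (k n i : ℝ) / n) (fun n => (n : ℝ)⁻¹)) := by
  intro i hi
  obtain ⟨hw, hwδ⟩ := tendsto_div_sq_of_isBigO hι hι2 hw1
  have hδ0 : ∀ᶠ n in atTop, δ n ≠ 0 := by
    filter_upwards [(tendsto_mul_sq_atTop hφ1 hδ).eventually_gt_atTop 0] with n hn h0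
    simp [h0] at hn
  have hci := hc i hi
  have hφ : φ - 2 < 0 := by linarith
  have hY' : ∀ (n : ℕ) ω, (fun t => Y n t ω) = fun t => X t ω + segmentMean m (k n) (μ n) t :=
    fun n ω => funext fun t => hY n t ω
  simp only [hY'] at hkhat hktilde
  have hmain : IsBigOp P (fun n ω => (ktilde n ω i : ℝ) - k n i)
      (fun n => |δ n| ^ (2 / (φ - 2))) := by
    intro η hη
    obtain ⟨A, b, hA, hb, hreg⟩ := exists_measure_not_regularNoise_le hσ.ne' hB hZ hFCLT
      (show 0 < ε / 8 by positivity) (half_pos hη)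
    obtain ⟨K, hK, hsum⟩ := exists_measure_sum_Icc_ge_le hstat hL2 hφ1 hφ2 hmoment
    obtain ⟨M, hM, hMη⟩ := exists_mul_rpow_le (a := 36 * K / c i ^ 2) hφ (half_pos hη)
    refine ⟨M, hM, ?_⟩
    filter_upwards [hδ0, hreg, eventually_jump_mul_le hφ1 hk0 hkm hτ0 hτm hkτ hε0 hε1 hspacing hc
      hμ hδ (by linarith) hγ1 hw hwδ hw2 hA hb] with n hδn hregn hjump
    have hδpos : 0 < |δ n| := abs_pos.2 hδn
    have hrate : 0 < M * |δ n| ^ (2 / (φ - 2)) := by positivity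
    have hL : 0 < |c i * δ n| / 6 := by positivity
    -- The rate is dictated by this cancellation: raised to the power `φ - 2` it produces `δ ^ 2`,
    -- which cancels against `L ^ 2`.
    have hval : K * (M * |δ n| ^ (2 / (φ - 2))) ^ (φ - 2) / (|c i * δ n| / 6) ^ 2
        = 36 * K / c i ^ 2 * M ^ (φ - 2) := by
      rw [Real.mul_rpow hM.le (by positivity), ← Real.rpow_mul hδpos.le,
        div_mul_cancel₀ _ hφ.ne, Real.rpow_two, div_pow, sq_abs, sq_abs, mul_pow]
      field_simp
      norm_num
    have hdev := (hsum (k n i) _ _ hL hrate).trans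
      (ENNReal.ofReal_le_ofReal (hval.le.trans hMη))
    rw [← add_halves η, ENNReal.ofReal_add (half_pos hη).le (half_pos hη).le]
    refine le_trans (measure_mono fun ω hω => ?_)
      ((measure_union_le _ _).trans (add_le_add hregn hdev))
    by_cases hx : RegularNoise (fun t => X t ω) n A b (ε / 8)
    · right
      obtain ⟨h1, h2⟩ := hjump _ _ _ hx (hkhat n ω) (hktilde n ω) i hi
      -- The deviation event ranges over all `j`, so the random estimate is itself an admissible
      -- witness.
      exact ⟨ktilde n ω i, hω, fun h => by linarith [h1 h], fun h => by linarith [h2 h]⟩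
    · left
      exact hx
  refine ⟨hmain, fun hconst η hη => ?_⟩
  obtain ⟨M, hM, h⟩ := hmain η hη
  obtain ⟨n₀, hn₀⟩ := hδ0.exists
  have hδ00 : 0 < |δ 0| := abs_pos.2 (hconst n₀ ▸ hn₀)
  -- For constant `δ` the rate is a fixed positive number, absorbed into the constant.
  refine ⟨M * |δ 0| ^ (2 / (φ - 2)), by positivity, ?_⟩
  filter_upwards [h, eventually_gt_atTop 0] with n hn hn0
  have hn' : (0 : ℝ) < n := by exact_mod_cast hn0
  refine le_trans (measure_mono fun ω hω => ?_) hn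
  rw [Set.mem_ofPred_eq, ← sub_div, abs_div, Nat.abs_cast, ← div_eq_mul_inv,
    div_lt_div_iff_of_pos_right hn'] at hω
  rwa [Set.mem_ofPred_eq, hconst n]
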